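/- Let $\Sigma=\{(t,r)\in\mathbb R^2: r>1\}$ carry the Schwarzschild string metric $$g_\Sigma=\frac{r-1}{r^3}\Big(dt+\frac{r\,dr}{r-1}\Big)\Big(dt-\frac{r\,dr}{r-1}\Big),$$ and let $H_\Sigma(\xi)=\tfrac12 g_\Sigma^{-1}(\xi,\xi)$ be its geodesic Hamiltonian on $T^*\Sigma$. **Theorem.** There exist a connected, Hausdorff, second countable real-analytic surface $S$, a real-analytic open embedding $\Sigma\hookrightarrow S$, and a real-analytic function $H:T^*S\to\mathbb R$ that extends $H_\Sigma$ (with respect to the induced embedding $T^*\Sigma\hookrightarrow T^*S$), such that the Hamiltonian flow of $H$ on $T^*S$ is timelike and null geodesically complete: through every covector with $H>0$ (timelike) or $H=0$ (null) there passes an integral curve of the flow defined for all values of the parameter in $\mathbb R$. Moreover, $S$ and $H$ can be obtained by gluing. The surface $S$ is covered by the following patches, which are real-analytic charts of $S$; here $\varepsilon,\delta\in\{1,-1\}$ and $W$ is the principal real branch of the Lambert function, $W(z)e^{W(z)}=z$, $W(z)\ge-1$. * Two disjoint Kruskal–Szekeres patches $K_{1},K_{-1}$, each with coordinates $(p,q)$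 ranging over $\{e\,pq>-1\}$, on which $r=1+W(pq)$ and $H$ is the geodesic Hamiltonian of $-4e^{-W(pq)}(1+W(pq))^{-3}\,dp\,dq$. The point $(t,r)$ of $\Sigma$ is the point $p=e^{(r+t-1)/2}\sqrt{r-1}$, $q=e^{(r-t-1)/2}\sqrt{r-1}$ of $K_1$. * Two patches across the singularity (one for each $\delta$), each with coordinates $(t,x)\in\mathbb R\times(-1,1)$, where $r=x^2$, on which, for the covector $T\,dt+X\,dx$, $$H=\frac{4x^6T^2-(x^2-1)^2X^2}{8(x^2-1)}.$$ The part $\varepsilon x>0$ is glued to $K_\varepsilon$ by $p=\delta e^{(x^2+t-1)/2}\sqrt{1-x^2}$, $q=-\delta e^{(x^2-t-1)/2}\sqrt{1-x^2}$. * Eight Eddington–Finkelstein patches across scri ($s=0$): for each pair $(\varepsilon,\delta)$ one with coordinates $(u,s)\in\mathbb R^2$ and one with coordinates $(v,s)\in\mathbb R^2$, on which $H$ is the geodesic Hamiltonian of $2\,du\,ds+s^2(1-s)\,du^2$, respectively $2\,dv\,ds+s^2(1-s)\,dv^2$. For $s>0$ they are glued to $K_\varepsilon$ by $r=1/s$,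 $pq=(r-1)e^{r-1}$ and $p=\delta e^{u/2}$, respectively $q=\delta e^{v/2}$. For $s<0$ the $(u,s)$ patches are glued to the $(v,s)$ patches, in pairs given by some bijection, by $u+v=2(r-1)+\ln\big((r-1)^2\big)$, $r=1/s$. -/

import Mathlib

open scoped Manifold ContDiff Topology Matrix

noncomputable section

namespace SchwarzschildString

/-! ### Cotangent bundles of surfaces and Hamilton's equations -/

/-- The cotangent bundle of a surface `S`: the total space of the bundle of real-valued continuous
linear forms on the tangent spaces.  It carries Mathlib's topology and real-analytic structure
(the bundle of homomorphisms from the tangent bundle to the trivial line bundle). -/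
abbrev CotangentBundle (S : Type) [TopologicalSpace S] [ChartedSpace (ℝ × ℝ) S]
    [IsManifold 𝓘(ℝ, ℝ × ℝ) ω S] : Type :=
  Bundle.TotalSpace ((ℝ × ℝ) →L[ℝ] ℝ)
    (fun z : S => TangentSpace 𝓘(ℝ, ℝ × ℝ) z →L[ℝ] Bundle.Trivial S ℝ z)

/-- The linear form `a dx₁ + b dx₂` on the plane. -/
def planeForm (ξ : ℝ × ℝ) : (ℝ × ℝ) →L[ℝ] ℝ :=
  ξ.1 • ContinuousLinearMap.fst ℝ ℝ ℝ + ξ.2 • ContinuousLinearMap.snd ℝ ℝ ℝ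

section Hamilton

variable {S : Type} [TopologicalSpace S] [ChartedSpace (ℝ × ℝ) S] [IsManifold 𝓘(ℝ, ℝ × ℝ) ω S]

/-- The covector of `S` whose canonical coordinates with respect to the chart `c = (x₁, x₂)` are
`(x₁, x₂, ξ₁, ξ₂)`, that is, the covector `ξ₁ dx₁ + ξ₂ dx₂` at the point with coordinates `x`. -/
def covectorAt (c : OpenPartialHomeomorph S (ℝ × ℝ)) (x ξ : ℝ × ℝ) : CotangentBundle S :=
  ⟨c.symm x, (planeForm ξ).comp (mfderiv 𝓘(ℝ, ℝ × ℝ) 𝓘(ℝ, ℝ × ℝ) c (c.symm x))⟩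

/-- At the parameter value `s`, the curve `γ` in the cotangent bundle obeys Hamilton's equations
for the Hamiltonian `H`, in the canonical coordinates `(x₁, x₂, ξ₁, ξ₂)` of an analytic chart
around it.  (The equations are invariant under changes of canonical coordinates, so it does not
matter which chart is used.) -/
def HamiltonEquationsAt (H : CotangentBundle S → ℝ) (γ : ℝ → CotangentBundle S) (s : ℝ) : Prop :=
  ∃ c ∈ IsManifold.maximalAtlas 𝓘(ℝ, ℝ × ℝ) ω S, ∃ x₁ x₂ ξ₁ ξ₂ : ℝ → ℝ,
    (∀ᶠ τ in 𝓝 s, (x₁ τ, x₂ τ) ∈ c.target ∧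
      γ τ = covectorAt c (x₁ τ, x₂ τ) (ξ₁ τ, ξ₂ τ)) ∧
    HasDerivAt x₁ (deriv (fun a => H (covectorAt c (x₁ s, x₂ s) (a, ξ₂ s))) (ξ₁ s)) s ∧
    HasDerivAt x₂ (deriv (fun a => H (covectorAt c (x₁ s, x₂ s) (ξ₁ s, a))) (ξ₂ s)) s ∧
    HasDerivAt ξ₁ (-deriv (fun a => H (covectorAt c (a, x₂ s) (ξ₁ s, ξ₂ s))) (x₁ s)) s ∧
    HasDerivAt ξ₂ (-deriv (fun a => H (covectorAt c (x₁ s, a) (ξ₁ s, ξ₂ s))) (x₂ s)) s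

/-- Timelike and null geodesic completeness of the Hamiltonian `H`, for metrics of signature
`(+, -)`: through every covector at which `H > 0` (timelike) or `H = 0` (null) there passes a curve
of the Hamiltonian flow that is defined for all values of the affine parameter. -/
def TimelikeAndNullComplete (H : CotangentBundle S → ℝ) : Prop :=
  ∀ z : CotangentBundle S, 0 < H z ∨ H z = 0 →
    ∃ γ : ℝ → CotangentBundle S, γ 0 = z ∧ ∀ s : ℝ, HamiltonEquationsAt H γ s

end Hamilton

/-! ### The string metric in its various coordinate systems -/

/-- The geodesic Hamiltonian `½ gⁱʲ ξᵢ ξⱼ` of a metric with matrix `g` at a point. -/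
def geodesicHamiltonian (g : Matrix (Fin 2) (Fin 2) ℝ) (ξ : ℝ × ℝ) : ℝ :=
  (![ξ.1, ξ.2] ⬝ᵥ (g⁻¹ *ᵥ ![ξ.1, ξ.2])) / 2

/-- The string space `Σ`, in the coordinates `(t, r)`. -/
def stringSpace : Set (ℝ × ℝ) := {x | 1 < x.2}

/-- The string metric
`((r - 1) / r³) (dt + r dr / (r - 1)) (dt - r dr / (r - 1))` in the coordinates `(t, r)`. -/
def stringMetric (x : ℝ × ℝ) : Matrix (Fin 2) (Fin 2) ℝ :=
  ((x.2 - 1) / x.2 ^ 3) • !![1, 0; 0, -(x.2 / (x.2 - 1)) ^ 2]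

/-- The Lambert function: for `z ≥ -1/e`, the solution `w ≥ -1` of `w eʷ = z`. -/
def lambertW (z : ℝ) : ℝ := Function.invFunOn (fun w : ℝ => w * Real.exp w) (Set.Ici (-1)) z

/-- The domain `e p q > -1` of the Kruskal–Szekeres coordinates `(p, q)`. -/
def kruskalDomain : Set (ℝ × ℝ) := {x | -1 < Real.exp 1 * x.1 * x.2}

/-- The Kruskal–Szekeres metric `-4 e^{-W(pq)} dp dq / (1 + W(pq))³`. -/
def kruskalMetric (x : ℝ × ℝ) : Matrix (Fin 2) (Fin 2) ℝ :=
  (-4 * Real.exp (-lambertW (x.1 * x.2)) / (1 + lambertW (x.1 * x.2)) ^ 3) •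
    !![0, 1 / 2; 1 / 2, 0]

/-- The domain of the coordinates `(t, x)`, where `r = x²`, around the singularity `x = 0`. -/
def singularDomain : Set (ℝ × ℝ) := {y | -1 < y.2 ∧ y.2 < 1}

/-- The Hamiltonian `(4 x⁶ T² - (x² - 1)² X²) / (8 (x² - 1))` of the string metric in the
coordinates `(t, x)`, where `r = x²`, for the covector `T dt + X dx`.
For `x ≠ 0` it is the geodesic Hamiltonian of the string metric; it is analytic at `x = 0`. -/
def singularHamiltonian (y ξ : ℝ × ℝ) : ℝ :=
  (4 * y.2 ^ 6 * ξ.1 ^ 2 - (y.2 ^ 2 - 1) ^ 2 * ξ.2 ^ 2) / (8 * (y.2 ^ 2 - 1))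

/-- The Eddington–Finkelstein metric `2 du ds + s² (1 - s) du²` in the coordinates `(u, s)`, where
`s = 1 / r`; the metric has the same form in the coordinates `(v, s)`. -/
def eddingtonMetric (x : ℝ × ℝ) : Matrix (Fin 2) (Fin 2) ℝ :=
  !![x.2 ^ 2 * (1 - x.2), 1; 1, 0]

/-! ### The coordinate relations -/

/-- A sign `±1` as a real number. -/
def sgn (δ : ℤˣ) : ℝ := ((δ : ℤ) : ℝ)

/-- The Kruskal–Szekeres coordinates `(p, q)` of the point `(t, r)` of `Σ`. -/
def kruskalOfString (x : ℝ × ℝ) : ℝ × ℝ :=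
  (Real.exp ((x.2 + x.1 - 1) / 2) * √(x.2 - 1), Real.exp ((x.2 - x.1 - 1) / 2) * √(x.2 - 1))

/-- The Kruskal–Szekeres coordinates `(p, q)` of the point `(t, r)` with `r = x² < 1`, in the
quadrant in which `p` has the sign `δ` (and `q` the sign `-δ`). -/
def kruskalOfSingular (δ : ℤˣ) (y : ℝ × ℝ) : ℝ × ℝ :=
  (sgn δ * (Real.exp ((y.2 ^ 2 + y.1 - 1) / 2) * √(1 - y.2 ^ 2)),
    -sgn δ * (Real.exp ((y.2 ^ 2 - y.1 - 1) / 2) * √(1 - y.2 ^ 2)))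

/-- The Kruskal–Szekeres coordinates `(p, q)` with `p = ± e^{u/2}` and `pq = (r - 1) e^{r - 1}`, as
functions of `u` and of `s = 1 / r > 0`; here `δ` is the sign of `p`. -/
def kruskalOfU (δ : ℤˣ) (x : ℝ × ℝ) : ℝ × ℝ :=
  (sgn δ * Real.exp (x.1 / 2),
    sgn δ * Real.exp (-x.1 / 2) * ((1 / x.2 - 1) * Real.exp (1 / x.2 - 1)))

/-- The Kruskal–Szekeres coordinates `(p, q)` with `q = ± e^{v/2}` and `pq = (r - 1) e^{r - 1}`, as
functions of `v` and of `s = 1 / r > 0`; here `δ` is the sign of `q`. -/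
def kruskalOfV (δ : ℤˣ) (x : ℝ × ℝ) : ℝ × ℝ :=
  (sgn δ * Real.exp (-x.1 / 2) * ((1 / x.2 - 1) * Real.exp (1 / x.2 - 1)),
    sgn δ * Real.exp (x.1 / 2))

/-- The coordinates `(v, s)` of the point with coordinates `(u, s)`:
`u + v = 2 (r - 1) + ln ((r - 1)²)`, where `r = 1 / s`. -/
def vOfU (x : ℝ × ℝ) : ℝ × ℝ :=
  (-x.1 + 2 * (1 / x.2 - 1) + Real.log ((1 / x.2 - 1) ^ 2), x.2)

/-! ### The glued surface -/

/-- The coordinate patches of the extended string surface. -/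
structure Patches (S : Type) [TopologicalSpace S] where
  /-- the original string space `Σ`, with coordinates `(t, r)` -/
  string : OpenPartialHomeomorph S (ℝ × ℝ)
  /-- the two Kruskal–Szekeres patches; the index is the sign of `x` -/
  kruskal : ℤˣ → OpenPartialHomeomorph S (ℝ × ℝ)
  /-- the `(t, x)` patches across the singularity; the index is the sign of `p` -/
  singular : ℤˣ → OpenPartialHomeomorph S (ℝ × ℝ)
  /-- the `(u, s)` Eddington–Finkelstein patches; the indices are the signs of `x` and `p` -/
  scriU : ℤˣ × ℤˣ → OpenPartialHomeomorph S (ℝ × ℝ)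
  /-- the `(v, s)` Eddington–Finkelstein patches; the indices are the signs of `x` and `q` -/
  scriV : ℤˣ × ℤˣ → OpenPartialHomeomorph S (ℝ × ℝ)

variable {S : Type} [TopologicalSpace S] [ChartedSpace (ℝ × ℝ) S] [IsManifold 𝓘(ℝ, ℝ × ℝ) ω S]

/-- The surface `S` is obtained by gluing the patches `A` along the coordinate relations. -/
structure IsGluing (A : Patches S) : Prop where
  string_mem : A.string ∈ IsManifold.maximalAtlas 𝓘(ℝ, ℝ × ℝ) ω S
  kruskal_mem : ∀ ε, A.kruskal ε ∈ IsManifold.maximalAtlas 𝓘(ℝ, ℝ × ℝ) ω S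
  singular_mem : ∀ δ, A.singular δ ∈ IsManifold.maximalAtlas 𝓘(ℝ, ℝ × ℝ) ω S
  scriU_mem : ∀ i, A.scriU i ∈ IsManifold.maximalAtlas 𝓘(ℝ, ℝ × ℝ) ω S
  scriV_mem : ∀ i, A.scriV i ∈ IsManifold.maximalAtlas 𝓘(ℝ, ℝ × ℝ) ω S
  string_target : A.string.target = stringSpace
  kruskal_target : ∀ ε, (A.kruskal ε).target = kruskalDomain
  singular_target : ∀ δ, (A.singular δ).target = singularDomain
  scriU_target : ∀ i, (A.scriU i).target = Set.univ
  scriV_target : ∀ i, (A.scriV i).target = Set.univ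
  /-- the patches cover the surface -/
  cover : ∀ z : S, (∃ ε, z ∈ (A.kruskal ε).source) ∨ (∃ δ, z ∈ (A.singular δ).source) ∨
    (∃ i, z ∈ (A.scriU i).source) ∨ (∃ i, z ∈ (A.scriV i).source)
  /-- the two Kruskal–Szekeres patches are disjoint -/
  kruskal_disjoint : Disjoint (A.kruskal 1).source (A.kruskal (-1)).source
  /-- `Σ` is the first quadrant of the first Kruskal–Szekeres patch -/
  string_kruskal : ∀ x ∈ stringSpace, A.string.symm x = (A.kruskal 1).symm (kruskalOfString x)
  /-- for `x > 0` and for `x < 0` the patches across the singularity `x = 0` are glued to the two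
  Kruskal–Szekeres patches by `r = x²` -/
  singular_kruskal : ∀ ε δ, ∀ y ∈ singularDomain, 0 < sgn ε * y.2 →
    (A.singular δ).symm y = (A.kruskal ε).symm (kruskalOfSingular δ y)
  /-- for `s > 0` the `(u, s)` patches are glued to the Kruskal–Szekeres patches -/
  scriU_kruskal : ∀ ε δ, ∀ x : ℝ × ℝ, 0 < x.2 →
    (A.scriU (ε, δ)).symm x = (A.kruskal ε).symm (kruskalOfU δ x)
  /-- for `s > 0` the `(v, s)` patches are glued to the Kruskal–Szekeres patches -/
  scriV_kruskal : ∀ ε δ, ∀ x : ℝ × ℝ, 0 < x.2 →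
    (A.scriV (ε, δ)).symm x = (A.kruskal ε).symm (kruskalOfV δ x)
  /-- beyond scri, where `s < 0`, the `(u, s)` patches are glued to the `(v, s)` patches in pairs -/
  scriU_scriV : ∃ π : Equiv.Perm (ℤˣ × ℤˣ), ∀ i, ∀ x : ℝ × ℝ, x.2 < 0 →
    (A.scriU i).symm x = (A.scriV (π i)).symm (vOfU x)

/-- The function `H` on the cotangent bundle is, in the canonical coordinates of every patch, the
geodesic Hamiltonian of the string metric (continued analytically to `x = 0` in the patches across
the singularity).  In particular it extends the geodesic Hamiltonian of `Σ`. -/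
structure IsStringHamiltonian (A : Patches S) (H : CotangentBundle S → ℝ) : Prop where
  string : ∀ x ∈ stringSpace, ∀ ξ,
    H (covectorAt A.string x ξ) = geodesicHamiltonian (stringMetric x) ξ
  kruskal : ∀ ε, ∀ x ∈ kruskalDomain, ∀ ξ,
    H (covectorAt (A.kruskal ε) x ξ) = geodesicHamiltonian (kruskalMetric x) ξ
  singular : ∀ δ, ∀ x ∈ singularDomain, ∀ ξ,
    H (covectorAt (A.singular δ) x ξ) = singularHamiltonian x ξ
  scriU : ∀ i x ξ, H (covectorAt (A.scriU i) x ξ) = geodesicHamiltonian (eddingtonMetric x) ξ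
  scriV : ∀ i x ξ, H (covectorAt (A.scriV i) x ξ) = geodesicHamiltonian (eddingtonMetric x) ξ

end SchwarzschildString

end

/-! Since `∂ₜ` is a Killing field, the Hamiltonian `H` and the energy `E`, the momentum of `∂ₜ`, are
both conserved. The coordinate `x` with `r = x²` at `r = 0`, and `s = 1/r` at `r = ∞`, make `H`
analytic there. What remains is to build the surface and to exclude escape in finite time.

Timelike covectors. A flow on an invariant set is complete once it exists for one uniform time from
every point (`exists_complete_flow`). On `{H = h, E = e}` with `h > 0` such a time comes from
compactness modulo isometries (translations of `t`, `u`, `v`, or boosts in `p, q`): see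
`exists_time_singular` for `r ≤ 1/4`, `exists_time_kruskal` for `1/4 ≤ r ≤ 2`,
`exists_time_eddington` for `s ≤ 1/2`. In the last region put `f = s²(1 - s)` and let `a`, `S` be
the momenta of `u`, `s`. Then `H = aS - fS²/2` gives `(a - fS)² = a² - 2hf ≥ 0`, so `f` is bounded
and `s` is bounded below: the curve turns back before `s = -∞`. Moreover `S(a + (a - fS)) = 2h`
bounds `S` whenever `a - fS = ds/dτ` has the sign of `a`. Otherwise one passes to the `(v, s)`
patch, which reverses `a` and keeps `ds/dτ`.

Null covectors. These bounds fail for `h = 0`, but in dimension two a null covector is a multiple of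
one of two null forms. A multiple of `du` moves with `u` constant and `s` affine in the parameter,
across horizon and scri, and so needs infinite parameter to approach `r = 0`; likewise for `dv`. The
horizons and the scris are themselves straight null lines, and on `x = 0` the null covectors are
fixed points of the flow.

The surface. Its points are listed without repetition, and each has a home patch. It suffices that
every patch is related near each of its points to the home patch by an analytic change of
coordinates preserving `H` and `E` (`exists_transition_home`); charts, `H` and `E` then glue. For
the Hausdorff property, `r²/(1 + r²)` separates points at different `r²`; the delicate pair is a
point of `u`-scri and a point of `v`-scri, where `u + v → ±∞` as `s → 0` on the overlaps
(`scriU_ne_scriV`). -/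

noncomputable section

namespace SchwarzschildString

/-! ### Gluing analytic patches of the plane -/

/-- The map `T`, with invertible derivative `T'` at `x`, is an analytic change of parameters at `x`
from the parametrization `f` to the parametrization `g`. -/
structure IsTransition {M : Type} (f g : ℝ × ℝ → M) (T : ℝ × ℝ → ℝ × ℝ)
    (T' : (ℝ × ℝ) ≃L[ℝ] (ℝ × ℝ)) (x : ℝ × ℝ) : Prop where
  contDiffAt : ContDiffAt ℝ ω T x
  hasFDerivAt : HasFDerivAt T (T' : (ℝ × ℝ) →L[ℝ] (ℝ × ℝ)) x
  eventually_eq : ∀ᶠ x' in 𝓝 x, f x' = g (T x')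

namespace IsTransition

variable {M : Type} {f g h : ℝ × ℝ → M} {T R : ℝ × ℝ → ℝ × ℝ}
  {T' R' : (ℝ × ℝ) ≃L[ℝ] (ℝ × ℝ)} {x : ℝ × ℝ}

theorem refl (f : ℝ × ℝ → M) (x : ℝ × ℝ) :
    IsTransition f f id (ContinuousLinearEquiv.refl ℝ _) x :=
  ⟨contDiffAt_id, hasFDerivAt_id x, by simp⟩

theorem apply_eq (hT : IsTransition f g T T' x) : f x = g (T x) :=
  hT.eventually_eq.self_of_nhds

theorem trans (hT : IsTransition f g T T' x) (hR : IsTransition g h R R' (T x)) :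
    IsTransition f h (R ∘ T) (T'.trans R') x where
  contDiffAt := hR.contDiffAt.comp x hT.contDiffAt
  hasFDerivAt := hR.hasFDerivAt.comp x hT.hasFDerivAt
  eventually_eq := by
    filter_upwards [hT.eventually_eq,
      hT.contDiffAt.continuousAt.eventually hR.eventually_eq] with x' h₁ h₂
    simp [h₁, h₂]

theorem exists_inverse (hT : IsTransition f g T T' x) :
    ∃ R, IsTransition g f R T'.symm (T x) ∧ R (T x) = x ∧ ∀ᶠ y in 𝓝 (T x), T (R y) = y := by
  have hs : HasStrictFDerivAt T (T' : (ℝ × ℝ) →L[ℝ] (ℝ × ℝ)) x :=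
    hT.contDiffAt.hasStrictFDerivAt' hT.hasFDerivAt (by simp)
  have hc : ContDiffAt ℝ ω (hs.localInverse T T' x) (T x) :=
    hT.contDiffAt.to_localInverse hT.hasFDerivAt (by simp)
  refine ⟨hs.localInverse T T' x, ⟨hc, hs.to_localInverse.hasFDerivAt, ?_⟩,
    hs.localInverse_apply_image, hs.eventually_right_inverse⟩
  have h₁ := hc.continuousAt.eventually (p := fun x' => f x' = g (T x'))
    (by rw [hs.localInverse_apply_image]; exact hT.eventually_eq)
  filter_upwards [h₁, hs.eventually_right_inverse] with y h₂ h₃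
  rw [h₂, h₃]

/-- A transition at a point is a transition at the nearby points. -/
theorem eventually_isTransition (hT : IsTransition f g T T' x) :
    ∀ᶠ x' in 𝓝 x, ∃ T'' : (ℝ × ℝ) ≃L[ℝ] (ℝ × ℝ), IsTransition f g T T'' x' := by
  have hinv : ∀ᶠ x' in 𝓝 x, fderiv ℝ T x' ∈
      Set.range ((↑) : ((ℝ × ℝ) ≃L[ℝ] (ℝ × ℝ)) → (ℝ × ℝ) →L[ℝ] (ℝ × ℝ)) := by
    have hc : ContinuousAt (fderiv ℝ T) x :=
      (hT.contDiffAt.fderiv_right (m := 0) (by simp)).continuousAt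
    refine hc.eventually_mem ?_
    rw [hT.hasFDerivAt.fderiv]
    exact T'.nhds
  filter_upwards [hT.contDiffAt.eventually (by simp), hT.eventually_eq.eventually_nhds, hinv]
    with x' h₁ h₂ ⟨T'', h₃⟩
  exact ⟨T'', h₁, h₃ ▸ (h₁.differentiableAt (by simp)).hasFDerivAt, h₂⟩

end IsTransition

/-- Parametrizations of the pieces of a set `M` by open subsets of the plane, each of which is
related to a preferred parametrization around each point by an analytic change of parameters. -/
structure AnalyticGluing (M ι : Type) where
  dom : ι → Set (ℝ × ℝ)
  param : ι → ℝ × ℝ → M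
  homeIdx : M → ι
  homePt : M → ℝ × ℝ
  isOpen_dom : ∀ i, IsOpen (dom i)
  injOn : ∀ i, Set.InjOn (param i) (dom i)
  homePt_mem : ∀ m, homePt m ∈ dom (homeIdx m)
  param_homePt : ∀ m, param (homeIdx m) (homePt m) = m
  exists_transition : ∀ i, ∀ x ∈ dom i, ∃ T T',
    IsTransition (param i) (param (homeIdx (param i x))) T T' x ∧ T x = homePt (param i x)

namespace AnalyticGluing

variable {M ι : Type} (G : AnalyticGluing M ι)

/-- Go to the home patch of the common point and come back by the inverse of the second transition.
Hence only transitions to home patches have to be verified, not those between all pairs of patches.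
-/
theorem exists_transition_of_eq {i j : ι} {x y : ℝ × ℝ} (hx : x ∈ G.dom i) (hy : y ∈ G.dom j)
    (h : G.param i x = G.param j y) :
    ∃ T T', IsTransition (G.param i) (G.param j) T T' x ∧ T x = y := by
  obtain ⟨T, T', hT, hTx⟩ := G.exists_transition i x hx
  obtain ⟨R, R', hR, hRy⟩ := G.exists_transition j y hy
  obtain ⟨Q, hQ, hQy, -⟩ := hR.exists_inverse
  rw [hRy, ← h, ← hTx] at hQ hQy
  exact ⟨_, _, hT.trans hQ, by simpa using hQy⟩

/-- The coordinates of a patch, as a partial bijection. -/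
def coord (i : ι) : PartialEquiv M (ℝ × ℝ) :=
  haveI : Nonempty (ℝ × ℝ) := ⟨0⟩
  (Set.BijOn.toPartialEquiv (G.param i) (G.dom i) _ (G.injOn i).bijOn_image).symm

@[simp] theorem coord_target (i : ι) : (G.coord i).target = G.dom i := rfl
@[simp] theorem coord_source (i : ι) : (G.coord i).source = G.param i '' G.dom i := rfl
@[simp] theorem coord_symm (i : ι) : ((G.coord i).symm : ℝ × ℝ → M) = G.param i := rfl

theorem coord_param {i : ι} {x : ℝ × ℝ} (hx : x ∈ G.dom i) : G.coord i (G.param i x) = x :=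
  (G.coord i).right_inv hx

theorem mem_trans_source {i j : ι} {x : ℝ × ℝ} :
    x ∈ ((G.coord i).symm.trans (G.coord j)).source ↔
      x ∈ G.dom i ∧ G.param i x ∈ G.param j '' G.dom j := by
  simp [PartialEquiv.trans_source]

theorem eventually_coord {i j : ι} {x : ℝ × ℝ}
    (hx : x ∈ ((G.coord i).symm.trans (G.coord j)).source) :
    ∃ T T', IsTransition (G.param i) (G.param j) T T' x ∧
      (∀ᶠ x' in 𝓝 x, x' ∈ ((G.coord i).symm.trans (G.coord j)).source) ∧
      ∀ᶠ x' in 𝓝 x, G.coord j (G.param i x') = T x' := by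
  obtain ⟨hx₁, y, hy, hxy⟩ := G.mem_trans_source.1 hx
  obtain ⟨T, T', hT, rfl⟩ := G.exists_transition_of_eq hx₁ hy hxy.symm
  have h₁ : ∀ᶠ x' in 𝓝 x, T x' ∈ G.dom j :=
    hT.contDiffAt.continuousAt.eventually ((G.isOpen_dom j).mem_nhds hy)
  refine ⟨T, T', hT, ?_, ?_⟩
  · filter_upwards [(G.isOpen_dom i).mem_nhds hx₁, h₁, hT.eventually_eq] with x' h₂ h₃ h₄
    exact G.mem_trans_source.2 ⟨h₂, _, h₃, h₄.symm⟩
  · filter_upwards [h₁, hT.eventually_eq] with x' h₃ h₄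
    rw [h₄, G.coord_param h₃]

theorem contDiffAt_trans {i j : ι} {x : ℝ × ℝ}
    (hx : x ∈ ((G.coord i).symm.trans (G.coord j)).source) :
    ContDiffAt ℝ ω ((G.coord i).symm.trans (G.coord j)) x := by
  obtain ⟨T, T', hT, -, h⟩ := G.eventually_coord hx
  exact hT.contDiffAt.congr_of_eventuallyEq h

/-- The charted space structure, without a topology, of the glued surface. -/
def core : ChartedSpaceCore (ℝ × ℝ) M where
  atlas := Set.range G.coord
  chartAt m := G.coord (G.homeIdx m)
  mem_chart_source m := ⟨G.homePt m, G.homePt_mem m, G.param_homePt m⟩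
  chart_mem_atlas m := ⟨_, rfl⟩
  open_source := by
    rintro _ _ ⟨i, rfl⟩ ⟨j, rfl⟩
    rw [isOpen_iff_mem_nhds]
    intro x hx
    obtain ⟨T, T', -, h, -⟩ := G.eventually_coord hx
    exact h
  continuousOn_toFun := by
    rintro _ _ ⟨i, rfl⟩ ⟨j, rfl⟩ x hx
    exact (G.contDiffAt_trans hx).continuousAt.continuousWithinAt

/-- The surface obtained by gluing. -/
def Space (_ : AnalyticGluing M ι) : Type := M

instance : TopologicalSpace G.Space := G.core.toTopologicalSpace

instance : ChartedSpace (ℝ × ℝ) G.Space := G.core.toChartedSpace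

/-- The charts of the glued surface. -/
def chart (i : ι) : OpenPartialHomeomorph G.Space (ℝ × ℝ) :=
  G.core.openPartialHomeomorph (G.coord i) ⟨i, rfl⟩

/-- The point of the glued surface with given coordinates. -/
def pt (i : ι) (x : ℝ × ℝ) : G.Space := G.param i x

theorem mem_atlas_iff {e : OpenPartialHomeomorph G.Space (ℝ × ℝ)} :
    e ∈ atlas (ℝ × ℝ) G.Space ↔ ∃ i, G.chart i = e := by
  refine Set.mem_iUnion₂.trans ⟨?_, ?_⟩
  · rintro ⟨_, ⟨i, rfl⟩, h⟩
    exact ⟨i, h.symm⟩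
  · rintro ⟨i, rfl⟩
    exact ⟨_, ⟨i, rfl⟩, rfl⟩

instance : IsManifold 𝓘(ℝ, ℝ × ℝ) ω G.Space := by
  apply isManifold_of_contDiffOn
  intro e e' he he'
  obtain ⟨i, rfl⟩ := G.mem_atlas_iff.1 he
  obtain ⟨j, rfl⟩ := G.mem_atlas_iff.1 he'
  rintro x ⟨hx, -⟩
  exact (G.contDiffAt_trans (i := i) (j := j) hx).contDiffWithinAt

theorem chart_mem_atlas (i : ι) : G.chart i ∈ atlas (ℝ × ℝ) G.Space :=
  G.mem_atlas_iff.2 ⟨i, rfl⟩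

theorem chart_mem_maximalAtlas (i : ι) :
    G.chart i ∈ IsManifold.maximalAtlas 𝓘(ℝ, ℝ × ℝ) ω G.Space :=
  IsManifold.subset_maximalAtlas (G.chart_mem_atlas i)

theorem chart_param {i : ι} {x : ℝ × ℝ} (hx : x ∈ G.dom i) :
    G.chart i (G.pt i x) = x :=
  (G.chart i).right_inv hx

theorem param_mem_source {i : ι} {x : ℝ × ℝ} (hx : x ∈ G.dom i) :
    (G.pt i x) ∈ (G.chart i).source := ⟨x, hx, rfl⟩

theorem mdifferentiableAt_chart {i : ι} {x : ℝ × ℝ} (hx : x ∈ G.dom i) :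
    MDifferentiableAt 𝓘(ℝ, ℝ × ℝ) 𝓘(ℝ, ℝ × ℝ) (G.chart i) (G.pt i x) :=
  ((contMDiffAt_of_mem_maximalAtlas (G.chart_mem_maximalAtlas i)
    (G.param_mem_source hx)).mdifferentiableAt (by simp))

/-- The differential of a chart, as a linear equivalence. -/
theorem exists_mfderiv_chart {i : ι} {x : ℝ × ℝ} (hx : x ∈ G.dom i) :
    ∃ L : (TangentSpace 𝓘(ℝ, ℝ × ℝ) (G.pt i x)) ≃L[ℝ] (ℝ × ℝ),
      (L : TangentSpace 𝓘(ℝ, ℝ × ℝ) (G.pt i x) →L[ℝ] (ℝ × ℝ)) =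
        mfderiv 𝓘(ℝ, ℝ × ℝ) 𝓘(ℝ, ℝ × ℝ) (G.chart i) (G.pt i x) := by
  have h : (G.chart i).MDifferentiable 𝓘(ℝ, ℝ × ℝ) 𝓘(ℝ, ℝ × ℝ) :=
    mdifferentiable_of_mem_atlas (G.chart_mem_atlas i)
  exact ⟨h.mfderiv (G.param_mem_source hx), rfl⟩

theorem mfderiv_chart_of_isTransition {i j : ι} {x : ℝ × ℝ} {T : ℝ × ℝ → ℝ × ℝ}
    {T' : (ℝ × ℝ) ≃L[ℝ] (ℝ × ℝ)} (hx : x ∈ G.dom i) (hy : T x ∈ G.dom j)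
    (hT : IsTransition (G.param i) (G.param j) T T' x) :
    mfderiv 𝓘(ℝ, ℝ × ℝ) 𝓘(ℝ, ℝ × ℝ) (G.chart j) (G.pt i x) =
      (T' : (ℝ × ℝ) →L[ℝ] (ℝ × ℝ)).comp
        (mfderiv 𝓘(ℝ, ℝ × ℝ) 𝓘(ℝ, ℝ × ℝ) (G.chart i) (G.pt i x)) := by
  have h₁ : HasMFDerivAt 𝓘(ℝ, ℝ × ℝ) 𝓘(ℝ, ℝ × ℝ) T (G.chart i (G.pt i x))
      (T' : (ℝ × ℝ) →L[ℝ] (ℝ × ℝ)) := by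
    rw [G.chart_param hx]; exact hT.hasFDerivAt.hasMFDerivAt
  have h₂ := h₁.comp _ (G.mdifferentiableAt_chart hx).hasMFDerivAt
  refine (h₂.congr_of_eventuallyEq ?_).mfderiv
  have h₃ : ∀ᶠ x' in 𝓝 (G.chart i (G.pt i x)),
      T x' ∈ G.dom j ∧ G.param i x' = G.param j (T x') := by
    rw [G.chart_param hx]
    exact (hT.contDiffAt.continuousAt.eventually ((G.isOpen_dom j).mem_nhds hy)).and
      hT.eventually_eq
  filter_upwards [((G.chart i).continuousAt (G.param_mem_source hx)).eventually h₃,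
    (G.chart i).open_source.mem_nhds (G.param_mem_source hx)] with m ⟨h₄, h₅⟩ h₆
  have h₇ : G.pt i (G.chart i m) = m := (G.chart i).left_inv h₆
  change G.chart j m = T (G.chart i m)
  exact (congrArg (G.chart j) (h₇.symm.trans h₅)).trans (G.chart_param h₄)

end AnalyticGluing

/-! ### Covectors on a glued surface -/

/-- The coefficients of a linear form on the plane. -/
def formCoords : ((ℝ × ℝ) →L[ℝ] ℝ) →L[ℝ] (ℝ × ℝ) :=
  (ContinuousLinearMap.apply ℝ ℝ ((1, 0) : ℝ × ℝ)).prod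
    (ContinuousLinearMap.apply ℝ ℝ ((0, 1) : ℝ × ℝ))

@[simp] theorem planeForm_apply (ξ v : ℝ × ℝ) : planeForm ξ v = ξ.1 * v.1 + ξ.2 * v.2 := by
  simp [planeForm]

@[simp] theorem formCoords_apply (α : (ℝ × ℝ) →L[ℝ] ℝ) :
    formCoords α = (α (1, 0), α (0, 1)) := rfl

@[simp] theorem planeForm_formCoords (α : (ℝ × ℝ) →L[ℝ] ℝ) : planeForm (formCoords α) = α := by
  ext <;> simp

@[simp] theorem formCoords_planeForm (ξ : ℝ × ℝ) : formCoords (planeForm ξ) = ξ := by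
  ext <;> simp

/-- The pullback of a covector of the plane, in coordinates, by a linear map. -/
def pullback (A : (ℝ × ℝ) →L[ℝ] (ℝ × ℝ)) (η : ℝ × ℝ) : ℝ × ℝ := formCoords ((planeForm η).comp A)

theorem pullback_apply (A : (ℝ × ℝ) →L[ℝ] (ℝ × ℝ)) (η : ℝ × ℝ) :
    pullback A η = (η.1 * (A (1, 0)).1 + η.2 * (A (1, 0)).2,
      η.1 * (A (0, 1)).1 + η.2 * (A (0, 1)).2) := by
  simp [pullback]

theorem pullback_surjective (T' : (ℝ × ℝ) ≃L[ℝ] (ℝ × ℝ)) : Function.Surjective (pullback T') := by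
  intro ξ
  refine ⟨pullback T'.symm ξ, ?_⟩
  rw [pullback, pullback, planeForm_formCoords, ContinuousLinearMap.comp_assoc]
  simp

namespace AnalyticGluing

variable {M ι : Type} (G : AnalyticGluing M ι)

theorem covectorAt_eq_of_eq {i : ι} {x ξ : ℝ × ℝ} {m : G.Space} (h : G.pt i x = m) :
    covectorAt (G.chart i) x ξ = ⟨m, (planeForm ξ).comp
      (mfderiv 𝓘(ℝ, ℝ × ℝ) 𝓘(ℝ, ℝ × ℝ) (G.chart i) m)⟩ := by
  subst h
  rfl

/-- Covectors pull back, so the components are computed against the direction of `T`; this is the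
chain rule for the chart differentials. -/
theorem covectorAt_transition {i j : ι} {x : ℝ × ℝ} {T : ℝ × ℝ → ℝ × ℝ}
    {T' : (ℝ × ℝ) ≃L[ℝ] (ℝ × ℝ)} (hx : x ∈ G.dom i) (hy : T x ∈ G.dom j)
    (hT : IsTransition (G.param i) (G.param j) T T' x) (η : ℝ × ℝ) :
    covectorAt (G.chart i) x (pullback T' η) = covectorAt (G.chart j) (T x) η := by
  have h : G.pt j (T x) = G.pt i x := hT.apply_eq.symm
  rw [G.covectorAt_eq_of_eq h, G.mfderiv_chart_of_isTransition hx hy hT,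
    G.covectorAt_eq_of_eq (i := i) rfl, pullback, planeForm_formCoords]
  rfl

theorem exists_eq_covectorAt {z : CotangentBundle G.Space} {i : ι} {x : ℝ × ℝ} (hx : x ∈ G.dom i)
    (hz : z.proj = G.pt i x) : ∃ ξ, z = covectorAt (G.chart i) x ξ := by
  obtain ⟨m, φ⟩ := z
  change m = _ at hz
  subst hz
  obtain ⟨L, hL⟩ := G.exists_mfderiv_chart hx
  refine ⟨formCoords (φ.comp (L.symm : (ℝ × ℝ) →L[ℝ] _)), ?_⟩
  rw [G.covectorAt_eq_of_eq rfl, planeForm_formCoords, ← hL]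
  congr 1
  refine ContinuousLinearMap.ext fun v => ?_
  exact (congrArg φ (L.symm_apply_apply v)).symm

theorem covectorAt_injective {i : ι} {x : ℝ × ℝ} (hx : x ∈ G.dom i) :
    Function.Injective (covectorAt (G.chart i) x) := by
  intro ξ η h
  rw [G.covectorAt_eq_of_eq rfl, G.covectorAt_eq_of_eq rfl] at h
  obtain ⟨L, hL⟩ := G.exists_mfderiv_chart hx
  have h₁ := Bundle.TotalSpace.mk_inj.1 h
  rw [← hL] at h₁
  have h₂ : planeForm ξ = planeForm η := by
    refine ContinuousLinearMap.ext fun v => ?_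
    have h₃ := congrArg (fun φ => φ (L.symm v)) h₁
    have h₄ : planeForm ξ (L (L.symm v)) = planeForm η (L (L.symm v)) := h₃
    rwa [L.apply_symm_apply] at h₄
  rw [← formCoords_planeForm ξ, h₂, formCoords_planeForm]

variable {β : Type} (F : ι → ℝ × ℝ → ℝ × ℝ → β)

/-- The functions `F i` on the cotangent bundles of the patches agree. -/
def IsCompatible : Prop :=
  ∀ i, ∀ x ∈ G.dom i, ∃ T T', IsTransition (G.param i) (G.param (G.homeIdx (G.param i x))) T T' x ∧
    T x = G.homePt (G.param i x) ∧
    ∀ η, F i x (pullback T' η) = F (G.homeIdx (G.param i x)) (T x) η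

theorem exists_home_covector (z : CotangentBundle G.Space) :
    ∃ ξ, z = covectorAt (G.chart (G.homeIdx z.proj)) (G.homePt z.proj) ξ :=
  G.exists_eq_covectorAt (G.homePt_mem _) (G.param_homePt z.proj).symm

/-- The function on the cotangent bundle given by the functions `F i` on the patches. -/
def glue (z : CotangentBundle G.Space) : β :=
  F (G.homeIdx z.proj) (G.homePt z.proj) (G.exists_home_covector z).choose

variable {F}

/-- `glue` evaluates in the home patch. Components there are unique because the differential of a
chart is invertible, so compatibility with the transition to the home patch is all that is needed.
-/
theorem glue_covectorAt (hF : G.IsCompatible F) {i : ι} {x : ℝ × ℝ} (hx : x ∈ G.dom i)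
    (ξ : ℝ × ℝ) : G.glue F (covectorAt (G.chart i) x ξ) = F i x ξ := by
  obtain ⟨T, T', hT, hTx, h⟩ := hF i x hx
  obtain ⟨η, rfl⟩ := pullback_surjective T' ξ
  have hy : T x ∈ G.dom (G.homeIdx (G.param i x)) := hTx ▸ G.homePt_mem _
  have h₁ := (G.exists_home_covector (covectorAt (G.chart i) x (pullback T' η))).choose_spec
  rw [h η]
  unfold glue
  generalize (G.exists_home_covector (covectorAt (G.chart i) x (pullback T' η))).choose = ζ at h₁
  have h₂ : covectorAt (G.chart (G.homeIdx (G.param i x))) (T x) η =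
      covectorAt (G.chart (G.homeIdx (G.param i x))) (T x) ζ := by
    rw [← G.covectorAt_transition hx hy hT, h₁, hTx]
    rfl
  rw [G.covectorAt_injective hy h₂, hTx]
  rfl

/-- In the bundle trivialization at `z₀` the base coordinates and the components of a covector are
analytic functions of the covector, and near `z₀` the function `H` is `F i` evaluated at them. -/
theorem contMDiff_of_covectorAt {H : CotangentBundle G.Space → ℝ} {F : ι → ℝ × ℝ → ℝ × ℝ → ℝ}
    (hH : ∀ i, ∀ x ∈ G.dom i, ∀ ξ, H (covectorAt (G.chart i) x ξ) = F i x ξ)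
    (hF : ∀ i, ∀ x ∈ G.dom i, ∀ ξ,
      ContDiffAt ℝ ω (fun w : (ℝ × ℝ) × (ℝ × ℝ) => F i w.1 w.2) (x, ξ)) :
    ContMDiff (𝓘(ℝ, ℝ × ℝ).prod 𝓘(ℝ, (ℝ × ℝ) →L[ℝ] ℝ)) 𝓘(ℝ, ℝ) ω H := by
  intro z₀
  set i := G.homeIdx z₀.proj with hi
  have hsrc : z₀.proj ∈ (G.chart i).source := mem_chart_source (ℝ × ℝ) z₀.proj
  let φ : CotangentBundle G.Space → (ℝ × ℝ) →L[ℝ] ℝ := fun z =>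
    ContinuousLinearMap.inCoordinates (ℝ × ℝ) (fun z : G.Space => TangentSpace 𝓘(ℝ, ℝ × ℝ) z)
      ℝ (Bundle.Trivial G.Space ℝ) z₀.proj z.proj z₀.proj z.proj z.2
  have hid : ContMDiffAt (𝓘(ℝ, ℝ × ℝ).prod 𝓘(ℝ, (ℝ × ℝ) →L[ℝ] ℝ))
      (𝓘(ℝ, ℝ × ℝ).prod 𝓘(ℝ, (ℝ × ℝ) →L[ℝ] ℝ)) ω (fun z : CotangentBundle G.Space => z) z₀ :=
    contMDiffAt_id
  obtain ⟨h₁, h₂⟩ := (contMDiffAt_hom_bundle _).1 hid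
  have h₃ : ContMDiffAt (𝓘(ℝ, ℝ × ℝ).prod 𝓘(ℝ, (ℝ × ℝ) →L[ℝ] ℝ)) 𝓘(ℝ, ℝ × ℝ) ω
      (fun z : CotangentBundle G.Space => G.chart i z.proj) z₀ :=
    (contMDiffAt_of_mem_maximalAtlas (G.chart_mem_maximalAtlas i) hsrc).comp z₀ h₁
  have h₄ : ContMDiffAt (𝓘(ℝ, ℝ × ℝ).prod 𝓘(ℝ, (ℝ × ℝ) →L[ℝ] ℝ)) 𝓘(ℝ, ℝ × ℝ) ω
      (fun z : CotangentBundle G.Space => formCoords (φ z)) z₀ :=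
    formCoords.contDiff.contDiffAt.contMDiffAt.comp z₀ h₂
  have h₅ : ContMDiffAt (𝓘(ℝ, ℝ × ℝ).prod 𝓘(ℝ, (ℝ × ℝ) →L[ℝ] ℝ)) 𝓘(ℝ, (ℝ × ℝ) × (ℝ × ℝ)) ω
      (fun z : CotangentBundle G.Space => (G.chart i z.proj, formCoords (φ z))) z₀ :=
    h₃.prodMk_space h₄
  have h₆ := (hF i (G.chart i z₀.proj) ((G.chart i).map_source hsrc)
    (formCoords (φ z₀))).contMDiffAt.comp z₀ h₅
  refine h₆.congr_of_eventuallyEq ?_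
  have hs : ∀ᶠ z : CotangentBundle G.Space in 𝓝 z₀, z.proj ∈ (G.chart i).source :=
    h₁.continuousAt.eventually ((G.chart i).open_source.mem_nhds hsrc)
  filter_upwards [hs] with z hz
  have hx : G.chart i z.proj ∈ G.dom i := (G.chart i).map_source hz
  have hz' : G.pt i (G.chart i z.proj) = z.proj := (G.chart i).left_inv hz
  change H z = F i (G.chart i z.proj) (formCoords (φ z))
  rw [← hH i _ hx, G.covectorAt_eq_of_eq hz', planeForm_formCoords]
  congr 1
  obtain ⟨m, ψ⟩ := z
  congr 1
  -- The tangent trivialization centred at `z₀` is the differential of the home chart, so the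
  -- components read by `inCoordinates` are those used by `covectorAt`.
  have h₇ := TangentBundle.continuousLinearMapAt_trivializationAt (I := 𝓘(ℝ, ℝ × ℝ)) (x₀ := z₀.proj)
    (x := m) hz
  have h₈ : mfderiv 𝓘(ℝ, ℝ × ℝ) 𝓘(ℝ, ℝ × ℝ) (G.chart i) m =
      mfderiv 𝓘(ℝ, ℝ × ℝ) 𝓘(ℝ, ℝ × ℝ) (extChartAt 𝓘(ℝ, ℝ × ℝ) z₀.proj) m := by
    congr 1
  rw [h₈, ← h₇]
  refine ContinuousLinearMap.ext fun v => ?_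
  have h₉ := Bundle.Trivialization.symmL_continuousLinearMapAt (R := ℝ)
    (trivializationAt (ℝ × ℝ) (TangentSpace 𝓘(ℝ, ℝ × ℝ)) z₀.proj) (b := m) hz v
  simp only [φ, ContinuousLinearMap.inCoordinates, ContinuousLinearMap.comp_apply]
  rw [h₉]
  simp

end AnalyticGluing

/-! ### Hamiltonian vector fields on the plane -/

/-- The Hamiltonian vector field of a function on the cotangent bundle of the plane. -/
def hamVF (h : (ℝ × ℝ) × (ℝ × ℝ) → ℝ) (w : (ℝ × ℝ) × (ℝ × ℝ)) : (ℝ × ℝ) × (ℝ × ℝ) :=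
  ((fderiv ℝ h w (0, (1, 0)), fderiv ℝ h w (0, (0, 1))),
    (-fderiv ℝ h w ((1, 0), 0), -fderiv ℝ h w ((0, 1), 0)))

theorem fderiv_eq_hamVF (h : (ℝ × ℝ) × (ℝ × ℝ) → ℝ) (w k : (ℝ × ℝ) × (ℝ × ℝ)) :
    fderiv ℝ h w k = planeForm k.2 (hamVF h w).1 - planeForm (hamVF h w).2 k.1 := by
  have hk : k = k.1.1 • (((1, 0), 0) : (ℝ × ℝ) × (ℝ × ℝ)) + k.1.2 • ((0, 1), 0)
      + k.2.1 • (0, (1, 0)) + k.2.2 • (0, (0, 1)) := by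
    ext <;> simp
  conv_lhs => rw [hk]
  simp only [map_add, map_smul, smul_eq_mul, planeForm_apply, hamVF]
  ring

/-- Nondegeneracy of the canonical symplectic form. It allows a Hamiltonian vector field to be
recognized by pairing with arbitrary vectors, without computing partial derivatives. -/
theorem eq_hamVF {h : (ℝ × ℝ) × (ℝ × ℝ) → ℝ} {w v : (ℝ × ℝ) × (ℝ × ℝ)}
    (H : ∀ k : (ℝ × ℝ) × (ℝ × ℝ), fderiv ℝ h w k = planeForm k.2 v.1 - planeForm v.2 k.1) :
    v = hamVF h w := by
  ext <;> simp [hamVF, H]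

theorem contDiffAt_hamVF {h : (ℝ × ℝ) × (ℝ × ℝ) → ℝ} {w : (ℝ × ℝ) × (ℝ × ℝ)}
    (hh : ContDiffAt ℝ ω h w) : ContDiffAt ℝ 1 (hamVF h) w := by
  have hd : ContDiffAt ℝ 1 (fderiv ℝ h) w := hh.fderiv_right (by simp)
  have hk (k : (ℝ × ℝ) × (ℝ × ℝ)) : ContDiffAt ℝ 1 (fun w => fderiv ℝ h w k) w :=
    hd.clm_apply contDiffAt_const
  exact ((hk _).prodMk (hk _)).prodMk ((hk _).neg.prodMk (hk _).neg)

/-- `planeForm` as a continuous linear map. -/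
def planeFormL : (ℝ × ℝ) →L[ℝ] ((ℝ × ℝ) →L[ℝ] ℝ) :=
  (ContinuousLinearMap.fst ℝ ℝ ℝ).smulRight (ContinuousLinearMap.fst ℝ ℝ ℝ) +
    (ContinuousLinearMap.snd ℝ ℝ ℝ).smulRight (ContinuousLinearMap.snd ℝ ℝ ℝ)

theorem planeFormL_apply (ξ : ℝ × ℝ) : planeFormL ξ = planeForm ξ := by
  ext <;> simp [planeFormL, planeForm]

/-- `pullback` as a continuous bilinear map. -/
def pullbackL : ((ℝ × ℝ) →L[ℝ] (ℝ × ℝ)) →L[ℝ] (ℝ × ℝ) →L[ℝ] (ℝ × ℝ) :=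
  (ContinuousLinearMap.compL ℝ (ℝ × ℝ) ((ℝ × ℝ) →L[ℝ] ℝ) (ℝ × ℝ) formCoords) ∘L
    ((ContinuousLinearMap.compL ℝ (ℝ × ℝ) ((ℝ × ℝ) →L[ℝ] ℝ) ((ℝ × ℝ) →L[ℝ] ℝ)).flip planeFormL) ∘L
      (ContinuousLinearMap.compL ℝ (ℝ × ℝ) (ℝ × ℝ) ℝ).flip

theorem pullbackL_apply (A : (ℝ × ℝ) →L[ℝ] (ℝ × ℝ)) (η : ℝ × ℝ) :
    pullbackL A η = pullback A η := by
  simp [pullbackL, pullback, planeFormL_apply]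

theorem planeForm_pullback (A : (ℝ × ℝ) →L[ℝ] (ℝ × ℝ)) (η v : ℝ × ℝ) :
    planeForm (pullback A η) v = planeForm η (A v) := by
  rw [pullback, planeForm_formCoords]; rfl

theorem planeForm_add (ξ η v : ℝ × ℝ) :
    planeForm (ξ + η) v = planeForm ξ v + planeForm η v := by
  simp only [planeForm_apply, Prod.fst_add, Prod.snd_add]; ring

/-- Hamilton's equations are invariant under changes of coordinates. -/
theorem hasDerivAt_pullback_hamVF {h₁ h₂ : (ℝ × ℝ) × (ℝ × ℝ) → ℝ} {φ : ℝ × ℝ → ℝ × ℝ}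
    {T' : (ℝ × ℝ) ≃L[ℝ] (ℝ × ℝ)} {x η : ℝ → ℝ × ℝ} {x' η' : ℝ × ℝ} {τ : ℝ}
    (hx : HasDerivAt x x' τ) (hη : HasDerivAt η η' τ)
    (hφ : ContDiffAt ℝ ω φ (x τ)) (hT : HasFDerivAt φ (T' : (ℝ × ℝ) →L[ℝ] (ℝ × ℝ)) (x τ))
    (hh₁ : DifferentiableAt ℝ h₁ (x τ, pullback T' (η τ)))
    (hh₂ : DifferentiableAt ℝ h₂ (φ (x τ), η τ))
    (hcomp : ∀ᶠ w : (ℝ × ℝ) × (ℝ × ℝ) in 𝓝 (x τ, η τ),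
      h₁ (w.1, pullback (fderiv ℝ φ w.1) w.2) = h₂ (φ w.1, w.2))
    (hsol : (T' x', η') = hamVF h₂ (φ (x τ), η τ)) :
    HasDerivAt (fun σ => (x σ, pullback (fderiv ℝ φ (x σ)) (η σ)))
      (hamVF h₁ (x τ, pullback T' (η τ))) τ := by
  set x₀ := x τ with hx₀
  set η₀ := η τ with hη₀
  have hfd : fderiv ℝ φ x₀ = T' := hT.fderiv
  have hdd : DifferentiableAt ℝ (fderiv ℝ φ) x₀ :=
    (hφ.fderiv_right (m := 1) (by simp)).differentiableAt (by simp)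
  -- Mixed coordinates are used: the base point `x` in the first chart and the covector `η` in the
  -- second. The map differentiated here leads to the canonical coordinates of the first chart, `(x,
  -- η) ↦ (φ x, η)` to those of the second, and the two Hamiltonians agree as functions of `(x, η)`.
  have hΛ : HasFDerivAt (fun w : (ℝ × ℝ) × (ℝ × ℝ) => (w.1, pullbackL (fderiv ℝ φ w.1) w.2))
      ((ContinuousLinearMap.fst ℝ (ℝ × ℝ) (ℝ × ℝ)).prod
        ((pullbackL (fderiv ℝ φ x₀)) ∘L (ContinuousLinearMap.snd ℝ (ℝ × ℝ) (ℝ × ℝ)) +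
        (pullbackL ∘L (fderiv ℝ (fderiv ℝ φ) x₀) ∘L
          (ContinuousLinearMap.fst ℝ (ℝ × ℝ) (ℝ × ℝ))).flip η₀)) (x₀, η₀) := by
    have h₁ : HasFDerivAt (fun w : (ℝ × ℝ) × (ℝ × ℝ) => pullbackL (fderiv ℝ φ w.1))
        (pullbackL ∘L (fderiv ℝ (fderiv ℝ φ) x₀) ∘L
          (ContinuousLinearMap.fst ℝ (ℝ × ℝ) (ℝ × ℝ))) (x₀, η₀) :=
      pullbackL.hasFDerivAt.comp _ (HasFDerivAt.comp (x₀, η₀) (g := fderiv ℝ φ)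
        hdd.hasFDerivAt hasFDerivAt_fst)
    exact hasFDerivAt_fst.prodMk (h₁.clm_apply hasFDerivAt_snd)
  have hcurve := hΛ.comp_hasDerivAt τ (hx.prodMk hη)
  simp only [Function.comp_def, pullbackL_apply] at hcurve
  convert! hcurve using 1
  symm
  apply eq_hamVF
  rintro ⟨h, γ⟩
  -- The second derivative of `φ` enters once through the test vector `(h, γ)` and once through the
  -- velocity of the curve; the two contributions cancel by symmetry.
  have hsymm : ∀ u v, fderiv ℝ (fderiv ℝ φ) x₀ u v = fderiv ℝ (fderiv ℝ φ) x₀ v u :=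
    fun u v => hφ.isSymmSndFDerivAt_of_omega.eq u v
  -- This writes the test vector `(h, γ)` as the image of `(h, k)` under the derivative `hΛ`.
  obtain ⟨k, hk⟩ := pullback_surjective T' (γ - pullback (fderiv ℝ (fderiv ℝ φ) x₀ h) η₀)
  have hγ : γ = pullback T' k + pullback (fderiv ℝ (fderiv ℝ φ) x₀ h) η₀ := by rw [hk]; abel
  have hd₁ : HasFDerivAt h₁ (fderiv ℝ h₁ (x₀, pullback T' η₀))
      ((fun w : (ℝ × ℝ) × (ℝ × ℝ) => (w.1, pullbackL (fderiv ℝ φ w.1) w.2)) (x₀, η₀)) := by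
    simpa only [pullbackL_apply, hfd] using hh₁.hasFDerivAt
  have hd₂ : HasFDerivAt (fun w : (ℝ × ℝ) × (ℝ × ℝ) => h₂ (φ w.1, w.2)) _ (x₀, η₀) :=
    HasFDerivAt.comp (x₀, η₀) (f := fun w : (ℝ × ℝ) × (ℝ × ℝ) => (φ w.1, w.2)) hh₂.hasFDerivAt
      ((HasFDerivAt.comp (x₀, η₀) (g := φ) hT hasFDerivAt_fst).prodMk hasFDerivAt_snd)
  have heq := (hd₁.comp (x₀, η₀) hΛ).unique (hd₂.congr_of_eventuallyEq (by
    filter_upwards [hcomp] with w hw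
    simpa only [Function.comp_def, pullbackL_apply] using hw))
  have heq' := congrArg (fun f => f (h, k)) heq
  simp only [ContinuousLinearMap.comp_apply, ContinuousLinearMap.prod_apply,
    add_apply, ContinuousLinearMap.flip_apply, ContinuousLinearMap.coe_fst',
    ContinuousLinearMap.coe_snd', pullbackL_apply, hfd, ← hγ] at heq'
  rw [heq', fderiv_eq_hamVF, ← hsol]
  simp only [ContinuousLinearMap.comp_apply, ContinuousLinearMap.prod_apply,
    add_apply, ContinuousLinearMap.flip_apply, ContinuousLinearMap.coe_fst',
    ContinuousLinearMap.coe_snd', pullbackL_apply, hfd, ContinuousLinearEquiv.coe_coe]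
  rw [hγ, planeForm_add, planeForm_add, planeForm_pullback, planeForm_pullback, planeForm_pullback,
    planeForm_pullback, hsymm x' h]
  simp only [ContinuousLinearEquiv.coe_coe]
  ring

/-- Solutions of an autonomous differential equation exist for a uniform time on compact sets. -/
theorem exists_uniform_time {E : Type} [NormedAddCommGroup E] [NormedSpace ℝ E] [CompleteSpace E]
    {X : E → E} {U K : Set E} (hU : IsOpen U) (hX : ∀ w ∈ U, ContDiffAt ℝ 1 X w)
    (hK : IsCompact K) (hKU : K ⊆ U) :
    ∃ ε > 0, ∀ w₀ ∈ K, ∃ w : ℝ → E, w 0 = w₀ ∧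
      ∀ τ ∈ Set.Ioo (-ε) ε, w τ ∈ U ∧ HasDerivAt w (X (w τ)) τ := by
  have hloc : ∀ w₀ ∈ K, ∃ N ∈ 𝓝 w₀, ∃ ε > 0, ∀ w₁ ∈ N, ∃ w : ℝ → E, w 0 = w₁ ∧
      ∀ τ ∈ Set.Ioo (-ε) ε, w τ ∈ U ∧ HasDerivAt w (X (w τ)) τ := by
    intro w₀ hw₀
    obtain ⟨ε, hε, a, r, L, k, hr, hpl⟩ := IsPicardLindelof.of_contDiffAt_one (hX w₀ (hKU hw₀))
    obtain ⟨α, hα, hc⟩ :=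
      (hpl 0).exists_forall_mem_closedBall_eq_hasDerivWithinAt_continuousOn
    have hr' : (0 : ℝ) < r := hr
    have hn : Metric.closedBall w₀ (r : ℝ) ×ˢ Set.Icc (0 - ε) (0 + ε) ∈ 𝓝 (w₀, (0 : ℝ)) :=
      prod_mem_nhds (Metric.closedBall_mem_nhds _ hr') (Icc_mem_nhds (by linarith) (by linarith))
    have h₀ : α (w₀, 0) ∈ U := by
      rw [(hα w₀ (Metric.mem_closedBall_self hr'.le)).1]
      exact hKU hw₀
    -- Picard–Lindelöf gives a common time for nearby starting points; joint continuity of the local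
    -- flow then makes all these curves stay in `U` for a common, shorter time.
    have h₁ : ∀ᶠ p in 𝓝 (w₀, (0 : ℝ)), α p ∈ U :=
      (hc.continuousAt hn).eventually (hU.mem_nhds h₀)
    obtain ⟨N, hN, J, hJ, hNJ⟩ := mem_nhds_prod_iff.1 h₁
    obtain ⟨δ, hδ, hδJ⟩ := Metric.mem_nhds_iff.1 hJ
    refine ⟨N ∩ Metric.closedBall w₀ r, Filter.inter_mem hN (Metric.closedBall_mem_nhds _ hr'),
      min δ ε, lt_min hδ hε, fun w₁ hw₁ => ⟨fun τ => α (w₁, τ), (hα w₁ hw₁.2).1, fun τ hτ => ?_⟩⟩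
    have hτδ : |τ| < δ := (abs_lt.2 hτ).trans_le (min_le_left _ _)
    obtain ⟨h₂, h₃⟩ := abs_lt.1 ((abs_lt.2 hτ).trans_le (min_le_right _ _))
    refine ⟨hNJ ⟨hw₁.1, hδJ (by simpa using hτδ)⟩, ?_⟩
    exact ((hα w₁ hw₁.2).2 τ ⟨by linarith, by linarith⟩).hasDerivAt
      (Icc_mem_nhds (by linarith) (by linarith))
  refine hK.induction_on (p := fun K => ∃ ε > 0, ∀ w₀ ∈ K, ∃ w : ℝ → E, w 0 = w₀ ∧
      ∀ τ ∈ Set.Ioo (-ε) ε, w τ ∈ U ∧ HasDerivAt w (X (w τ)) τ) ⟨1, one_pos, by simp⟩ ?_ ?_ ?_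
  · rintro s t hst ⟨ε, hε, h⟩
    exact ⟨ε, hε, fun w₀ hw₀ => h w₀ (hst hw₀)⟩
  · rintro s t ⟨ε, hε, h⟩ ⟨ε', hε', h'⟩
    refine ⟨min ε ε', lt_min hε hε', ?_⟩
    rintro w₀ (hw₀ | hw₀)
    · obtain ⟨w, hw, H⟩ := h w₀ hw₀
      exact ⟨w, hw, fun τ hτ => H τ (abs_lt.1 ((abs_lt.2 hτ).trans_le (min_le_left _ _)))⟩
    · obtain ⟨w, hw, H⟩ := h' w₀ hw₀
      exact ⟨w, hw, fun τ hτ => H τ (abs_lt.1 ((abs_lt.2 hτ).trans_le (min_le_right _ _)))⟩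
  · intro w₀ hw₀
    obtain ⟨N, hN, h⟩ := hloc w₀ hw₀
    exact ⟨N, mem_nhdsWithin_of_mem_nhds hN, h⟩

/-! ### The Hamiltonian flow on a glued surface -/

namespace AnalyticGluing

variable {M ι : Type} (G : AnalyticGluing M ι) (F : ι → ℝ × ℝ → ℝ × ℝ → ℝ)

/-- Near the parameter value `s`, the curve `γ` is, in some patch, an integral curve of the
Hamiltonian flow of `F`. -/
def IsFlowAt (γ : ℝ → CotangentBundle G.Space) (s : ℝ) : Prop :=
  ∃ i, ∃ w : ℝ → (ℝ × ℝ) × (ℝ × ℝ), ∀ᶠ τ in 𝓝 s, (w τ).1 ∈ G.dom i ∧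
    γ τ = covectorAt (G.chart i) (w τ).1 (w τ).2 ∧
    HasDerivAt w (hamVF (Function.uncurry (F i)) (w τ)) τ

variable {G F} {γ γ₁ γ₂ : ℝ → CotangentBundle G.Space} {s : ℝ}

theorem IsFlowAt.congr (h : G.IsFlowAt F γ₁ s) (h' : γ₂ =ᶠ[𝓝 s] γ₁) : G.IsFlowAt F γ₂ s := by
  obtain ⟨i, w, hw⟩ := h
  refine ⟨i, w, ?_⟩
  filter_upwards [hw, h'] with τ h₁ h₂
  rwa [h₂]

theorem IsFlowAt.comp_sub (h : G.IsFlowAt F γ (s - a)) : G.IsFlowAt F (fun τ => γ (τ - a)) s := by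
  obtain ⟨i, w, hw⟩ := h
  refine ⟨i, fun τ => w (τ - a), ?_⟩
  have hc : ContinuousAt (fun τ : ℝ => τ - a) s := by fun_prop
  filter_upwards [hc.eventually hw] with τ ⟨h₁, h₂, h₃⟩
  exact ⟨h₁, h₂, h₃.comp_sub_const τ a⟩

/-- The functions `F i` are analytic and come from a function `H` on the cotangent bundle. -/
structure IsExpression (G : AnalyticGluing M ι) (H : CotangentBundle G.Space → ℝ)
    (F : ι → ℝ × ℝ → ℝ × ℝ → ℝ) : Prop where
  contDiffAt : ∀ i, ∀ x ∈ G.dom i, ∀ ξ, ContDiffAt ℝ ω (Function.uncurry (F i)) (x, ξ)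
  apply_covectorAt : ∀ i, ∀ x ∈ G.dom i, ∀ ξ, H (covectorAt (G.chart i) x ξ) = F i x ξ

variable {H : CotangentBundle G.Space → ℝ}

/-- A curve given in patch `j` is moved to patch `i` by the local inverse `R` of a transition `T`
and by pulling covectors back along `T`; `hasDerivAt_pullback_hamVF` keeps Hamilton's equations.
This makes curves given in different patches comparable. -/
theorem IsFlowAt.exists_in_chart (hH : IsExpression G H F) (h : G.IsFlowAt F γ s) {i : ι}
    {x₀ ξ₀ : ℝ × ℝ} (hx₀ : x₀ ∈ G.dom i) (hγ : γ s = covectorAt (G.chart i) x₀ ξ₀) :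
    ∃ w : ℝ → (ℝ × ℝ) × (ℝ × ℝ), w s = (x₀, ξ₀) ∧ ∀ᶠ τ in 𝓝 s, (w τ).1 ∈ G.dom i ∧
      γ τ = covectorAt (G.chart i) (w τ).1 (w τ).2 ∧
      HasDerivAt w (hamVF (Function.uncurry (F i)) (w τ)) τ := by
  obtain ⟨j, v, hv⟩ := h
  obtain ⟨hvs, hγs, hds⟩ := hv.self_of_nhds
  have hpt : G.param i x₀ = G.param j (v s).1 :=
    congrArg Bundle.TotalSpace.proj (hγ.symm.trans hγs)
  obtain ⟨T, T', hT, hTx⟩ := G.exists_transition_of_eq hx₀ hvs hpt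
  obtain ⟨R, hR, hRy, hTR⟩ := hT.exists_inverse
  rw [hTx] at hR hRy hTR
  have hvc : ContinuousAt (fun τ => (v τ).1) s := hds.continuousAt.fst
  have hRc : ContinuousAt R (v s).1 := hR.contDiffAt.continuousAt
  have hdomi := G.isOpen_dom i
  have hdomj := G.isOpen_dom j
  have hev : ∀ᶠ y in 𝓝 (v s).1, T (R y) = y ∧ R y ∈ G.dom i ∧ DifferentiableAt ℝ R y ∧
      ∃ T'', IsTransition (G.param i) (G.param j) T T'' (R y) := by
    refine hTR.and (Filter.Eventually.and ?_ (Filter.Eventually.and ?_ ?_))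
    · exact hRc.eventually (by rw [hRy]; exact hdomi.mem_nhds hx₀)
    · filter_upwards [hR.contDiffAt.eventually (by simp)] with y hy
      exact hy.differentiableAt (by simp)
    · exact hRc.eventually (by rw [hRy]; exact hT.eventually_isTransition)
  refine ⟨fun τ => (R (v τ).1, pullback (fderiv ℝ T (R (v τ).1)) (v τ).2), ?_, ?_⟩
  · have h₁ := G.covectorAt_transition hx₀ (hTx ▸ hvs) hT (v s).2
    rw [hTx, ← hγs, hγ] at h₁
    change (R (v s).1, pullback (fderiv ℝ T (R (v s).1)) (v s).2) = _
    rw [hRy, hT.hasFDerivAt.fderiv, G.covectorAt_injective hx₀ h₁]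
  · filter_upwards [hv.eventually_nhds, (hvc.eventually hev.eventually_nhds)] with τ h₁ h₂
    obtain ⟨h₃, h₄, h₅⟩ := h₁.self_of_nhds
    obtain ⟨h₆, h₇, h₈, T'', hT''⟩ := h₂.self_of_nhds
    have h₉ : T (R (v τ).1) ∈ G.dom j := by rwa [h₆]
    refine ⟨h₇, ?_, ?_⟩
    · rw [h₄]
      have := G.covectorAt_transition h₇ h₉ hT'' (v τ).2
      rw [h₆] at this
      rw [← this, hT''.hasFDerivAt.fderiv]
    · have hv₁ : HasDerivAt (fun σ => (v σ).1) (hamVF (Function.uncurry (F j)) (v τ)).1 τ := h₅.fst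
      have hv₂ : HasDerivAt (fun σ => (v σ).2) (hamVF (Function.uncurry (F j)) (v τ)).2 τ := h₅.snd
      have hx : HasDerivAt (fun σ => R (v σ).1) (fderiv ℝ R (v τ).1
          (hamVF (Function.uncurry (F j)) (v τ)).1) τ :=
        HasFDerivAt.comp_hasDerivAt τ (f := fun σ => (v σ).1) h₈.hasFDerivAt hv₁
      have hTd : HasDerivAt (fun σ => T (R (v σ).1)) (T'' (fderiv ℝ R (v τ).1
          (hamVF (Function.uncurry (F j)) (v τ)).1)) τ :=
        HasFDerivAt.comp_hasDerivAt τ (f := fun σ => R (v σ).1) hT''.hasFDerivAt hx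
      have hTe : (fun σ => T (R (v σ).1)) =ᶠ[𝓝 τ] fun σ => (v σ).1 := by
        filter_upwards [hv₁.continuousAt.eventually h₂] with σ hσ
        exact hσ.1
      have hT' := hTd.unique (hv₁.congr_of_eventuallyEq hTe)
      have := hasDerivAt_pullback_hamVF (h₁ := Function.uncurry (F i))
        (h₂ := Function.uncurry (F j)) hx hv₂ hT''.contDiffAt hT''.hasFDerivAt
        ((hH.contDiffAt i _ h₇ _).differentiableAt (by simp))
        ((hH.contDiffAt j _ h₉ _).differentiableAt (by simp)) ?_ (by rw [hT', h₆])
      · rwa [← hT''.hasFDerivAt.fderiv] at this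
      · have hTc := hT''.contDiffAt.continuousAt
        have hev₂ : ∀ᶠ x in 𝓝 (R (v τ).1), x ∈ G.dom i ∧ T x ∈ G.dom j ∧
            ∃ T₃, IsTransition (G.param i) (G.param j) T T₃ x :=
          Filter.Eventually.and (hdomi.mem_nhds h₇)
            ((hTc.eventually (hdomj.mem_nhds h₉)).and hT''.eventually_isTransition)
        have hfst : ContinuousAt (Prod.fst : (ℝ × ℝ) × (ℝ × ℝ) → ℝ × ℝ)
          (R (v τ).1, (v τ).2) := continuousAt_fst
        filter_upwards [hfst.eventually hev₂] with w ⟨hw₁, hw₂, T₃, hT₃⟩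
        simp only [Function.uncurry]
        rw [← hH.apply_covectorAt i _ hw₁, ← hH.apply_covectorAt j _ hw₂,
          ← G.covectorAt_transition hw₁ hw₂ hT₃, hT₃.hasFDerivAt.fderiv]

/-- The Hamiltonian flow is locally unique. -/
theorem IsFlowAt.eventuallyEq (hH : IsExpression G H F) (h₁ : G.IsFlowAt F γ₁ s)
    (h₂ : G.IsFlowAt F γ₂ s) (h : γ₁ s = γ₂ s) : γ₁ =ᶠ[𝓝 s] γ₂ := by
  obtain ⟨i, w, hw⟩ := h₁
  obtain ⟨hws, hγs, hds⟩ := hw.self_of_nhds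
  obtain ⟨v, hvs, hv⟩ := h₂.exists_in_chart hH hws (h.symm.trans hγs)
  obtain ⟨k, t, ht, hl⟩ :=
    (contDiffAt_hamVF (hH.contDiffAt i _ hws (w s).2)).exists_lipschitzOnWith
  have hvd := hv.self_of_nhds.2.2
  have heq : w =ᶠ[𝓝 s] v := by
    refine ODE_solution_unique_of_eventually (v := fun _ => hamVF (Function.uncurry (F i)))
      (s := fun _ => t) (K := k) (Filter.Eventually.of_forall fun _ => hl) ?_ ?_ hvs.symm
    · filter_upwards [hw, hds.continuousAt.eventually ht] with τ h₁ h₂ using ⟨h₁.2.2, h₂⟩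
    · filter_upwards [hv, hvd.continuousAt.eventually (by rw [hvs]; exact ht)] with τ h₁ h₂
      exact ⟨h₁.2.2, h₂⟩
  filter_upwards [hw, hv, heq] with τ h₁ h₂ h₃
  rw [h₁.2.1, h₂.2.1, h₃]

/-- The Hamiltonian flow is complete on an invariant set on which it exists for a uniform time. -/
theorem exists_complete_flow (hH : IsExpression G H F) {Z : Set (CotangentBundle G.Space)} {ε : ℝ}
    (hε : 0 < ε)
    (hloc : ∀ z ∈ Z, ∃ γ, γ 0 = z ∧ ∀ s ∈ Set.Ioo (-ε) ε, G.IsFlowAt F γ s)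
    (hinv : ∀ γ b, (∀ s ∈ Set.Ioo (-b) b, G.IsFlowAt F γ s) → γ 0 ∈ Z →
      ∀ s ∈ Set.Ioo (-b) b, γ s ∈ Z) {z : CotangentBundle G.Space} (hz : z ∈ Z) :
    ∃ γ, γ 0 = z ∧ ∀ s, G.IsFlowAt F γ s := by
  -- A flow on `(-b, b)` is cut at `±(b - ε/2)`, where it is still in `Z`, and continued by flows of
  -- duration `ε`; this gains `ε/2` at both ends. At the cuts only local uniqueness is used, so this
  -- argument does not need the Hausdorff property.
  have step : ∀ (b : ℝ) (γ : ℝ → CotangentBundle G.Space), ε ≤ b → γ 0 = z →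
      (∀ s ∈ Set.Ioo (-b) b, G.IsFlowAt F γ s) → ∃ γ', (∀ τ, |τ| ≤ b - ε / 2 → γ' τ = γ τ) ∧
      ∀ s ∈ Set.Ioo (-(b + ε / 2)) (b + ε / 2), G.IsFlowAt F γ' s := by
    intro b γ hb hγ hf
    have hm₁ : b - ε / 2 ∈ Set.Ioo (-b) b := ⟨by linarith, by linarith⟩
    have hm₂ : -(b - ε / 2) ∈ Set.Ioo (-b) b := ⟨by linarith, by linarith⟩
    obtain ⟨β, hβ₀, hβ⟩ := hloc _ (hinv γ b hf (hγ ▸ hz) _ hm₁)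
    obtain ⟨δ, hδ₀, hδ⟩ := hloc _ (hinv γ b hf (hγ ▸ hz) _ hm₂)
    set c := b - ε / 2 with hc
    have hc0 : 0 < c := by linarith
    have hβ' : ∀ s ∈ Set.Ioo (c - ε) (c + ε), G.IsFlowAt F (fun τ => β (τ - c)) s :=
      fun s hs => (hβ _ ⟨by linarith [hs.1], by linarith [hs.2]⟩).comp_sub
    have hδ' : ∀ s ∈ Set.Ioo (-c - ε) (-c + ε), G.IsFlowAt F (fun τ => δ (τ - -c)) s :=
      fun s hs => (hδ _ ⟨by linarith [hs.1], by linarith [hs.2]⟩).comp_sub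
    have e₁ : (fun τ => β (τ - c)) =ᶠ[𝓝 c] γ :=
      (hβ' c ⟨by linarith, by linarith⟩).eventuallyEq hH (hf _ hm₁) (by simpa using hβ₀)
    have e₂ : (fun τ => δ (τ - -c)) =ᶠ[𝓝 (-c)] γ :=
      (hδ' (-c) ⟨by linarith, by linarith⟩).eventuallyEq hH (hf _ hm₂) (by simpa using hδ₀)
    refine ⟨fun τ => if c < τ then β (τ - c) else if τ < -c then δ (τ - -c) else γ τ, ?_, ?_⟩
    · intro τ hτ
      obtain ⟨h₁, h₂⟩ := abs_le.1 hτ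
      simp [not_lt.2 h₁, not_lt.2 h₂]
    · intro s hs
      rcases lt_trichotomy s c with h | h | h
      · rcases lt_trichotomy s (-c) with h' | rfl | h'
        · refine (hδ' s ⟨by linarith [hs.1], by linarith⟩).congr ?_
          filter_upwards [gt_mem_nhds h', gt_mem_nhds h] with τ h₁ h₂
          simp [h₁, not_lt.2 h₂.le]
        · refine (hf _ hm₂).congr ?_
          filter_upwards [gt_mem_nhds h, e₂] with τ h₁ h₂
          simp only [not_lt.2 h₁.le, if_false]
          split_ifs
          · exact h₂
          · rfl
        · refine (hf s ⟨by linarith, by linarith⟩).congr ?_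
          filter_upwards [lt_mem_nhds h', gt_mem_nhds h] with τ h₁ h₂
          simp [not_lt.2 h₁.le, not_lt.2 h₂.le]
      · rw [h]
        refine (hf _ hm₁).congr ?_
        filter_upwards [lt_mem_nhds (show -c < c by linarith), e₁] with τ h₁ h₂
        rw [if_neg (not_lt.2 h₁.le)]
        split_ifs
        · exact h₂
        · rfl
      · refine (hβ' s ⟨by linarith, by linarith [hs.2]⟩).congr ?_
        filter_upwards [lt_mem_nhds h] with τ h₁
        simp [h₁]
  choose! next hnext hflow using step
  obtain ⟨γ₀, h₀, hf₀⟩ := hloc z hz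
  let Γ : ℕ → ℝ → CotangentBundle G.Space := fun n =>
    Nat.rec γ₀ (fun n γ => next (ε + n * (ε / 2)) γ) n
  have hΓs : ∀ n : ℕ, Γ (n + 1) = next (ε + n * (ε / 2)) (Γ n) := fun n => rfl
  have hpos : ∀ n : ℕ, 0 ≤ n * (ε / 2) := fun n => by positivity
  have hΓ : ∀ n : ℕ, Γ n 0 = z ∧
      ∀ s ∈ Set.Ioo (-(ε + n * (ε / 2))) (ε + n * (ε / 2)), G.IsFlowAt F (Γ n) s := by
    intro n
    induction n with
    | zero => exact ⟨h₀, fun s hs => hf₀ s (by simpa using hs)⟩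
    | succ n ih =>
      rw [hΓs]
      refine ⟨?_, ?_⟩
      · rw [hnext _ _ (by linarith [hpos n]) ih.1 ih.2 0 (by rw [abs_zero]; linarith [hpos n])]
        exact ih.1
      · have := hflow _ _ (by linarith [hpos n]) ih.1 ih.2
        have e : ε + ((n + 1 : ℕ) : ℝ) * (ε / 2) = ε + n * (ε / 2) + ε / 2 := by push_cast; ring
        rwa [e]
  -- Stage `m + 1` leaves stage `m` unchanged for `|τ| ≤ (ε + m ε/2) - ε/2`, which includes `|τ| ≤ m
  -- ε/2`.
  have hagree : ∀ n m : ℕ, n ≤ m → ∀ τ, |τ| ≤ n * (ε / 2) → Γ m τ = Γ n τ := by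
    intro n m hnm τ hτ
    induction m, hnm using Nat.le_induction with
    | base => rfl
    | succ m hm ih =>
      rw [hΓs, hnext _ _ (by linarith [hpos m]) (hΓ m).1 (hΓ m).2 τ ?_, ih]
      have : (n : ℝ) * (ε / 2) ≤ m * (ε / 2) := by gcongr
      linarith
  have hceil : ∀ t : ℝ, t ≤ ⌈t / (ε / 2)⌉₊ * (ε / 2) := fun t => by
    rw [← div_le_iff₀ (by positivity)]
    exact Nat.le_ceil _
  refine ⟨fun τ => Γ ⌈|τ| / (ε / 2)⌉₊ τ, (hΓ _).1, fun s => ?_⟩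
  -- The extra `1` makes the single stage `n` agree with the limit curve on a whole neighbourhood of
  -- `s`.
  set n := ⌈(|s| + 1) / (ε / 2)⌉₊ with hn
  have hs : |s| < ε + n * (ε / 2) := by
    have := hceil (|s| + 1)
    rw [← hn] at this
    linarith
  refine ((hΓ n).2 s (abs_lt.1 hs)).congr ?_
  have hcont : ContinuousAt (fun τ : ℝ => |τ|) s := continuous_abs.continuousAt
  filter_upwards [hcont.eventually (gt_mem_nhds (lt_add_one |s|))] with τ hτ
  refine (hagree _ _ ?_ τ (hceil _)).symm
  exact Nat.ceil_mono (by gcongr)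

theorem IsFlowAt.hamiltonEquationsAt (hH : IsExpression G H F) (h : G.IsFlowAt F γ s) :
    HamiltonEquationsAt H γ s := by
  obtain ⟨i, w, hw⟩ := h
  obtain ⟨hws, -, hd⟩ := hw.self_of_nhds
  refine ⟨G.chart i, G.chart_mem_maximalAtlas i, fun τ => (w τ).1.1, fun τ => (w τ).1.2,
    fun τ => (w τ).2.1, fun τ => (w τ).2.2, ?_, ?_, ?_, ?_, ?_⟩
  · filter_upwards [hw] with τ hτ using ⟨hτ.1, hτ.2.1⟩
  all_goals
    have hd' := (hH.contDiffAt i _ hws (w s).2).differentiableAt (by simp)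
  · have e : (fun a => H (covectorAt (G.chart i) ((w s).1.1, (w s).1.2) (a, (w s).2.2))) =
        fun a => Function.uncurry (F i) ((w s).1, (a, (w s).2.2)) :=
      funext fun a => hH.apply_covectorAt i _ hws _
    have hl : HasDerivAt (fun a : ℝ => ((w s).1, (a, (w s).2.2)))
        ((0, (1, 0)) : (ℝ × ℝ) × (ℝ × ℝ)) (w s).2.1 :=
      (hasDerivAt_const _ _).prodMk ((hasDerivAt_id _).prodMk (hasDerivAt_const _ _))
    refine HasDerivAt.congr_deriv (f' := (hamVF (Function.uncurry (F i)) (w s)).1.1) hd.fst.fst ?_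
    rw [e]
    exact (HasFDerivAt.comp_hasDerivAt (w s).2.1 hd'.hasFDerivAt hl).deriv.symm
  · have e : (fun a => H (covectorAt (G.chart i) ((w s).1.1, (w s).1.2) ((w s).2.1, a))) =
        fun a => Function.uncurry (F i) ((w s).1, ((w s).2.1, a)) :=
      funext fun a => hH.apply_covectorAt i _ hws _
    have hl : HasDerivAt (fun a : ℝ => ((w s).1, ((w s).2.1, a)))
        ((0, (0, 1)) : (ℝ × ℝ) × (ℝ × ℝ)) (w s).2.2 :=
      (hasDerivAt_const _ _).prodMk ((hasDerivAt_const _ _).prodMk (hasDerivAt_id _))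
    refine HasDerivAt.congr_deriv (f' := (hamVF (Function.uncurry (F i)) (w s)).1.2) hd.fst.snd ?_
    rw [e]
    exact (HasFDerivAt.comp_hasDerivAt (w s).2.2 hd'.hasFDerivAt hl).deriv.symm
  · have e : (fun a => H (covectorAt (G.chart i) (a, (w s).1.2) ((w s).2.1, (w s).2.2)))
        =ᶠ[𝓝 (w s).1.1] fun a => Function.uncurry (F i) ((a, (w s).1.2), (w s).2) := by
      have hc : ContinuousAt (fun a : ℝ => (a, (w s).1.2)) (w s).1.1 := by fun_prop
      filter_upwards [hc.eventually ((G.isOpen_dom i).mem_nhds hws)] with a ha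
      exact hH.apply_covectorAt i _ ha _
    have hl : HasDerivAt (fun a : ℝ => ((a, (w s).1.2), (w s).2))
        (((1, 0), 0) : (ℝ × ℝ) × (ℝ × ℝ)) (w s).1.1 :=
      ((hasDerivAt_id _).prodMk (hasDerivAt_const _ _)).prodMk (hasDerivAt_const _ _)
    refine HasDerivAt.congr_deriv (f' := (hamVF (Function.uncurry (F i)) (w s)).2.1) hd.snd.fst ?_
    rw [e.deriv_eq]
    exact congrArg Neg.neg (HasFDerivAt.comp_hasDerivAt (w s).1.1 hd'.hasFDerivAt hl).deriv.symm
  · have e : (fun a => H (covectorAt (G.chart i) ((w s).1.1, a) ((w s).2.1, (w s).2.2)))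
        =ᶠ[𝓝 (w s).1.2] fun a => Function.uncurry (F i) (((w s).1.1, a), (w s).2) := by
      have hc : ContinuousAt (fun a : ℝ => ((w s).1.1, a)) (w s).1.2 := by fun_prop
      filter_upwards [hc.eventually ((G.isOpen_dom i).mem_nhds hws)] with a ha
      exact hH.apply_covectorAt i _ ha _
    have hl : HasDerivAt (fun a : ℝ => (((w s).1.1, a), (w s).2))
        (((0, 1), 0) : (ℝ × ℝ) × (ℝ × ℝ)) (w s).1.2 :=
      ((hasDerivAt_const _ _).prodMk (hasDerivAt_id _)).prodMk (hasDerivAt_const _ _)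
    refine HasDerivAt.congr_deriv (f' := (hamVF (Function.uncurry (F i)) (w s)).2.2) hd.snd.snd ?_
    rw [e.deriv_eq]
    exact congrArg Neg.neg (HasFDerivAt.comp_hasDerivAt (w s).1.2 hd'.hasFDerivAt hl).deriv.symm

/-- A function whose Poisson bracket with the Hamiltonian vanishes in every patch is constant along
the flow. -/
theorem const_of_isFlowAt {J : CotangentBundle G.Space → ℝ} {F' : ι → ℝ × ℝ → ℝ × ℝ → ℝ}
    (hJ : IsExpression G J F')
    (hbr : ∀ i, ∀ x ∈ G.dom i, ∀ ξ, fderiv ℝ (Function.uncurry (F' i)) (x, ξ)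
      (hamVF (Function.uncurry (F i)) (x, ξ)) = 0) {b : ℝ}
    (h : ∀ s ∈ Set.Ioo (-b) b, G.IsFlowAt F γ s) (hs : s ∈ Set.Ioo (-b) b) : J (γ s) = J (γ 0) := by
  have hd : ∀ s ∈ Set.Ioo (-b) b, HasDerivAt (fun τ => J (γ τ)) 0 s := by
    intro s hs
    obtain ⟨i, w, hw⟩ := h s hs
    obtain ⟨hws, -, hd⟩ := hw.self_of_nhds
    have hd' := (hJ.contDiffAt i _ hws (w s).2).differentiableAt (by simp)
    have h₁ := HasFDerivAt.comp_hasDerivAt s (f := w) hd'.hasFDerivAt hd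
    rw [hbr i _ hws] at h₁
    refine h₁.congr_of_eventuallyEq ?_
    filter_upwards [hw] with τ hτ
    rw [hτ.2.1, hJ.apply_covectorAt i _ hτ.1]
    rfl
  refine isOpen_Ioo.is_const_of_deriv_eq_zero isPreconnected_Ioo
    (fun s hs => (hd s hs).differentiableAt.differentiableWithinAt) (fun s hs => (hd s hs).deriv) hs
    ⟨?_, ?_⟩ <;> linarith [hs.1, hs.2]

end AnalyticGluing

/-! ### The Lambert function -/

theorem hasDerivAt_mul_exp (w : ℝ) :
    HasDerivAt (fun w : ℝ => w * Real.exp w) (Real.exp w * (1 + w)) w := by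
  convert! (hasDerivAt_id w).mul (Real.hasDerivAt_exp w) using 1
  simp only [id]; ring

theorem strictMonoOn_mul_exp : StrictMonoOn (fun w : ℝ => w * Real.exp w) (Set.Ici (-1)) := by
  refine strictMonoOn_of_deriv_pos (convex_Ici _) (by fun_prop) fun w hw => ?_
  rw [interior_Ici, Set.mem_Ioi] at hw
  rw [(hasDerivAt_mul_exp w).deriv]
  have := Real.exp_pos w
  have : 0 < 1 + w := by linarith
  positivity

theorem lambertW_mul_exp_self {w : ℝ} (hw : -1 ≤ w) : lambertW (w * Real.exp w) = w :=
  strictMonoOn_mul_exp.injOn.leftInvOn_invFunOn hw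

theorem exists_mul_exp_eq {z : ℝ} (hz : -1 < Real.exp 1 * z) :
    ∃ w, -1 < w ∧ w * Real.exp w = z := by
  have h₀ : (-1 : ℝ) * Real.exp (-1) < z := by
    have h₁ : Real.exp (-1) * Real.exp 1 = 1 := by rw [← Real.exp_add]; simp
    have h₂ : 0 < Real.exp (-1) := Real.exp_pos _
    nlinarith
  have hz' : z ≤ |z| * Real.exp |z| := by
    have := Real.one_le_exp (abs_nonneg z)
    nlinarith [le_abs_self z, abs_nonneg z]
  have hle : (-1 : ℝ) ≤ |z| := by linarith [abs_nonneg z]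
  obtain ⟨w, hw, rfl⟩ := intermediate_value_Icc hle
    (f := fun w : ℝ => w * Real.exp w) (by fun_prop) ⟨h₀.le, hz'⟩
  refine ⟨w, lt_of_le_of_ne hw.1 ?_, rfl⟩
  rintro rfl
  exact lt_irrefl _ h₀

theorem lambertW_spec {z : ℝ} (hz : -1 < Real.exp 1 * z) :
    -1 < lambertW z ∧ lambertW z * Real.exp (lambertW z) = z := by
  obtain ⟨w, hw, rfl⟩ := exists_mul_exp_eq hz
  rw [lambertW_mul_exp_self hw.le]
  exact ⟨hw, rfl⟩

theorem neg_one_lt_exp_mul {w : ℝ} (hw : -1 < w) : -1 < Real.exp 1 * (w * Real.exp w) := by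
  have h₁ : (-1 : ℝ) * Real.exp (-1) < w * Real.exp w :=
    strictMonoOn_mul_exp (Set.mem_Ici.2 le_rfl) (Set.mem_Ici.2 hw.le) hw
  have h₂ : Real.exp 1 * Real.exp (-1) = 1 := by rw [← Real.exp_add]; simp
  nlinarith [Real.exp_pos 1]

/-- The derivative `eʷ(1 + w)` does not vanish for `w > -1`, so the inverse function theorem
applies; the analytic local inverse stays above `-1`, hence is the principal branch. -/
theorem contDiffAt_lambertW {z : ℝ} (hz : -1 < Real.exp 1 * z) : ContDiffAt ℝ ω lambertW z := by
  obtain ⟨w, hw, rfl⟩ := exists_mul_exp_eq hz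
  have hne : Real.exp w * (1 + w) ≠ 0 := by
    have : 1 + w ≠ 0 := by linarith
    positivity
  have hc : ContDiffAt ℝ ω (fun w : ℝ => w * Real.exp w) w := by fun_prop
  have hf : HasFDerivAt (fun w : ℝ => w * Real.exp w)
      ((ContinuousLinearEquiv.unitsEquivAut ℝ (Units.mk0 _ hne) : ℝ ≃L[ℝ] ℝ) : ℝ →L[ℝ] ℝ) w := by
    convert! (hasDerivAt_mul_exp w).hasFDerivAt using 1
  have hs := hc.hasStrictFDerivAt' hf (by simp)
  have hL : ContDiffAt ℝ ω (hc.localInverse hf (by simp)) (w * Real.exp w) :=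
    hc.to_localInverse hf (by simp)
  refine hL.congr_of_eventuallyEq ?_
  have h₁ : ∀ᶠ z in 𝓝 (w * Real.exp w), -1 < hc.localInverse hf (by simp) z := by
    refine hL.continuousAt.eventually (lt_mem_nhds ?_)
    rwa [hc.localInverse_apply_image hf (by simp)]
  filter_upwards [h₁, hs.eventually_right_inverse] with z h₂ h₃
  conv_lhs => rw [← h₃]
  exact lambertW_mul_exp_self h₂.le

theorem mem_kruskalDomain {x : ℝ × ℝ} : x ∈ kruskalDomain ↔ -1 < Real.exp 1 * (x.1 * x.2) := by
  rw [← mul_assoc]; rfl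

theorem mem_kruskalDomain_of_eq {x : ℝ × ℝ} {w : ℝ} (hw : -1 < w)
    (h : x.1 * x.2 = w * Real.exp w) : x ∈ kruskalDomain := by
  rw [mem_kruskalDomain, h]
  exact neg_one_lt_exp_mul hw

theorem isOpen_kruskalDomain : IsOpen kruskalDomain :=
  isOpen_lt (by fun_prop) (by fun_prop)

/-! ### The Hamiltonians of the patches -/

theorem geodesicHamiltonian_stringMetric {x : ℝ × ℝ} (hx : 1 < x.2) (ξ : ℝ × ℝ) :
    geodesicHamiltonian (stringMetric x) ξ =
      x.2 ^ 3 / (2 * (x.2 - 1)) * ξ.1 ^ 2 - x.2 * (x.2 - 1) / 2 * ξ.2 ^ 2 := by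
  have h₁ : x.2 - 1 ≠ 0 := by linarith
  have h₂ : x.2 ≠ 0 := by linarith
  have hinv : (stringMetric x)⁻¹ =
      !![x.2 ^ 3 / (x.2 - 1), 0; 0, -(x.2 * (x.2 - 1))] := by
    refine Matrix.inv_eq_right_inv ?_
    ext i j
    fin_cases i <;> fin_cases j <;> simp [stringMetric, Matrix.mul_apply] <;> field_simp
  rw [geodesicHamiltonian, hinv]
  simp [Matrix.mulVec, dotProduct]
  field_simp
  ring

theorem geodesicHamiltonian_kruskalMetric {x : ℝ × ℝ} (hx : x ∈ kruskalDomain) (ξ : ℝ × ℝ) :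
    geodesicHamiltonian (kruskalMetric x) ξ =
      -(Real.exp (lambertW (x.1 * x.2)) * (1 + lambertW (x.1 * x.2)) ^ 3 / 2) * (ξ.1 * ξ.2) := by
  have hW := (lambertW_spec (mem_kruskalDomain.1 hx)).1
  set w := lambertW (x.1 * x.2) with hw
  have h₁ : 1 + w ≠ 0 := by linarith
  have hinv : (kruskalMetric x)⁻¹ =
      !![0, -(Real.exp w * (1 + w) ^ 3 / 2); -(Real.exp w * (1 + w) ^ 3 / 2), 0] := by
    refine Matrix.inv_eq_right_inv ?_
    have h₂ : Real.exp (-w) * Real.exp w = 1 := by rw [← Real.exp_add]; simp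
    ext i j
    fin_cases i <;> fin_cases j <;> simp [kruskalMetric, Matrix.mul_apply, ← hw] <;> field_simp <;>
      linarith
  rw [geodesicHamiltonian, hinv]
  simp [Matrix.mulVec, dotProduct]
  ring

theorem geodesicHamiltonian_eddingtonMetric (x ξ : ℝ × ℝ) :
    geodesicHamiltonian (eddingtonMetric x) ξ =
      ξ.1 * ξ.2 - x.2 ^ 2 * (1 - x.2) / 2 * ξ.2 ^ 2 := by
  have hinv : (eddingtonMetric x)⁻¹ = !![0, 1; 1, -(x.2 ^ 2 * (1 - x.2))] := by
    refine Matrix.inv_eq_right_inv ?_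
    ext i j
    fin_cases i <;> fin_cases j <;> simp [eddingtonMetric, Matrix.mul_apply]
  rw [geodesicHamiltonian, hinv]
  simp [Matrix.mulVec, dotProduct]
  ring

/-- The energy, the momentum of the Killing field `∂ₜ`, in the Kruskal–Szekeres coordinates. -/
def kruskalEnergy (x ξ : ℝ × ℝ) : ℝ := (x.1 * ξ.1 - x.2 * ξ.2) / 2

/-! ### The coordinate changes -/

/-- The linear map with matrix `!![a, b; c, d]`. -/
def planeMap (a b c d : ℝ) : (ℝ × ℝ) →L[ℝ] (ℝ × ℝ) :=
  (a • ContinuousLinearMap.fst ℝ ℝ ℝ + b • ContinuousLinearMap.snd ℝ ℝ ℝ).prod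
    (c • ContinuousLinearMap.fst ℝ ℝ ℝ + d • ContinuousLinearMap.snd ℝ ℝ ℝ)

@[simp] theorem planeMap_apply (a b c d : ℝ) (v : ℝ × ℝ) :
    planeMap a b c d v = (a * v.1 + b * v.2, c * v.1 + d * v.2) := by
  simp [planeMap]

theorem exists_planeMap_equiv {a b c d : ℝ} (h : a * d - b * c ≠ 0) :
    ∃ L : (ℝ × ℝ) ≃L[ℝ] (ℝ × ℝ), (L : (ℝ × ℝ) →L[ℝ] (ℝ × ℝ)) = planeMap a b c d := by
  obtain ⟨D, hD⟩ : ∃ D, D = a * d - b * c := ⟨_, rfl⟩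
  rw [← hD] at h
  refine ⟨ContinuousLinearEquiv.equivOfInverse (planeMap a b c d)
    (D⁻¹ • planeMap d (-b) (-c) a) ?_ ?_, rfl⟩ <;>
  · intro v
    ext <;> simp <;> field_simp <;> rw [hD] <;> ring

theorem pullback_planeMap (a b c d : ℝ) (η : ℝ × ℝ) :
    pullback (planeMap a b c d) η = (η.1 * a + η.2 * c, η.1 * b + η.2 * d) := by
  simp [pullback_apply]

/-- The coordinate change `T` is analytic at `x`, with invertible derivative, and takes the
Hamiltonian `h` and the energy `e` to `h'` and `e'`. -/
structure Intertwines (T : ℝ × ℝ → ℝ × ℝ) (x : ℝ × ℝ) (h e h' e' : ℝ × ℝ → ℝ × ℝ → ℝ)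
    (T' : (ℝ × ℝ) ≃L[ℝ] (ℝ × ℝ)) : Prop where
  contDiffAt : ContDiffAt ℝ ω T x
  hasFDerivAt : HasFDerivAt T (T' : (ℝ × ℝ) →L[ℝ] (ℝ × ℝ)) x
  hamiltonian : ∀ η, h x (pullback T' η) = h' (T x) η
  energy : ∀ η, e x (pullback T' η) = e' (T x) η

theorem Intertwines.refl (x : ℝ × ℝ) (h e : ℝ × ℝ → ℝ × ℝ → ℝ) :
    Intertwines id x h e h e (ContinuousLinearEquiv.refl ℝ _) :=
  ⟨contDiffAt_id, hasFDerivAt_id x, fun η => by simp [pullback_apply], fun η => by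
    simp [pullback_apply]⟩

theorem sgn_mul_self (δ : ℤˣ) : sgn δ * sgn δ = 1 := by
  rcases Int.units_eq_one_or δ with rfl | rfl <;> simp [sgn]

theorem sgn_ne_zero (δ : ℤˣ) : sgn δ ≠ 0 := fun h => by
  have := sgn_mul_self δ
  simp [h] at this

/-- Every coordinate relation with a Kruskal–Szekeres patch gives `pq = (r - 1)e^{r-1}`. Hence the
image lies in `kruskalDomain` when `r > 0`, and `W(pq) = r - 1` recovers `r`. -/
theorem kruskalOfString_mul {x : ℝ × ℝ} (hx : 1 < x.2) :
    (kruskalOfString x).1 * (kruskalOfString x).2 = (x.2 - 1) * Real.exp (x.2 - 1) := by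
  have h : √(x.2 - 1) * √(x.2 - 1) = x.2 - 1 := Real.mul_self_sqrt (by linarith)
  have e : Real.exp ((x.2 + x.1 - 1) / 2) * Real.exp ((x.2 - x.1 - 1) / 2) = Real.exp (x.2 - 1) := by
    rw [← Real.exp_add]; ring_nf
  simp only [kruskalOfString]
  linear_combination (Real.exp (x.2 - 1)) * h + √(x.2 - 1) * √(x.2 - 1) * e

theorem kruskalOfSingular_mul (δ : ℤˣ) {y : ℝ × ℝ} (hy : y ∈ singularDomain) :
    (kruskalOfSingular δ y).1 * (kruskalOfSingular δ y).2 =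
      (y.2 ^ 2 - 1) * Real.exp (y.2 ^ 2 - 1) := by
  have h : √(1 - y.2 ^ 2) * √(1 - y.2 ^ 2) = 1 - y.2 ^ 2 :=
    Real.mul_self_sqrt (by nlinarith [hy.1, hy.2])
  have e : Real.exp ((y.2 ^ 2 + y.1 - 1) / 2) * Real.exp ((y.2 ^ 2 - y.1 - 1) / 2) =
      Real.exp (y.2 ^ 2 - 1) := by
    rw [← Real.exp_add]; ring_nf
  simp only [kruskalOfSingular]
  have h₂ := sgn_mul_self δ
  generalize √(1 - y.2 ^ 2) = A at *
  generalize Real.exp ((y.2 ^ 2 + y.1 - 1) / 2) = B at *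
  generalize Real.exp ((y.2 ^ 2 - y.1 - 1) / 2) = C at *
  linear_combination (-(B * A * C * A)) * h₂ - B * C * h - (1 - y.2 ^ 2) * e

theorem kruskalOfU_mul (δ : ℤˣ) (x : ℝ × ℝ) :
    (kruskalOfU δ x).1 * (kruskalOfU δ x).2 = (1 / x.2 - 1) * Real.exp (1 / x.2 - 1) := by
  have e : Real.exp (x.1 / 2) * Real.exp (-x.1 / 2) = 1 := by rw [← Real.exp_add]; ring_nf; simp
  simp only [kruskalOfU]
  linear_combination ((1 / x.2 - 1) * Real.exp (1 / x.2 - 1)) * (sgn_mul_self δ) +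
    sgn δ * sgn δ * ((1 / x.2 - 1) * Real.exp (1 / x.2 - 1)) * e

theorem kruskalOfV_eq_swap (δ : ℤˣ) (x : ℝ × ℝ) : kruskalOfV δ x = (kruskalOfU δ x).swap := rfl

theorem kruskalOfV_mul (δ : ℤˣ) (x : ℝ × ℝ) :
    (kruskalOfV δ x).1 * (kruskalOfV δ x).2 = (1 / x.2 - 1) * Real.exp (1 / x.2 - 1) := by
  rw [mul_comm]; exact kruskalOfU_mul δ x

theorem kruskalOfString_mem {x : ℝ × ℝ} (hx : 1 < x.2) : kruskalOfString x ∈ kruskalDomain :=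
  mem_kruskalDomain_of_eq (by linarith) (kruskalOfString_mul hx)

theorem kruskalOfSingular_mem (δ : ℤˣ) {y : ℝ × ℝ} (hy : y ∈ singularDomain) (hy' : y.2 ≠ 0) :
    kruskalOfSingular δ y ∈ kruskalDomain :=
  mem_kruskalDomain_of_eq (by have : 0 < y.2 ^ 2 := by positivity
                              linarith) (kruskalOfSingular_mul δ hy)

theorem kruskalOfU_mem (δ : ℤˣ) {x : ℝ × ℝ} (hx : 0 < x.2) : kruskalOfU δ x ∈ kruskalDomain :=
  mem_kruskalDomain_of_eq (by have : 0 < 1 / x.2 := by positivity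
                              linarith) (kruskalOfU_mul δ x)

theorem kruskalOfV_mem (δ : ℤˣ) {x : ℝ × ℝ} (hx : 0 < x.2) : kruskalOfV δ x ∈ kruskalDomain :=
  mem_kruskalDomain_of_eq (by have : 0 < 1 / x.2 := by positivity
                              linarith) (kruskalOfV_mul δ x)

theorem lambertW_kruskalOfString {x : ℝ × ℝ} (hx : 1 < x.2) :
    lambertW ((kruskalOfString x).1 * (kruskalOfString x).2) = x.2 - 1 := by
  rw [kruskalOfString_mul hx, lambertW_mul_exp_self (by linarith)]

theorem lambertW_kruskalOfSingular (δ : ℤˣ) {y : ℝ × ℝ} (hy : y ∈ singularDomain) :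
    lambertW ((kruskalOfSingular δ y).1 * (kruskalOfSingular δ y).2) = y.2 ^ 2 - 1 := by
  rw [kruskalOfSingular_mul δ hy, lambertW_mul_exp_self (by linarith [sq_nonneg y.2])]

theorem lambertW_kruskalOfU (δ : ℤˣ) {x : ℝ × ℝ} (hx : 0 < x.2) :
    lambertW ((kruskalOfU δ x).1 * (kruskalOfU δ x).2) = 1 / x.2 - 1 := by
  rw [kruskalOfU_mul, lambertW_mul_exp_self]
  have : 0 < 1 / x.2 := by positivity
  linarith

theorem lambertW_kruskalOfV (δ : ℤˣ) {x : ℝ × ℝ} (hx : 0 < x.2) :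
    lambertW ((kruskalOfV δ x).1 * (kruskalOfV δ x).2) = 1 / x.2 - 1 := by
  rw [mul_comm]; exact lambertW_kruskalOfU δ hx

/-- The geodesic Hamiltonian as a function on the cotangent bundle of the plane. -/
abbrev metricHam (g : ℝ × ℝ → Matrix (Fin 2) (Fin 2) ℝ) (x ξ : ℝ × ℝ) : ℝ :=
  geodesicHamiltonian (g x) ξ

theorem hasFDerivAt_planeMap {T₁ T₂ : ℝ × ℝ → ℝ} {a b c d : ℝ} {x : ℝ × ℝ}
    (h₁ : HasFDerivAt T₁ (a • ContinuousLinearMap.fst ℝ ℝ ℝ + b • ContinuousLinearMap.snd ℝ ℝ ℝ) x)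
    (h₂ : HasFDerivAt T₂ (c • ContinuousLinearMap.fst ℝ ℝ ℝ + d • ContinuousLinearMap.snd ℝ ℝ ℝ) x) :
    HasFDerivAt (fun y => (T₁ y, T₂ y)) (planeMap a b c d) x :=
  h₁.prodMk h₂

theorem hasFDerivAt_fst_add_snd {A B : ℝ → ℝ} {a b : ℝ} {x : ℝ × ℝ} (hA : HasDerivAt A a x.1)
    (hB : HasDerivAt B b x.2) : HasFDerivAt (fun y : ℝ × ℝ => A y.1 + B y.2)
      (a • ContinuousLinearMap.fst ℝ ℝ ℝ + b • ContinuousLinearMap.snd ℝ ℝ ℝ) x :=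
  (hA.comp_hasFDerivAt x (f := Prod.fst) (hasFDerivAt_fst (𝕜 := ℝ) (p := x))).add
    (hB.comp_hasFDerivAt x (f := Prod.snd) (hasFDerivAt_snd (𝕜 := ℝ) (p := x)))

theorem hasFDerivAt_fst_mul_snd {A B : ℝ → ℝ} {a b : ℝ} {x : ℝ × ℝ} (hA : HasDerivAt A a x.1)
    (hB : HasDerivAt B b x.2) : HasFDerivAt (fun y : ℝ × ℝ => A y.1 * B y.2)
      ((a * B x.2) • ContinuousLinearMap.fst ℝ ℝ ℝ + (A x.1 * b) • ContinuousLinearMap.snd ℝ ℝ ℝ)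
      x := by
  convert! (hA.comp_hasFDerivAt x (f := Prod.fst) (hasFDerivAt_fst (𝕜 := ℝ) (p := x))).mul
    (hB.comp_hasFDerivAt x (f := Prod.snd) (hasFDerivAt_snd (𝕜 := ℝ) (p := x))) using 1
  ext <;> simp; ring

/-- The differential of a product `c exp(f) √g`, in terms of its value. -/
theorem hasFDerivAt_exp_mul_sqrt (c : ℝ) {f g : ℝ × ℝ → ℝ} {f' g' : (ℝ × ℝ) →L[ℝ] ℝ} {x : ℝ × ℝ}
    (hf : HasFDerivAt f f' x) (hg : HasFDerivAt g g' x) (h : 0 < g x) :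
    HasFDerivAt (fun y => c * (Real.exp (f y) * √(g y)))
      ((c * (Real.exp (f x) * √(g x))) • (f' + (1 / (2 * g x)) • g')) x := by
  convert! ((hf.exp.mul (hg.sqrt h.ne')).const_mul c) using 1
  have h₁ : √(g x) ≠ 0 := (Real.sqrt_pos.2 h).ne'
  have h₂ : g x = √(g x) ^ 2 := (Real.sq_sqrt h.le).symm
  ext <;>
  · simp only [ContinuousLinearMap.comp_apply, smul_apply, add_apply, smul_eq_mul]
    generalize √(g x) = A at *
    rw [h₂]
    field_simp
    ring

/-- The logarithmic differentials of `p` and `q` are `±dt/2 - x³ dx/(1 - x²)`. The Jacobian is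
therefore a nonzero multiple of `x³`: the relation is a change of coordinates exactly off `x = 0`.
-/
theorem intertwines_kruskalOfSingular (δ : ℤˣ) {y : ℝ × ℝ} (hy : y ∈ singularDomain)
    (hy' : y.2 ≠ 0) : ∃ T', Intertwines (kruskalOfSingular δ) y singularHamiltonian (fun _ ξ => ξ.1)
      (metricHam kruskalMetric) kruskalEnergy T' := by
  have hpos : 0 < 1 - y.2 ^ 2 := by nlinarith [hy.1, hy.2]
  have hpq := kruskalOfSingular_mul δ hy
  have hW := lambertW_kruskalOfSingular δ hy
  have hsq : HasDerivAt (fun x : ℝ => x ^ 2) (2 * y.2) y.2 := by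
    simpa using hasDerivAt_pow 2 y.2
  have hg : HasFDerivAt (fun y : ℝ × ℝ => 1 - y.2 ^ 2)
      ((0 : ℝ) • ContinuousLinearMap.fst ℝ ℝ ℝ + (-(2 * y.2)) • ContinuousLinearMap.snd ℝ ℝ ℝ) y :=
    hasFDerivAt_fst_add_snd (A := fun _ => 1) (B := fun x => -x ^ 2) (hasDerivAt_const _ _) hsq.neg
  have hf₁ : HasFDerivAt (fun y : ℝ × ℝ => (y.2 ^ 2 + y.1 - 1) / 2)
      ((1 / 2 : ℝ) • ContinuousLinearMap.fst ℝ ℝ ℝ + (2 * y.2 / 2) • ContinuousLinearMap.snd ℝ ℝ ℝ)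
      y := by
    convert! hasFDerivAt_fst_add_snd ((hasDerivAt_id y.1).div_const 2)
      ((hsq.sub_const 1).div_const 2) using 2
    simp only [id]; ring
  have hf₂ : HasFDerivAt (fun y : ℝ × ℝ => (y.2 ^ 2 - y.1 - 1) / 2)
      ((-1 / 2 : ℝ) • ContinuousLinearMap.fst ℝ ℝ ℝ + (2 * y.2 / 2) • ContinuousLinearMap.snd ℝ ℝ ℝ)
      y := by
    convert! hasFDerivAt_fst_add_snd ((hasDerivAt_id y.1).neg.div_const 2)
      ((hsq.sub_const 1).div_const 2) using 2
    simp only [Pi.neg_apply, id]; ring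
  have h₁ := hasFDerivAt_exp_mul_sqrt (sgn δ) hf₁ hg hpos
  have h₂ := hasFDerivAt_exp_mul_sqrt (-sgn δ) hf₂ hg hpos
  set P := (kruskalOfSingular δ y).1 with hP
  set Q := (kruskalOfSingular δ y).2 with hQ
  have hd : HasFDerivAt (kruskalOfSingular δ) (planeMap (P / 2) (P * (-y.2 ^ 3 / (1 - y.2 ^ 2)))
      (-Q / 2) (Q * (-y.2 ^ 3 / (1 - y.2 ^ 2)))) y := by
    refine hasFDerivAt_planeMap ?_ ?_
    · convert! h₁ using 1
      change _ = P • _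
      ext <;> simp <;> field_simp; ring
    · convert! h₂ using 1
      change _ = Q • _
      ext <;> simp <;> field_simp; ring
  have hne : P * Q ≠ 0 := by
    rw [hpq]
    have : y.2 ^ 2 - 1 ≠ 0 := by linarith
    positivity
  obtain ⟨L, hL⟩ := exists_planeMap_equiv (a := P / 2) (b := P * (-y.2 ^ 3 / (1 - y.2 ^ 2)))
    (c := -Q / 2) (d := Q * (-y.2 ^ 3 / (1 - y.2 ^ 2))) (by
      have e : P / 2 * (Q * (-y.2 ^ 3 / (1 - y.2 ^ 2))) -
        P * (-y.2 ^ 3 / (1 - y.2 ^ 2)) * (-Q / 2) = P * Q * (-y.2 ^ 3 / (1 - y.2 ^ 2)) := by ring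
      rw [e]
      exact mul_ne_zero hne (div_ne_zero (neg_ne_zero.2 (pow_ne_zero _ hy')) hpos.ne'))
  refine ⟨L, ?_, hL ▸ hd, fun η => ?_, fun η => ?_⟩
  · unfold kruskalOfSingular
    have hs : ContDiffAt ℝ ω (fun y : ℝ × ℝ => √(1 - y.2 ^ 2)) y :=
      ContDiffAt.sqrt (by fun_prop) hpos.ne'
    fun_prop
  · rw [hL, pullback_planeMap, metricHam,
      geodesicHamiltonian_kruskalMetric (kruskalOfSingular_mem δ hy hy'), hW, singularHamiltonian]
    have h₃ : y.2 ^ 2 - 1 ≠ 0 := by linarith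
    have h₄ : 1 - y.2 ^ 2 ≠ 0 := hpos.ne'
    have h₅ : (1 - y.2 ^ 2) = -(y.2 ^ 2 - 1) := by ring
    rw [h₅]
    -- Eliminating the exponential turns the identity of Hamiltonians into a rational one.
    have h₆ : Real.exp (y.2 ^ 2 - 1) = P * Q / (y.2 ^ 2 - 1) := by rw [hpq]; field_simp
    rw [h₆]
    field_simp
    ring
  · rw [hL, pullback_planeMap, kruskalEnergy, ← hP, ← hQ]
    ring

theorem intertwines_kruskalOfString {x : ℝ × ℝ} (hx : 1 < x.2) :
    ∃ T', Intertwines kruskalOfString x (metricHam stringMetric) (fun _ ξ => ξ.1)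
      (metricHam kruskalMetric) kruskalEnergy T' := by
  have hpos : 0 < x.2 - 1 := by linarith
  have hpq := kruskalOfString_mul hx
  have hW := lambertW_kruskalOfString hx
  have hid := hasDerivAt_id x.2
  have hg : HasFDerivAt (fun y : ℝ × ℝ => y.2 - 1)
      ((0 : ℝ) • ContinuousLinearMap.fst ℝ ℝ ℝ + (1 : ℝ) • ContinuousLinearMap.snd ℝ ℝ ℝ) x := by
    convert! hasFDerivAt_fst_add_snd (hasDerivAt_const _ (0 : ℝ)) (hid.sub_const 1) using 2
    simp only [id]; ring
  have hf₁ : HasFDerivAt (fun y : ℝ × ℝ => (y.2 + y.1 - 1) / 2)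
      ((1 / 2 : ℝ) • ContinuousLinearMap.fst ℝ ℝ ℝ + (1 / 2 : ℝ) • ContinuousLinearMap.snd ℝ ℝ ℝ)
      x := by
    convert! hasFDerivAt_fst_add_snd ((hasDerivAt_id x.1).div_const 2)
      ((hid.sub_const 1).div_const 2) using 2
    simp only [id]; ring
  have hf₂ : HasFDerivAt (fun y : ℝ × ℝ => (y.2 - y.1 - 1) / 2)
      ((-1 / 2 : ℝ) • ContinuousLinearMap.fst ℝ ℝ ℝ + (1 / 2 : ℝ) • ContinuousLinearMap.snd ℝ ℝ ℝ)
      x := by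
    convert! hasFDerivAt_fst_add_snd ((hasDerivAt_id x.1).neg.div_const 2)
      ((hid.sub_const 1).div_const 2) using 2
    simp only [Pi.neg_apply, id]; ring
  have h₁ := hasFDerivAt_exp_mul_sqrt 1 hf₁ hg hpos
  have h₂ := hasFDerivAt_exp_mul_sqrt 1 hf₂ hg hpos
  simp only [one_mul] at h₁ h₂
  set P := (kruskalOfString x).1 with hP
  set Q := (kruskalOfString x).2 with hQ
  have hd : HasFDerivAt kruskalOfString (planeMap (P / 2) (P * (x.2 / (2 * (x.2 - 1))))
      (-Q / 2) (Q * (x.2 / (2 * (x.2 - 1))))) x := by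
    refine hasFDerivAt_planeMap ?_ ?_
    · convert! h₁ using 1
      change _ = P • _
      ext <;> simp <;> field_simp; ring
    · convert! h₂ using 1
      change _ = Q • _
      ext <;> simp <;> field_simp; ring
  have hne : P * Q ≠ 0 := by rw [hpq]; positivity
  obtain ⟨L, hL⟩ := exists_planeMap_equiv (a := P / 2) (b := P * (x.2 / (2 * (x.2 - 1))))
    (c := -Q / 2) (d := Q * (x.2 / (2 * (x.2 - 1)))) (by
      have e : P / 2 * (Q * (x.2 / (2 * (x.2 - 1)))) - P * (x.2 / (2 * (x.2 - 1))) * (-Q / 2) =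
        P * Q * (x.2 / (2 * (x.2 - 1))) := by ring
      rw [e]
      exact mul_ne_zero hne (div_ne_zero (by linarith) (by linarith)))
  refine ⟨L, ?_, hL ▸ hd, fun η => ?_, fun η => ?_⟩
  · unfold kruskalOfString
    have hs : ContDiffAt ℝ ω (fun y : ℝ × ℝ => √(y.2 - 1)) x :=
      ContDiffAt.sqrt (by fun_prop) hpos.ne'
    fun_prop
  · rw [hL, pullback_planeMap, metricHam, metricHam, geodesicHamiltonian_stringMetric hx,
      geodesicHamiltonian_kruskalMetric (kruskalOfString_mem hx), hW]
    have h₆ : Real.exp (x.2 - 1) = P * Q / (x.2 - 1) := by rw [hpq]; field_simp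
    rw [h₆]
    field_simp
    ring
  · rw [hL, pullback_planeMap, kruskalEnergy, ← hP, ← hQ]
    ring

theorem hasDerivAt_exp_half (a c u : ℝ) :
    HasDerivAt (fun u : ℝ => a * Real.exp (c * u / 2)) (c / 2 * (a * Real.exp (c * u / 2))) u := by
  have h : HasDerivAt (fun u : ℝ => c * u / 2) (c / 2) u := by
    convert! ((hasDerivAt_id u).const_mul c).div_const 2 using 1
    simp
  convert! h.exp.const_mul a using 1
  ring

theorem hasDerivAt_inv_sub_one {s : ℝ} (hs : s ≠ 0) :
    HasDerivAt (fun s : ℝ => 1 / s - 1) (-1 / s ^ 2) s := by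
  convert! (hasDerivAt_inv hs).sub_const 1 using 1
  · ext; simp
  · ring

theorem hasDerivAt_kruskal_product {s : ℝ} (hs : s ≠ 0) :
    HasDerivAt (fun s : ℝ => (1 / s - 1) * Real.exp (1 / s - 1))
      (-Real.exp (1 / s - 1) / s ^ 3) s := by
  convert! (hasDerivAt_mul_exp (1 / s - 1)).comp s (hasDerivAt_inv_sub_one hs) using 1
  field_simp
  ring

/-- The Jacobian determinant is `-e^{r-1}/(2s³)`, which is nonzero also at `s = 1`; so the `(u, s)`
coordinates are regular across the horizon `q = 0`. -/
theorem intertwines_kruskalOfU (δ : ℤˣ) {x : ℝ × ℝ} (hx : 0 < x.2) :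
    ∃ T', Intertwines (kruskalOfU δ) x (metricHam eddingtonMetric) (fun _ ξ => ξ.1)
      (metricHam kruskalMetric) kruskalEnergy T' := by
  have hW := lambertW_kruskalOfU δ hx
  have h₁ : HasFDerivAt (fun y : ℝ × ℝ => sgn δ * Real.exp (y.1 / 2))
      ((1 / 2 * (sgn δ * Real.exp (1 * x.1 / 2))) • ContinuousLinearMap.fst ℝ ℝ ℝ +
        (0 : ℝ) • ContinuousLinearMap.snd ℝ ℝ ℝ) x := by
    convert! hasFDerivAt_fst_add_snd (hasDerivAt_exp_half (sgn δ) 1 x.1)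
      (hasDerivAt_const x.2 0) using 2
    simp
  have h₂ : HasFDerivAt (fun y : ℝ × ℝ => sgn δ * Real.exp (-y.1 / 2) *
      ((1 / y.2 - 1) * Real.exp (1 / y.2 - 1)))
      ((-1 / 2 * (sgn δ * Real.exp (-1 * x.1 / 2)) * ((1 / x.2 - 1) * Real.exp (1 / x.2 - 1))) •
        ContinuousLinearMap.fst ℝ ℝ ℝ + (sgn δ * Real.exp (-1 * x.1 / 2) *
          (-Real.exp (1 / x.2 - 1) / x.2 ^ 3)) • ContinuousLinearMap.snd ℝ ℝ ℝ) x := by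
    convert! hasFDerivAt_fst_mul_snd (hasDerivAt_exp_half (sgn δ) (-1) x.1)
      (hasDerivAt_kruskal_product hx.ne') using 2
    simp
  have hd := hasFDerivAt_planeMap h₁ h₂
  have hE : Real.exp (1 * x.1 / 2) * Real.exp (-1 * x.1 / 2) = 1 := by
    rw [← Real.exp_add]; ring_nf; simp
  have hσ := sgn_mul_self δ
  obtain ⟨L, hL⟩ := exists_planeMap_equiv (a := 1 / 2 * (sgn δ * Real.exp (1 * x.1 / 2))) (b := 0)
    (c := -1 / 2 * (sgn δ * Real.exp (-1 * x.1 / 2)) * ((1 / x.2 - 1) * Real.exp (1 / x.2 - 1)))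
    (d := sgn δ * Real.exp (-1 * x.1 / 2) * (-Real.exp (1 / x.2 - 1) / x.2 ^ 3)) (by
      have := sgn_ne_zero δ
      simp only [zero_mul, sub_zero]
      exact mul_ne_zero (by positivity) (mul_ne_zero (by positivity)
        (div_ne_zero (neg_ne_zero.2 (Real.exp_ne_zero _)) (by positivity))))
  refine ⟨L, ?_, hL ▸ hd, fun η => ?_, fun η => ?_⟩
  · unfold kruskalOfU
    have hs : ContDiffAt ℝ ω (fun y : ℝ × ℝ => 1 / y.2 - 1) x :=
      (contDiffAt_const.div contDiffAt_snd hx.ne').sub contDiffAt_const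
    fun_prop
  · rw [hL, pullback_planeMap, metricHam, metricHam, geodesicHamiltonian_eddingtonMetric,
      geodesicHamiltonian_kruskalMetric (kruskalOfU_mem δ hx), hW]
    generalize Real.exp (1 * x.1 / 2) = A at *
    generalize Real.exp (-1 * x.1 / 2) = B at *
    generalize Real.exp (1 / x.2 - 1) = C at *
    generalize sgn δ = σ at *
    have hx' := hx.ne'
    field_simp
    linear_combination (-(η.1 * η.2 * x.2 * C) * (A * B)) * hσ - η.1 * η.2 * x.2 * C * hE
  · rw [hL, pullback_planeMap, kruskalEnergy, kruskalOfU]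
    simp only [one_mul, neg_one_mul]
    ring

/-- Exchanging `p` and `q` preserves the Kruskal–Szekeres Hamiltonian and reverses the energy; with
this lemma the `(v, s)` relations follow from the `(u, s)` relations. -/
theorem intertwines_swap {T : ℝ × ℝ → ℝ × ℝ} {x : ℝ × ℝ} {h e h' e' h₁ e₁ : ℝ × ℝ → ℝ × ℝ → ℝ}
    {T' : (ℝ × ℝ) ≃L[ℝ] (ℝ × ℝ)} (hT : Intertwines T x h e h' e' T')
    (hh : ∀ η, h₁ (T x).swap η.swap = h' (T x) η) (he : ∀ η, e₁ (T x).swap η.swap = e' (T x) η) :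
    ∃ T', Intertwines (fun x => (T x).swap) x h e h₁ e₁ T' := by
  refine ⟨T'.trans (ContinuousLinearEquiv.prodComm ℝ ℝ ℝ), ?_, ?_, fun η => ?_, fun η => ?_⟩
  · exact (contDiff_snd.prodMk contDiff_fst).contDiffAt.comp x hT.contDiffAt
  · exact (ContinuousLinearEquiv.prodComm ℝ ℝ ℝ).hasFDerivAt.comp x hT.hasFDerivAt
  all_goals
    have e : pullback ((T'.trans (ContinuousLinearEquiv.prodComm ℝ ℝ ℝ) :
        (ℝ × ℝ) ≃L[ℝ] (ℝ × ℝ)) : (ℝ × ℝ) →L[ℝ] (ℝ × ℝ)) η = pullback T' η.swap := by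
      simp [pullback_apply, add_comm]
    rw [e]
  · rw [hT.hamiltonian, ← hh, Prod.swap_swap]
  · rw [hT.energy, ← he, Prod.swap_swap]

theorem intertwines_kruskalOfV (δ : ℤˣ) {x : ℝ × ℝ} (hx : 0 < x.2) :
    ∃ T', Intertwines (kruskalOfV δ) x (metricHam eddingtonMetric) (fun _ ξ => -ξ.1)
      (metricHam kruskalMetric) kruskalEnergy T' := by
  obtain ⟨T', hT⟩ := intertwines_kruskalOfU δ hx
  have hT' : Intertwines (kruskalOfU δ) x (metricHam eddingtonMetric) (fun _ ξ => -ξ.1)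
      (metricHam kruskalMetric) (fun x ξ => -kruskalEnergy x ξ) T' :=
    ⟨hT.contDiffAt, hT.hasFDerivAt, hT.hamiltonian, fun η => congrArg Neg.neg (hT.energy η)⟩
  refine intertwines_swap hT' (fun η => ?_) fun η => ?_
  · have hm : (kruskalOfU δ x).swap ∈ kruskalDomain := kruskalOfV_mem δ hx
    rw [metricHam, geodesicHamiltonian_kruskalMetric hm, metricHam,
      geodesicHamiltonian_kruskalMetric (kruskalOfU_mem δ hx)]
    simp only [Prod.fst_swap, Prod.snd_swap, mul_comm]
  · simp only [kruskalEnergy, Prod.fst_swap, Prod.snd_swap]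
    ring

/-- The Killing field is `∂_u` in `(u, s)` and `-∂_v` in `(v, s)`, whence the opposite signs of the
energies. The pullback is made explicit because the completeness proofs choose between the two
patches by the signs of momenta. -/
theorem intertwines_vOfU {x : ℝ × ℝ} (h₀ : x.2 ≠ 0) (h₁ : x.2 ≠ 1) :
    ∃ T', Intertwines vOfU x (metricHam eddingtonMetric) (fun _ ξ => -ξ.1)
      (metricHam eddingtonMetric) (fun _ ξ => ξ.1) T' ∧
      ∀ η, pullback T' η = (-η.1, η.2 - 2 / (x.2 ^ 2 * (1 - x.2)) * η.1) := by
  have h₁' : 1 - x.2 ≠ 0 := sub_ne_zero.2 h₁.symm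
  have hr : 1 / x.2 - 1 ≠ 0 := by
    intro h
    have h := sub_eq_zero.1 h
    field_simp at h
    exact h₁ h.symm
  have hg : HasDerivAt (fun s : ℝ => 2 * (1 / s - 1) + Real.log ((1 / s - 1) ^ 2))
      (-2 / (x.2 ^ 2 * (1 - x.2))) x.2 := by
    have h := hasDerivAt_inv_sub_one h₀
    convert! (h.const_mul 2).add ((h.fun_pow 2).log (pow_ne_zero 2 hr)) using 1
    have h₂ : 1 / x.2 - 1 = (1 - x.2) / x.2 := by field_simp
    rw [h₂]
    simp only [Nat.cast_ofNat, Nat.add_one_sub_one, pow_one]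
    field_simp
    ring
  have hd₁ : HasFDerivAt (fun y : ℝ × ℝ => -y.1 + 2 * (1 / y.2 - 1) +
      Real.log ((1 / y.2 - 1) ^ 2)) ((-1 : ℝ) • ContinuousLinearMap.fst ℝ ℝ ℝ +
        (-2 / (x.2 ^ 2 * (1 - x.2))) • ContinuousLinearMap.snd ℝ ℝ ℝ) x := by
    convert! hasFDerivAt_fst_add_snd (hasDerivAt_id x.1).neg hg using 2
    simp [add_assoc]
  have hd₂ : HasFDerivAt (fun y : ℝ × ℝ => y.2) ((0 : ℝ) • ContinuousLinearMap.fst ℝ ℝ ℝ +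
      (1 : ℝ) • ContinuousLinearMap.snd ℝ ℝ ℝ) x := by
    convert! hasFDerivAt_snd using 1
    simp
  have hd := hasFDerivAt_planeMap hd₁ hd₂
  obtain ⟨L, hL⟩ := exists_planeMap_equiv (a := -1) (b := -2 / (x.2 ^ 2 * (1 - x.2))) (c := 0)
    (d := 1) (by norm_num)
  have hpull (η : ℝ × ℝ) :
      pullback L η = (-η.1, η.2 - 2 / (x.2 ^ 2 * (1 - x.2)) * η.1) := by
    rw [hL, pullback_planeMap]
    ext
    · simp
    · simp only
      ring
  refine ⟨L, ⟨?_, hL ▸ hd, fun η => ?_, fun η => ?_⟩, hpull⟩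
  · unfold vOfU
    have hs : ContDiffAt ℝ ω (fun y : ℝ × ℝ => 1 / y.2 - 1) x :=
      (contDiffAt_const.div contDiffAt_snd h₀).sub contDiffAt_const
    have hl : ContDiffAt ℝ ω (fun y : ℝ × ℝ => Real.log ((1 / y.2 - 1) ^ 2)) x :=
      (hs.pow 2).log (pow_ne_zero 2 hr)
    have h₂ : ContDiffAt ℝ ω (fun y : ℝ × ℝ => -y.1 + 2 * (1 / y.2 - 1)) x :=
      contDiffAt_fst.neg.add (contDiffAt_const.mul hs)
    exact (h₂.add hl).prodMk contDiffAt_snd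
  · rw [hL, pullback_planeMap, metricHam, metricHam, geodesicHamiltonian_eddingtonMetric,
      geodesicHamiltonian_eddingtonMetric]
    simp only [vOfU]
    field_simp
    ring
  · rw [hL, pullback_planeMap]
    simp

/-! ### The glued surface -/

/-- The names of the patches. -/
inductive Patch
  | string
  | kruskal (ε : ℤˣ)
  | singular (δ : ℤˣ)
  | scriU (i : ℤˣ × ℤˣ)
  | scriV (i : ℤˣ × ℤˣ)

/-- The points of the extended string surface: those of the Kruskal–Szekeres patches, of the
singularities, of the scris, and of the regions beyond scri. -/
inductive SurfacePoint
  | kruskal (ε : ℤˣ) (x : kruskalDomain)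
  | singular (δ : ℤˣ) (t : ℝ)
  | scriU (i : ℤˣ × ℤˣ) (u : ℝ)
  | scriV (i : ℤˣ × ℤˣ) (v : ℝ)
  | beyond (i : ℤˣ × ℤˣ) (x : {x : ℝ × ℝ // x.2 < 0})

open Classical in
/-- The point of the surface with given Kruskal–Szekeres coordinates. -/
def kruskalPoint (ε : ℤˣ) (x : ℝ × ℝ) : SurfacePoint :=
  -- The value off the domain is arbitrary: parametrizations are only used on the domains of their
  -- patches.
  if h : x ∈ kruskalDomain then .kruskal ε ⟨x, h⟩ else .singular 1 0

/-- The point beyond scri with given coordinates `(u, s)`. -/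
def beyondPoint (i : ℤˣ × ℤˣ) (x : ℝ × ℝ) : SurfacePoint :=
  if h : x.2 < 0 then .beyond i ⟨x, h⟩ else .singular 1 0

theorem kruskalPoint_of_mem (ε : ℤˣ) {x : ℝ × ℝ} (hx : x ∈ kruskalDomain) :
    kruskalPoint ε x = .kruskal ε ⟨x, hx⟩ := dif_pos hx

theorem beyondPoint_of_neg (i : ℤˣ × ℤˣ) {x : ℝ × ℝ} (hx : x.2 < 0) :
    beyondPoint i x = .beyond i ⟨x, hx⟩ := dif_pos hx

theorem kruskalPoint_inj {ε ε' : ℤˣ} {x x' : ℝ × ℝ} (hx : x ∈ kruskalDomain)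
    (hx' : x' ∈ kruskalDomain) : kruskalPoint ε x = kruskalPoint ε' x' ↔ ε = ε' ∧ x = x' := by
  rw [kruskalPoint_of_mem ε hx, kruskalPoint_of_mem ε' hx']
  simp

theorem beyondPoint_inj {i i' : ℤˣ × ℤˣ} {x x' : ℝ × ℝ} (hx : x.2 < 0) (hx' : x'.2 < 0) :
    beyondPoint i x = beyondPoint i' x' ↔ i = i' ∧ x = x' := by
  rw [beyondPoint_of_neg i hx, beyondPoint_of_neg i' hx']
  simp

namespace Patch

/-- The range of the coordinates of a patch. -/
def dom : Patch → Set (ℝ × ℝ)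
  | string => stringSpace
  | kruskal _ => kruskalDomain
  | singular _ => singularDomain
  | scriU _ => Set.univ
  | scriV _ => Set.univ

/-- The point with given coordinates. -/
def param : Patch → ℝ × ℝ → SurfacePoint
  | string, x => kruskalPoint 1 (kruskalOfString x)
  | kruskal ε, x => kruskalPoint ε x
  | singular δ, y =>
    if 0 < y.2 then kruskalPoint 1 (kruskalOfSingular δ y)
    else if y.2 < 0 then kruskalPoint (-1) (kruskalOfSingular δ y) else .singular δ y.1
  | scriU i, x =>
    if 0 < x.2 then kruskalPoint i.1 (kruskalOfU i.2 x)
    else if x.2 < 0 then beyondPoint i x else .scriU i x.1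
  | scriV i, x =>
    if 0 < x.2 then kruskalPoint i.1 (kruskalOfV i.2 x)
    else if x.2 < 0 then beyondPoint i (vOfU x) else .scriV i x.1

/-- The Hamiltonian in the canonical coordinates of a patch. -/
def ham : Patch → ℝ × ℝ → ℝ × ℝ → ℝ
  | string => metricHam stringMetric
  | kruskal _ => metricHam kruskalMetric
  | singular _ => singularHamiltonian
  | scriU _ => metricHam eddingtonMetric
  | scriV _ => metricHam eddingtonMetric

/-- The energy in the canonical coordinates of a patch. -/
def energy : Patch → ℝ × ℝ → ℝ × ℝ → ℝ
  | string => fun _ ξ => ξ.1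
  | kruskal _ => kruskalEnergy
  | singular _ => fun _ ξ => ξ.1
  | scriU _ => fun _ ξ => ξ.1
  | scriV _ => fun _ ξ => -ξ.1

theorem param_scriU_of_pos {i : ℤˣ × ℤˣ} {x : ℝ × ℝ} (hx : 0 < x.2) :
    param (scriU i) x = kruskalPoint i.1 (kruskalOfU i.2 x) := if_pos hx

theorem param_scriU_of_neg {i : ℤˣ × ℤˣ} {x : ℝ × ℝ} (hx : x.2 < 0) :
    param (scriU i) x = beyondPoint i x := by simp [param, hx, hx.not_gt]

theorem param_scriU_of_eq {i : ℤˣ × ℤˣ} {x : ℝ × ℝ} (hx : x.2 = 0) :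
    param (scriU i) x = .scriU i x.1 := by simp [param, hx]

theorem param_scriV_of_pos {i : ℤˣ × ℤˣ} {x : ℝ × ℝ} (hx : 0 < x.2) :
    param (scriV i) x = kruskalPoint i.1 (kruskalOfV i.2 x) := if_pos hx

theorem param_scriV_of_neg {i : ℤˣ × ℤˣ} {x : ℝ × ℝ} (hx : x.2 < 0) :
    param (scriV i) x = beyondPoint i (vOfU x) := by simp [param, hx, hx.not_gt]

theorem param_scriV_of_eq {i : ℤˣ × ℤˣ} {x : ℝ × ℝ} (hx : x.2 = 0) :
    param (scriV i) x = .scriV i x.1 := by simp [param, hx]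

theorem param_singular_of_pos {δ : ℤˣ} {y : ℝ × ℝ} (hy : 0 < y.2) :
    param (singular δ) y = kruskalPoint 1 (kruskalOfSingular δ y) := if_pos hy

theorem param_singular_of_neg {δ : ℤˣ} {y : ℝ × ℝ} (hy : y.2 < 0) :
    param (singular δ) y = kruskalPoint (-1) (kruskalOfSingular δ y) := by
  simp [param, hy, hy.not_gt]

theorem param_singular_of_eq {δ : ℤˣ} {y : ℝ × ℝ} (hy : y.2 = 0) :
    param (singular δ) y = .singular δ y.1 := by simp [param, hy]

end Patch

/-! ### Injectivity of the coordinate relations -/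

theorem vOfU_snd (x : ℝ × ℝ) : (vOfU x).2 = x.2 := rfl

theorem vOfU_vOfU (x : ℝ × ℝ) : vOfU (vOfU x) = x := by
  ext <;> simp [vOfU]; ring

theorem kruskalOfString_injOn : Set.InjOn kruskalOfString stringSpace := by
  intro x (hx : 1 < x.2) y (hy : 1 < y.2) h
  have h₂ : x.2 = y.2 := by
    have := lambertW_kruskalOfString hx
    rw [h, lambertW_kruskalOfString hy] at this
    linarith
  have h₁ := congrArg Prod.fst h
  simp only [kruskalOfString, h₂] at h₁
  have h₃ := Real.exp_injective (mul_right_cancel₀ (Real.sqrt_pos.2 (by linarith)).ne' h₁)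
  exact Prod.ext (by linarith) h₂

theorem kruskalOfU_inj {δ : ℤˣ} {x y : ℝ × ℝ} (hx : 0 < x.2) (hy : 0 < y.2)
    (h : kruskalOfU δ x = kruskalOfU δ y) : x = y := by
  have h₂ : x.2 = y.2 := by
    have := lambertW_kruskalOfU δ hx
    rw [h, lambertW_kruskalOfU δ hy] at this
    field_simp at this
    linarith
  have h₁ := congrArg Prod.fst h
  simp only [kruskalOfU] at h₁
  have h₃ := Real.exp_injective (mul_left_cancel₀ (sgn_ne_zero δ) h₁)
  exact Prod.ext (by linarith) h₂

theorem kruskalOfV_inj {δ : ℤˣ} {x y : ℝ × ℝ} (hx : 0 < x.2) (hy : 0 < y.2)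
    (h : kruskalOfV δ x = kruskalOfV δ y) : x = y :=
  kruskalOfU_inj hx hy (Prod.swap_injective h)

/-- The product `pq` determines only `x²`; that both points lie on the same side of the singularity
determines `x`. -/
theorem kruskalOfSingular_inj {δ : ℤˣ} {x y : ℝ × ℝ} (hx : x ∈ singularDomain)
    (hy : y ∈ singularDomain) (hxy : 0 < x.2 * y.2)
    (h : kruskalOfSingular δ x = kruskalOfSingular δ y) : x = y := by
  have h₂ : x.2 = y.2 := by
    have := lambertW_kruskalOfSingular δ hx
    rw [h, lambertW_kruskalOfSingular δ hy] at this
    have h₃ : (x.2 - y.2) * (x.2 + y.2) = 0 := by linarith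
    rcases mul_eq_zero.1 h₃ with h₄ | h₄
    · linarith
    · nlinarith [sq_nonneg x.2]
  have h₁ := congrArg Prod.fst h
  simp only [kruskalOfSingular, h₂] at h₁
  have hpos : 0 < 1 - y.2 ^ 2 := by nlinarith [hy.1, hy.2]
  have h₃ := Real.exp_injective (mul_right_cancel₀ (Real.sqrt_pos.2 hpos).ne'
    (mul_left_cancel₀ (sgn_ne_zero δ) h₁))
  exact Prod.ext (by linarith) h₂

/-- Different strata of a patch go to different constructors of `SurfacePoint`, and on each stratum
the coordinate relation is injective. The two sides of a singularity do not collide because they lie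
in different Kruskal–Szekeres patches. -/
theorem Patch.injOn_param (i : Patch) : Set.InjOn i.param i.dom := by
  have hk {ε : ℤˣ} {x : ℝ × ℝ} (hx : x ∈ kruskalDomain) := kruskalPoint_of_mem ε hx
  intro x hx y hy h
  cases i with
  | string =>
    exact kruskalOfString_injOn hx hy
      ((kruskalPoint_inj (kruskalOfString_mem hx) (kruskalOfString_mem hy)).1 h).2
  | kruskal ε => exact ((kruskalPoint_inj hx hy).1 h).2
  | singular δ =>
    have hm {z : ℝ × ℝ} (hz : z ∈ singularDomain) (hz' : z.2 ≠ 0) :=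
      kruskalOfSingular_mem δ hz hz'
    rcases lt_trichotomy x.2 0 with h₁ | h₁ | h₁ <;> rcases lt_trichotomy y.2 0 with h₂ | h₂ | h₂
    · rw [param_singular_of_neg h₁, param_singular_of_neg h₂,
        kruskalPoint_inj (hm hx h₁.ne) (hm hy h₂.ne)] at h
      exact kruskalOfSingular_inj hx hy (mul_pos_of_neg_of_neg h₁ h₂) h.2
    · rw [param_singular_of_neg h₁, param_singular_of_eq h₂, hk (hm hx h₁.ne)] at h
      cases h
    · rw [param_singular_of_neg h₁, param_singular_of_pos h₂,
        kruskalPoint_inj (hm hx h₁.ne) (hm hy h₂.ne')] at h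
      exact absurd h.1 (by decide)
    · rw [param_singular_of_eq h₁, param_singular_of_neg h₂, hk (hm hy h₂.ne)] at h
      cases h
    · rw [param_singular_of_eq h₁, param_singular_of_eq h₂] at h
      exact Prod.ext (SurfacePoint.singular.inj h).2 (h₁.trans h₂.symm)
    · rw [param_singular_of_eq h₁, param_singular_of_pos h₂, hk (hm hy h₂.ne')] at h
      cases h
    · rw [param_singular_of_pos h₁, param_singular_of_neg h₂,
        kruskalPoint_inj (hm hx h₁.ne') (hm hy h₂.ne)] at h
      exact absurd h.1 (by decide)
    · rw [param_singular_of_pos h₁, param_singular_of_eq h₂, hk (hm hx h₁.ne')] at h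
      cases h
    · rw [param_singular_of_pos h₁, param_singular_of_pos h₂,
        kruskalPoint_inj (hm hx h₁.ne') (hm hy h₂.ne')] at h
      exact kruskalOfSingular_inj hx hy (mul_pos h₁ h₂) h.2
  | scriU i =>
    rcases lt_trichotomy x.2 0 with h₁ | h₁ | h₁ <;> rcases lt_trichotomy y.2 0 with h₂ | h₂ | h₂
    · rw [param_scriU_of_neg h₁, param_scriU_of_neg h₂, beyondPoint_inj h₁ h₂] at h
      exact h.2
    · rw [param_scriU_of_neg h₁, param_scriU_of_eq h₂, beyondPoint_of_neg _ h₁] at h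
      cases h
    · rw [param_scriU_of_neg h₁, param_scriU_of_pos h₂, beyondPoint_of_neg _ h₁,
        hk (kruskalOfU_mem _ h₂)] at h
      cases h
    · rw [param_scriU_of_eq h₁, param_scriU_of_neg h₂, beyondPoint_of_neg _ h₂] at h
      cases h
    · rw [param_scriU_of_eq h₁, param_scriU_of_eq h₂] at h
      exact Prod.ext (SurfacePoint.scriU.inj h).2 (h₁.trans h₂.symm)
    · rw [param_scriU_of_eq h₁, param_scriU_of_pos h₂, hk (kruskalOfU_mem _ h₂)] at h
      cases h
    · rw [param_scriU_of_pos h₁, param_scriU_of_neg h₂, beyondPoint_of_neg _ h₂,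
        hk (kruskalOfU_mem _ h₁)] at h
      cases h
    · rw [param_scriU_of_pos h₁, param_scriU_of_eq h₂, hk (kruskalOfU_mem _ h₁)] at h
      cases h
    · rw [param_scriU_of_pos h₁, param_scriU_of_pos h₂,
        kruskalPoint_inj (kruskalOfU_mem _ h₁) (kruskalOfU_mem _ h₂)] at h
      exact kruskalOfU_inj h₁ h₂ h.2
  | scriV i =>
    have hv {z : ℝ × ℝ} (hz : z.2 < 0) : (vOfU z).2 < 0 := hz
    rcases lt_trichotomy x.2 0 with h₁ | h₁ | h₁ <;> rcases lt_trichotomy y.2 0 with h₂ | h₂ | h₂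
    · rw [param_scriV_of_neg h₁, param_scriV_of_neg h₂, beyondPoint_inj (hv h₁) (hv h₂)] at h
      rw [← vOfU_vOfU x, h.2, vOfU_vOfU]
    · rw [param_scriV_of_neg h₁, param_scriV_of_eq h₂, beyondPoint_of_neg _ (hv h₁)] at h
      cases h
    · rw [param_scriV_of_neg h₁, param_scriV_of_pos h₂, beyondPoint_of_neg _ (hv h₁),
        hk (kruskalOfV_mem _ h₂)] at h
      cases h
    · rw [param_scriV_of_eq h₁, param_scriV_of_neg h₂, beyondPoint_of_neg _ (hv h₂)] at h
      cases h
    · rw [param_scriV_of_eq h₁, param_scriV_of_eq h₂] at h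
      exact Prod.ext (SurfacePoint.scriV.inj h).2 (h₁.trans h₂.symm)
    · rw [param_scriV_of_eq h₁, param_scriV_of_pos h₂, hk (kruskalOfV_mem _ h₂)] at h
      cases h
    · rw [param_scriV_of_pos h₁, param_scriV_of_neg h₂, beyondPoint_of_neg _ (hv h₂),
        hk (kruskalOfV_mem _ h₁)] at h
      cases h
    · rw [param_scriV_of_pos h₁, param_scriV_of_eq h₂, hk (kruskalOfV_mem _ h₁)] at h
      cases h
    · rw [param_scriV_of_pos h₁, param_scriV_of_pos h₂,
        kruskalPoint_inj (kruskalOfV_mem _ h₁) (kruskalOfV_mem _ h₂)] at h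
      exact kruskalOfV_inj h₁ h₂ h.2

theorem Patch.isOpen_dom (i : Patch) : IsOpen i.dom := by
  cases i with
  | string => exact isOpen_lt continuous_const continuous_snd
  | kruskal ε => exact isOpen_kruskalDomain
  | singular δ =>
    exact (isOpen_lt continuous_const continuous_snd).inter (isOpen_lt continuous_snd continuous_const)
  | scriU i => exact isOpen_univ
  | scriV i => exact isOpen_univ

namespace SurfacePoint

/-- A patch around a point. -/
def homeIdx : SurfacePoint → Patch
  | kruskal ε _ => .kruskal ε
  | singular δ _ => .singular δ
  | scriU i _ => .scriU i
  | scriV i _ => .scriV i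
  | beyond i _ => .scriU i

/-- The coordinates of a point in the patch `homeIdx`. -/
def homePt : SurfacePoint → ℝ × ℝ
  | kruskal _ x => x
  | singular _ t => (t, 0)
  | scriU _ u => (u, 0)
  | scriV _ v => (v, 0)
  | beyond _ x => x

theorem homePt_mem (m : SurfacePoint) : m.homePt ∈ m.homeIdx.dom := by
  cases m with
  | kruskal ε x => exact x.2
  | singular δ t => constructor <;> norm_num [homePt]
  | _ => trivial

theorem param_homePt (m : SurfacePoint) : m.homeIdx.param m.homePt = m := by
  cases m with
  | kruskal ε x => exact kruskalPoint_of_mem ε x.2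
  | singular δ t => exact Patch.param_singular_of_eq rfl
  | scriU i u => exact Patch.param_scriU_of_eq rfl
  | scriV i u => exact Patch.param_scriV_of_eq rfl
  | beyond i x => exact (Patch.param_scriU_of_neg x.2).trans (beyondPoint_of_neg i x.2)

end SurfacePoint

/-- Coordinates around a point can be changed to the coordinates of its home patch, compatibly with
the Hamiltonians and the energies. -/
theorem exists_transition_home (i : Patch) (x : ℝ × ℝ) (hx : x ∈ i.dom) : ∃ T T',
    IsTransition i.param (i.param x).homeIdx.param T T' x ∧ T x = (i.param x).homePt ∧
    (∀ η, i.ham x (pullback T' η) = (i.param x).homeIdx.ham (T x) η) ∧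
    ∀ η, i.energy x (pullback T' η) = (i.param x).homeIdx.energy (T x) η := by
  have key : ∀ (T : ℝ × ℝ → ℝ × ℝ) (j : Patch), (i.param x).homeIdx = j →
      (i.param x).homePt = T x → (∀ᶠ x' in 𝓝 x, i.param x' = j.param (T x')) →
      (∃ T', Intertwines T x i.ham i.energy j.ham j.energy T') → ∃ T T',
      IsTransition i.param (i.param x).homeIdx.param T T' x ∧ T x = (i.param x).homePt ∧
      (∀ η, i.ham x (pullback T' η) = (i.param x).homeIdx.ham (T x) η) ∧
      ∀ η, i.energy x (pullback T' η) = (i.param x).homeIdx.energy (T x) η := by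
    rintro T j rfl hpt hev ⟨T', h⟩
    exact ⟨T, T', ⟨h.contDiffAt, h.hasFDerivAt, hev⟩, hpt.symm, h.hamiltonian, h.energy⟩
  have hid : (i.param x).homeIdx = i → (i.param x).homePt = x → ∃ T T',
      IsTransition i.param (i.param x).homeIdx.param T T' x ∧ T x = (i.param x).homePt ∧
      (∀ η, i.ham x (pullback T' η) = (i.param x).homeIdx.ham (T x) η) ∧
      ∀ η, i.energy x (pullback T' η) = (i.param x).homeIdx.energy (T x) η :=
    fun h₁ h₂ => key id i h₁ h₂ (by simp) ⟨_, Intertwines.refl x _ _⟩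
  have hsnd : ContinuousAt (Prod.snd : ℝ × ℝ → ℝ) x := continuousAt_snd
  cases i with
  | string =>
    have e : Patch.string.param x = .kruskal 1 ⟨_, kruskalOfString_mem hx⟩ :=
      kruskalPoint_of_mem _ _
    exact key kruskalOfString (.kruskal 1) (by rw [e]; rfl) (by rw [e]; rfl)
      (Filter.Eventually.of_forall fun _ => rfl) (intertwines_kruskalOfString hx)
  | kruskal ε =>
    have e : (Patch.kruskal ε).param x = .kruskal ε ⟨x, hx⟩ := kruskalPoint_of_mem _ _
    exact hid (by rw [e]; rfl) (by rw [e]; rfl)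
  | singular δ =>
    rcases lt_trichotomy x.2 0 with h | h | h
    · have e : (Patch.singular δ).param x = .kruskal (-1) ⟨_, kruskalOfSingular_mem δ hx h.ne⟩ := by
        rw [Patch.param_singular_of_neg h, kruskalPoint_of_mem]
      refine key (kruskalOfSingular δ) (.kruskal (-1)) (by rw [e]; rfl) (by rw [e]; rfl) ?_
        (intertwines_kruskalOfSingular δ hx h.ne)
      filter_upwards [hsnd.eventually (gt_mem_nhds h)] with x' h'
      exact Patch.param_singular_of_neg h'
    · exact hid (by rw [Patch.param_singular_of_eq h]; rfl)
        (by rw [Patch.param_singular_of_eq h]; exact Prod.ext rfl h.symm)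
    · have e : (Patch.singular δ).param x = .kruskal 1 ⟨_, kruskalOfSingular_mem δ hx h.ne'⟩ := by
        rw [Patch.param_singular_of_pos h, kruskalPoint_of_mem]
      refine key (kruskalOfSingular δ) (.kruskal 1) (by rw [e]; rfl) (by rw [e]; rfl) ?_
        (intertwines_kruskalOfSingular δ hx h.ne')
      filter_upwards [hsnd.eventually (lt_mem_nhds h)] with x' h'
      exact Patch.param_singular_of_pos h'
  | scriU j =>
    rcases lt_trichotomy x.2 0 with h | h | h
    · have e : (Patch.scriU j).param x = .beyond j ⟨x, h⟩ := by
        rw [Patch.param_scriU_of_neg h, beyondPoint_of_neg]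
      exact hid (by rw [e]; rfl) (by rw [e]; rfl)
    · exact hid (by rw [Patch.param_scriU_of_eq h]; rfl)
        (by rw [Patch.param_scriU_of_eq h]; exact Prod.ext rfl h.symm)
    · have e : (Patch.scriU j).param x = .kruskal j.1 ⟨_, kruskalOfU_mem j.2 h⟩ := by
        rw [Patch.param_scriU_of_pos h, kruskalPoint_of_mem]
      refine key (kruskalOfU j.2) (.kruskal j.1) (by rw [e]; rfl) (by rw [e]; rfl) ?_
        (intertwines_kruskalOfU j.2 h)
      filter_upwards [hsnd.eventually (lt_mem_nhds h)] with x' h'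
      exact Patch.param_scriU_of_pos h'
  | scriV j =>
    rcases lt_trichotomy x.2 0 with h | h | h
    · have e : (Patch.scriV j).param x = .beyond j ⟨vOfU x, h⟩ := by
        rw [Patch.param_scriV_of_neg h, beyondPoint_of_neg j (x := vOfU x) h]
      refine key vOfU (.scriU j) (by rw [e]; rfl) (by rw [e]; rfl) ?_
        ((intertwines_vOfU h.ne (by linarith)).imp fun _ h => h.1)
      filter_upwards [hsnd.eventually (gt_mem_nhds h)] with x' (h' : x'.2 < 0)
      rw [Patch.param_scriV_of_neg h', Patch.param_scriU_of_neg]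
      exact h'
    · exact hid (by rw [Patch.param_scriV_of_eq h]; rfl)
        (by rw [Patch.param_scriV_of_eq h]; exact Prod.ext rfl h.symm)
    · have e : (Patch.scriV j).param x = .kruskal j.1 ⟨_, kruskalOfV_mem j.2 h⟩ := by
        rw [Patch.param_scriV_of_pos h, kruskalPoint_of_mem]
      refine key (kruskalOfV j.2) (.kruskal j.1) (by rw [e]; rfl) (by rw [e]; rfl) ?_
        (intertwines_kruskalOfV j.2 h)
      filter_upwards [hsnd.eventually (lt_mem_nhds h)] with x' h'
      exact Patch.param_scriV_of_pos h'

/-- The gluing of the patches. -/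
def gluing : AnalyticGluing SurfacePoint Patch where
  dom := Patch.dom
  param := Patch.param
  homeIdx := SurfacePoint.homeIdx
  homePt := SurfacePoint.homePt
  isOpen_dom := Patch.isOpen_dom
  injOn := Patch.injOn_param
  homePt_mem := SurfacePoint.homePt_mem
  param_homePt := SurfacePoint.param_homePt
  exists_transition i x hx := by
    obtain ⟨T, T', hT, hTx, -⟩ := exists_transition_home i x hx
    exact ⟨T, T', hT, hTx⟩

/-- The extended string surface. -/
abbrev Surface : Type := gluing.Space

/-- The patches of the extended string surface. -/
def patches : Patches Surface where
  string := gluing.chart .string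
  kruskal ε := gluing.chart (.kruskal ε)
  singular δ := gluing.chart (.singular δ)
  scriU i := gluing.chart (.scriU i)
  scriV i := gluing.chart (.scriV i)

/-- The string Hamiltonian on the cotangent bundle of the extended string surface. -/
def stringHam : CotangentBundle Surface → ℝ := gluing.glue Patch.ham

/-- The energy on the cotangent bundle of the extended string surface. -/
def stringEnergy : CotangentBundle Surface → ℝ := gluing.glue Patch.energy

theorem stringHam_covectorAt (i : Patch) (x : ℝ × ℝ) (hx : x ∈ i.dom) (ξ : ℝ × ℝ) :
    stringHam (covectorAt (gluing.chart i) x ξ) = i.ham x ξ := by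
  refine gluing.glue_covectorAt (fun i x hx => ?_) hx ξ
  obtain ⟨T, T', hT, hTx, h, -⟩ := exists_transition_home i x hx
  exact ⟨T, T', hT, hTx, h⟩

theorem stringEnergy_covectorAt (i : Patch) (x : ℝ × ℝ) (hx : x ∈ i.dom) (ξ : ℝ × ℝ) :
    stringEnergy (covectorAt (gluing.chart i) x ξ) = i.energy x ξ := by
  refine gluing.glue_covectorAt (fun i x hx => ?_) hx ξ
  obtain ⟨T, T', hT, hTx, -, h⟩ := exists_transition_home i x hx
  exact ⟨T, T', hT, hTx, h⟩

theorem contDiffAt_ham (i : Patch) (x : ℝ × ℝ) (hx : x ∈ i.dom) (ξ : ℝ × ℝ) :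
    ContDiffAt ℝ ω (Function.uncurry i.ham) (x, ξ) := by
  have hfst : ContinuousAt (Prod.fst : (ℝ × ℝ) × (ℝ × ℝ) → ℝ × ℝ) (x, ξ) := continuousAt_fst
  have hdom := hfst.eventually ((Patch.isOpen_dom i).mem_nhds hx)
  have hedd : ContDiffAt ℝ ω (Function.uncurry (metricHam eddingtonMetric)) (x, ξ) := by
    have e : Function.uncurry (metricHam eddingtonMetric) =
        fun w : (ℝ × ℝ) × (ℝ × ℝ) => w.2.1 * w.2.2 - w.1.2 ^ 2 * (1 - w.1.2) / 2 * w.2.2 ^ 2 :=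
      funext fun w => geodesicHamiltonian_eddingtonMetric w.1 w.2
    rw [e]
    fun_prop
  cases i with
  | string =>
    have h₁ : ContDiffAt ℝ ω (fun w : (ℝ × ℝ) × (ℝ × ℝ) => w.1.2 ^ 3 / (2 * (w.1.2 - 1))) (x, ξ) :=
      ContDiffAt.div (by fun_prop) (by fun_prop)
        (by have : 1 < x.2 := hx
            change 2 * (x.2 - 1) ≠ 0
            linarith)
    refine ContDiffAt.congr_of_eventuallyEq (f := fun w : (ℝ × ℝ) × (ℝ × ℝ) =>
      w.1.2 ^ 3 / (2 * (w.1.2 - 1)) * w.2.1 ^ 2 - w.1.2 * (w.1.2 - 1) / 2 * w.2.2 ^ 2) ?_ ?_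
    · fun_prop
    · filter_upwards [hdom] with w hw
      exact geodesicHamiltonian_stringMetric hw w.2
  | kruskal ε =>
    have hW : ContDiffAt ℝ ω (fun w : (ℝ × ℝ) × (ℝ × ℝ) => lambertW (w.1.1 * w.1.2)) (x, ξ) := by
      refine ContDiffAt.comp (g := lambertW) (x, ξ) ?_ (by fun_prop)
      exact contDiffAt_lambertW (mem_kruskalDomain.1 hx)
    refine ContDiffAt.congr_of_eventuallyEq (f := fun w : (ℝ × ℝ) × (ℝ × ℝ) =>
      -(Real.exp (lambertW (w.1.1 * w.1.2)) * (1 + lambertW (w.1.1 * w.1.2)) ^ 3 / 2) *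
        (w.2.1 * w.2.2)) ?_ ?_
    · fun_prop
    · filter_upwards [hdom] with w hw
      exact geodesicHamiltonian_kruskalMetric hw w.2
  | singular δ =>
    refine ContDiffAt.div (by fun_prop) (by fun_prop) ?_
    change 8 * (x.2 ^ 2 - 1) ≠ 0
    nlinarith [hx.1, hx.2]
  | scriU i => exact hedd
  | scriV i => exact hedd

theorem isExpression_ham : AnalyticGluing.IsExpression gluing stringHam Patch.ham :=
  ⟨contDiffAt_ham, stringHam_covectorAt⟩

theorem isExpression_energy : AnalyticGluing.IsExpression gluing stringEnergy Patch.energy := by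
  refine ⟨fun i x hx ξ => ?_, stringEnergy_covectorAt⟩
  cases i <;> simp only [Patch.energy, kruskalEnergy, Function.uncurry_def] <;> fun_prop

theorem isGluing_patches : IsGluing patches where
  string_mem := gluing.chart_mem_maximalAtlas _
  kruskal_mem _ := gluing.chart_mem_maximalAtlas _
  singular_mem _ := gluing.chart_mem_maximalAtlas _
  scriU_mem _ := gluing.chart_mem_maximalAtlas _
  scriV_mem _ := gluing.chart_mem_maximalAtlas _
  string_target := rfl
  kruskal_target _ := rfl
  singular_target _ := rfl
  scriU_target _ := rfl
  scriV_target _ := rfl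
  cover z := by
    have h : z ∈ (gluing.chart (SurfacePoint.homeIdx z)).source := mem_chart_source (ℝ × ℝ) z
    cases z with
    | kruskal ε x => exact Or.inl ⟨ε, h⟩
    | singular δ t => exact Or.inr (Or.inl ⟨δ, h⟩)
    | scriU i u => exact Or.inr (Or.inr (Or.inl ⟨i, h⟩))
    | scriV i v => exact Or.inr (Or.inr (Or.inr ⟨i, h⟩))
    | beyond i x => exact Or.inr (Or.inr (Or.inl ⟨i, h⟩))
  kruskal_disjoint := by
    rw [Set.disjoint_left]
    rintro _ ⟨x, hx, rfl⟩ ⟨y, hy, h⟩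
    exact absurd ((kruskalPoint_inj hy hx).1 h).1 (by decide)
  string_kruskal _ _ := rfl
  singular_kruskal ε δ y hy h := by
    rcases Int.units_eq_one_or ε with rfl | rfl
    · exact Patch.param_singular_of_pos (by simpa [sgn] using h)
    · exact Patch.param_singular_of_neg (by simpa [sgn] using h)
  scriU_kruskal ε δ x hx := Patch.param_scriU_of_pos hx
  scriV_kruskal ε δ x hx := Patch.param_scriV_of_pos hx
  scriU_scriV := by
    refine ⟨Equiv.refl _, fun i x hx => ?_⟩
    change Patch.param (.scriU i) x = Patch.param (.scriV i) (vOfU x)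
    rw [Patch.param_scriU_of_neg hx, Patch.param_scriV_of_neg (by exact hx), vOfU_vOfU]

theorem isStringHamiltonian : IsStringHamiltonian patches stringHam where
  string x hx ξ := stringHam_covectorAt .string x hx ξ
  kruskal ε x hx ξ := stringHam_covectorAt (.kruskal ε) x hx ξ
  singular δ x hx ξ := stringHam_covectorAt (.singular δ) x hx ξ
  scriU i x ξ := stringHam_covectorAt (.scriU i) x trivial ξ
  scriV i x ξ := stringHam_covectorAt (.scriV i) x trivial ξ

/-! ### The topology of the extended string surface -/

namespace AnalyticGluing

variable {M ι : Type} (G : AnalyticGluing M ι)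

theorem continuousOn_pt (i : ι) : ContinuousOn (G.pt i) (G.dom i) :=
  (G.chart i).continuousOn_symm

theorem isOpen_image_pt {i : ι} {O : Set (ℝ × ℝ)} (hO : IsOpen O) (h : O ⊆ G.dom i) :
    IsOpen (G.pt i '' O) :=
  (G.chart i).isOpen_image_symm_of_subset_target hO h

theorem continuous_of_continuousAt_param {f : M → ℝ}
    (hf : ∀ i, ∀ x ∈ G.dom i, ContinuousAt (fun y => f (G.param i y)) x) :
    Continuous (fun m : G.Space => f m) := by
  rw [continuous_iff_continuousAt]
  intro m
  have hm : m ∈ (G.chart (G.homeIdx m)).source := mem_chart_source (ℝ × ℝ) m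
  have h := (hf (G.homeIdx m) (G.chart (G.homeIdx m) m)
    ((G.chart (G.homeIdx m)).map_source hm)).comp ((G.chart (G.homeIdx m)).continuousAt hm)
  refine h.congr ?_
  filter_upwards [(G.chart (G.homeIdx m)).open_source.mem_nhds hm] with m' hm'
  exact congrArg f ((G.chart (G.homeIdx m)).left_inv hm')

theorem secondCountable [Countable ι] : SecondCountableTopology G.Space := by
  have : SecondCountableTopology (ℝ × ℝ) := inferInstance
  refine ChartedSpace.secondCountable_of_countable_cover (ℝ × ℝ)
    (s := Set.range fun i : Set.range G.homeIdx => (Classical.choose i.2 : G.Space)) ?_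
    (Set.countable_range _)
  refine Set.eq_univ_of_forall fun m => ?_
  have h := Classical.choose_spec (⟨m, rfl⟩ : G.homeIdx m ∈ Set.range G.homeIdx)
  refine Set.mem_iUnion₂.2 ⟨_, ⟨⟨G.homeIdx m, ⟨m, rfl⟩⟩, rfl⟩, ?_⟩
  exact (congrArg (fun i => m ∈ (G.chart i).source) h).mpr (mem_chart_source (ℝ × ℝ) m)

theorem separated_of_images {i j : ι} {m m' : G.Space} {O O' : Set (ℝ × ℝ)} (hO : IsOpen O)
    (hO' : IsOpen O') (h : O ⊆ G.dom i) (h' : O' ⊆ G.dom j) (hm : m ∈ G.pt i '' O)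
    (hm' : m' ∈ G.pt j '' O') (hne : ∀ x ∈ O, ∀ y ∈ O', G.param i x ≠ G.param j y) :
    SeparatedNhds {m} {m'} := by
  refine ⟨_, _, G.isOpen_image_pt hO h, G.isOpen_image_pt hO' h', by simpa using hm,
    by simpa using hm', ?_⟩
  rw [Set.disjoint_left]
  rintro _ ⟨x, hx, rfl⟩ ⟨y, hy, hxy⟩
  exact hne x hx y hy hxy.symm

theorem separated_of_ne {i : ι} {x y : ℝ × ℝ} (hx : x ∈ G.dom i) (hy : y ∈ G.dom i) (hxy : x ≠ y) :
    SeparatedNhds {G.pt i x} {G.pt i y} := by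
  obtain ⟨u, v, hu, hv, hxu, hyv, huv⟩ := t2_separation hxy
  refine G.separated_of_images (hu.inter (G.isOpen_dom i)) (hv.inter (G.isOpen_dom i))
    Set.inter_subset_right Set.inter_subset_right ⟨x, ⟨hxu, hx⟩, rfl⟩ ⟨y, ⟨hyv, hy⟩, rfl⟩ ?_
  intro a ha b hb hab
  have : a = b := G.injOn i ha.2 hb.2 hab
  exact Set.disjoint_left.1 huv ha.1 (this ▸ hb.1)

theorem connectedComponent_eq {i : ι} (hi : IsPreconnected (G.dom i)) {x y : ℝ × ℝ}
    (hx : x ∈ G.dom i) (hy : y ∈ G.dom i) :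
    connectedComponent (G.pt i x) = connectedComponent (G.pt i y) := by
  have h : IsPreconnected (G.pt i '' G.dom i) := hi.image _ (G.continuousOn_pt i)
  exact _root_.connectedComponent_eq (h.subset_connectedComponent ⟨x, hx, rfl⟩ ⟨y, hy, rfl⟩)

end AnalyticGluing

/-! ### Connectedness -/

theorem isPreconnected_kruskalDomain : IsPreconnected kruskalDomain := by
  have h0 : (0 : ℝ × ℝ) ∈ kruskalDomain := by rw [mem_kruskalDomain]; norm_num
  -- Scaling by `a ∈ [0, 1]` multiplies `pq` by `a²`, which preserves `e pq > -1`.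
  have h : StarConvex ℝ 0 kruskalDomain := by
    rw [starConvex_zero_iff]
    intro x hx a ha₀ ha₁
    rw [mem_kruskalDomain] at hx ⊢
    have e : Real.exp 1 * ((a • x).1 * (a • x).2) = a ^ 2 * (Real.exp 1 * (x.1 * x.2)) := by
      simp; ring
    rw [e]
    rcases eq_or_lt_of_le ha₀ with rfl | h
    · norm_num
    · have : 0 < a ^ 2 := by positivity
      nlinarith
  exact (h.isPathConnected h0).isConnected.isPreconnected

theorem Patch.isPreconnected_dom (i : Patch) : IsPreconnected i.dom := by
  have hlin : IsLinearMap ℝ (Prod.snd : ℝ × ℝ → ℝ) := (LinearMap.snd ℝ ℝ ℝ).isLinear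
  cases i with
  | string => exact (convex_halfSpace_gt hlin 1).isPreconnected
  | kruskal ε => exact isPreconnected_kruskalDomain
  | singular δ =>
    exact ((convex_halfSpace_gt hlin (-1)).inter (convex_halfSpace_lt hlin 1)).isPreconnected
  | scriU i => exact isPreconnected_univ
  | scriV i => exact isPreconnected_univ

/-- All patch domains are connected. A singular patch meets both Kruskal–Szekeres patches, and each
Eddington–Finkelstein patch meets one of them at `s = 1`. -/
theorem connectedSpace_surface : ConnectedSpace Surface := by
  rw [connectedSpace_iff_connectedComponent]
  have hc (i : Patch) {x y : ℝ × ℝ} (hx : x ∈ i.dom) (hy : y ∈ i.dom) :=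
    gluing.connectedComponent_eq i.isPreconnected_dom hx hy
  have h0 : (0 : ℝ × ℝ) ∈ kruskalDomain := by rw [mem_kruskalDomain]; norm_num
  let z₀ : Surface := gluing.pt (.kruskal 1) 0
  have hsing : ∀ δ, ∀ y ∈ singularDomain, y.2 ≠ 0 → ∃ ε,
      gluing.pt (.singular δ) y = gluing.pt (.kruskal ε) (kruskalOfSingular δ y) ∧
        (0 < y.2 → ε = 1) ∧ (y.2 < 0 → ε = -1) := by
    intro δ y hy hy'
    rcases lt_or_gt_of_ne hy' with h | h
    · exact ⟨-1, Patch.param_singular_of_neg h, fun h' => absurd h h'.not_gt, fun _ => rfl⟩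
    · exact ⟨1, Patch.param_singular_of_pos h, fun _ => rfl, fun h' => absurd h h'.not_gt⟩
  have h₁ : ∀ x ∈ kruskalDomain, connectedComponent (gluing.pt (.kruskal 1) x) =
      connectedComponent z₀ := fun x hx => hc (.kruskal 1) hx h0
  have hm₁ : ((0, 1 / 2) : ℝ × ℝ) ∈ singularDomain := by constructor <;> norm_num
  have hm₂ : ((0, -1 / 2) : ℝ × ℝ) ∈ singularDomain := by constructor <;> norm_num
  have h₂ : ∀ δ, ∀ y ∈ singularDomain, connectedComponent (gluing.pt (.singular δ) y) =
      connectedComponent z₀ := by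
    intro δ y hy
    rw [hc (.singular δ) hy hm₁]
    have e : gluing.pt (.singular δ) (0, 1 / 2) = gluing.pt (.kruskal 1) _ :=
      Patch.param_singular_of_pos (by norm_num)
    rw [e]
    exact h₁ _ (kruskalOfSingular_mem δ hm₁ (by norm_num))
  have h₃ : ∀ ε, ∀ x ∈ kruskalDomain, connectedComponent (gluing.pt (.kruskal ε) x) =
      connectedComponent z₀ := by
    intro ε x hx
    rcases Int.units_eq_one_or ε with rfl | rfl
    · exact h₁ x hx
    · rw [hc (.kruskal (-1)) hx (kruskalOfSingular_mem 1 hm₂ (by norm_num)), ← h₂ 1 _ hm₂]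
      have e : gluing.pt (.singular 1) (0, -1 / 2) = gluing.pt (.kruskal (-1)) _ :=
        Patch.param_singular_of_neg (by norm_num)
      rw [e]
  have h₄ : ∀ i x, connectedComponent (gluing.pt (.scriU i) x) = connectedComponent z₀ := by
    intro i x
    rw [hc (.scriU i) (y := (0, 1)) trivial trivial]
    have e : gluing.pt (.scriU i) (0, 1) = gluing.pt (.kruskal i.1) _ :=
      Patch.param_scriU_of_pos (by norm_num)
    rw [e]
    exact h₃ _ _ (kruskalOfU_mem _ (by norm_num))
  have h₅ : ∀ i x, connectedComponent (gluing.pt (.scriV i) x) = connectedComponent z₀ := by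
    intro i x
    rw [hc (.scriV i) (y := (0, 1)) trivial trivial]
    have e : gluing.pt (.scriV i) (0, 1) = gluing.pt (.kruskal i.1) _ :=
      Patch.param_scriV_of_pos (by norm_num)
    rw [e]
    exact h₃ _ _ (kruskalOfV_mem _ (by norm_num))
  refine ⟨z₀, Set.eq_univ_of_forall fun z => ?_⟩
  have hz : gluing.pt (SurfacePoint.homeIdx z) (SurfacePoint.homePt z) = z :=
    SurfacePoint.param_homePt z
  have hmem := SurfacePoint.homePt_mem z
  suffices h : connectedComponent z = connectedComponent z₀ from h ▸ mem_connectedComponent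
  rw [← hz]
  cases z with
  | kruskal ε x => exact h₃ ε _ hmem
  | singular δ t => exact h₂ δ _ hmem
  | scriU i u => exact h₄ i _
  | scriV i v => exact h₅ i _
  | beyond i x => exact h₄ i _

/-! ### The Hausdorff property -/

/-- A continuous function on the surface: `r² / (1 + r²) = 1 / (1 + s²)`. -/
def level : SurfacePoint → ℝ
  | .kruskal _ x => (1 + lambertW (x.1.1 * x.1.2)) ^ 2 / (1 + (1 + lambertW (x.1.1 * x.1.2)) ^ 2)
  | .singular _ _ => 0
  | .scriU _ _ => 1
  | .scriV _ _ => 1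
  | .beyond _ x => 1 / (1 + x.1.2 ^ 2)

theorem level_kruskalPoint (ε : ℤˣ) {x : ℝ × ℝ} (hx : x ∈ kruskalDomain) :
    level (kruskalPoint ε x) =
      (1 + lambertW (x.1 * x.2)) ^ 2 / (1 + (1 + lambertW (x.1 * x.2)) ^ 2) := by
  rw [kruskalPoint_of_mem ε hx, level]

theorem continuousAt_level_param (i : Patch) {x : ℝ × ℝ} (hx : x ∈ i.dom) :
    ContinuousAt (fun y => level (i.param y)) x := by
  have hev : ∀ᶠ y in 𝓝 x, y ∈ i.dom := (Patch.isOpen_dom i).mem_nhds hx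
  have hpos (a : ℝ) : 1 + a ^ 2 ≠ 0 := by positivity
  have hdiv {f : ℝ × ℝ → ℝ} (hf : ContinuousAt f x) :
      ContinuousAt (fun y => f y ^ 2 / (1 + f y ^ 2)) x :=
    ContinuousAt.div (hf.pow 2) ((hf.pow 2).const_add 1) (hpos _)
  have hcont : Continuous fun y : ℝ × ℝ => 1 / (1 + y.2 ^ 2) :=
    Continuous.div (by fun_prop) (by fun_prop) fun y => hpos y.2
  cases i with
  | string =>
    refine (hdiv continuousAt_snd).congr ?_
    filter_upwards [hev] with y hy
    change _ = level (kruskalPoint 1 (kruskalOfString y))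
    rw [level_kruskalPoint _ (kruskalOfString_mem hy), lambertW_kruskalOfString hy,
      add_sub_cancel]
  | kruskal ε =>
    have hW : ContinuousAt (fun y : ℝ × ℝ => lambertW (y.1 * y.2)) x :=
      ContinuousAt.comp (g := lambertW) (contDiffAt_lambertW (mem_kruskalDomain.1 hx)).continuousAt
        (by fun_prop)
    refine (hdiv (hW.const_add 1)).congr ?_
    filter_upwards [hev] with y hy
    exact (level_kruskalPoint ε hy).symm
  | singular δ =>
    refine (hdiv (f := fun y => y.2 ^ 2) (continuousAt_snd.pow 2)).congr ?_
    filter_upwards [hev] with y hy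
    have hm (h : y.2 ≠ 0) := kruskalOfSingular_mem δ hy h
    rcases lt_trichotomy y.2 0 with h | h | h
    · rw [Patch.param_singular_of_neg h, level_kruskalPoint _ (hm h.ne),
        lambertW_kruskalOfSingular δ hy, add_sub_cancel]
    · rw [Patch.param_singular_of_eq h, h]
      simp [level]
    · rw [Patch.param_singular_of_pos h, level_kruskalPoint _ (hm h.ne'),
        lambertW_kruskalOfSingular δ hy, add_sub_cancel]
  | scriU i =>
    refine hcont.continuousAt.congr (Filter.Eventually.of_forall fun y => ?_)
    dsimp only
    rcases lt_trichotomy y.2 0 with h | h | h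
    · rw [Patch.param_scriU_of_neg h, beyondPoint_of_neg i h, level]
    · rw [Patch.param_scriU_of_eq h, h]
      simp [level]
    · rw [Patch.param_scriU_of_pos h, level_kruskalPoint _ (kruskalOfU_mem _ h),
        lambertW_kruskalOfU _ h]
      field_simp
      ring
  | scriV i =>
    refine hcont.continuousAt.congr (Filter.Eventually.of_forall fun y => ?_)
    dsimp only
    rcases lt_trichotomy y.2 0 with h | h | h
    · rw [Patch.param_scriV_of_neg h, beyondPoint_of_neg i (x := vOfU y) h, level, vOfU_snd]
    · rw [Patch.param_scriV_of_eq h, h]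
      simp [level]
    · rw [Patch.param_scriV_of_pos h, level_kruskalPoint _ (kruskalOfV_mem _ h),
        lambertW_kruskalOfV _ h]
      field_simp
      ring

theorem continuous_level : Continuous (fun m : Surface => level m) :=
  gluing.continuous_of_continuousAt_param fun i _ hx => continuousAt_level_param i hx

/-- This settles every pair of points at different `r²`, in particular a singularity or scri against
anything of another kind except `u`-scri against `v`-scri. -/
theorem separated_of_level {m m' : Surface} (h : level m ≠ level m') : SeparatedNhds {m} {m'} := by
  obtain ⟨u, v, hu, hv, hmu, hmv, huv⟩ := t2_separation h
  exact ⟨_, _, hu.preimage continuous_level, hv.preimage continuous_level, by simpa using hmu,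
    by simpa using hmv, huv.preimage _⟩

theorem level_kruskal_mem (ε : ℤˣ) (x : kruskalDomain) :
    0 < level (.kruskal ε x) ∧ level (.kruskal ε x) < 1 := by
  have := (lambertW_spec (mem_kruskalDomain.1 x.2)).1
  have h : 0 < 1 + lambertW (x.1.1 * x.1.2) := by linarith
  refine ⟨by simp only [level]; positivity, ?_⟩
  simp only [level]
  rw [div_lt_one (by positivity)]
  linarith

theorem level_beyond_mem (i : ℤˣ × ℤˣ) (x : {x : ℝ × ℝ // x.2 < 0}) :
    0 < level (.beyond i x) ∧ level (.beyond i x) < 1 := by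
  have h : 0 < x.1.2 ^ 2 := by have := x.2.ne; positivity
  refine ⟨by simp only [level]; positivity, ?_⟩
  simp only [level]
  rw [div_lt_one (by positivity)]
  linarith

/-- Eddington–Finkelstein patches of different kinds do not overlap near bounded pieces of scri. -/
theorem scriU_ne_scriV (i j : ℤˣ × ℤˣ) (u v : ℝ) : ∃ c > 0, ∀ a b : ℝ × ℝ,
    |a.1 - u| < 1 → |a.2| < c → |b.1 - v| < 1 → |b.2| < c →
      Patch.param (.scriU i) a ≠ Patch.param (.scriV j) b := by
  set B := Real.exp ((u + v + 2) / 2) with hB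
  have hBpos : 0 < B := Real.exp_pos _
  have hDpos : 0 < B + |u| + |v| + 3 := by positivity
  -- Small `|s|` makes `|r|` larger than `B + |u| + |v| + 3`. For `s > 0` this contradicts `|pq| =
  -- e^{(u'+v')/2} < B`, for `s < 0` it contradicts `u' + v' > u + v - 2`, where `u'`, `v'` are the
  -- nearby coordinates.
  refine ⟨1 / (B + |u| + |v| + 3), by positivity, fun a b ha₁ ha₂ hb₁ hb₂ h => ?_⟩
  rw [abs_lt] at ha₁ hb₁
  have hbig : ∀ s : ℝ, s ≠ 0 → |s| < 1 / (B + |u| + |v| + 3) → B + |u| + |v| + 3 < 1 / |s| := by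
    intro s hs hs'
    rwa [lt_one_div hDpos (abs_pos.2 hs)]
  rcases lt_trichotomy a.2 0 with h₁ | h₁ | h₁ <;> rcases lt_trichotomy b.2 0 with h₂ | h₂ | h₂
  · rw [Patch.param_scriU_of_neg h₁, Patch.param_scriV_of_neg h₂,
      beyondPoint_inj h₁ (by exact h₂)] at h
    have h₃ := congrArg Prod.fst h.2
    simp only [vOfU] at h₃
    have h₄ := hbig _ h₂.ne hb₂
    rw [abs_of_neg h₂] at h₄
    have h₅ : 1 / -b.2 = -(1 / b.2) := by ring
    rw [h₅] at h₄
    generalize 1 / b.2 = y at *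
    -- The bound `log z ≤ z - 1` at `z = -(y - 1)` would exactly cancel the linear term `2(y - 1)`
    -- of `u + v`. Halving the argument first leaves `u + v ≤ y - 1`, which tends to `-∞`.
    have h₆ : Real.log ((y - 1) ^ 2) ≤ -(y - 1) := by
      have hy : 0 < -(y - 1) / 2 := by linarith [abs_nonneg u, abs_nonneg v]
      have e : (y - 1) ^ 2 = (-(y - 1) / 2) ^ 2 * 2 ^ 2 := by ring
      rw [e, Real.log_mul (by positivity) (by positivity), Real.log_pow, Real.log_pow]
      have := Real.log_le_sub_one_of_pos hy
      have := Real.log_two_lt_d9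
      push_cast
      linarith
    linarith [neg_abs_le u, neg_abs_le v]
  · rw [Patch.param_scriU_of_neg h₁, Patch.param_scriV_of_eq h₂, beyondPoint_of_neg _ h₁] at h
    cases h
  · rw [Patch.param_scriU_of_neg h₁, Patch.param_scriV_of_pos h₂, beyondPoint_of_neg _ h₁,
      kruskalPoint_of_mem _ (kruskalOfV_mem _ h₂)] at h
    cases h
  · rw [Patch.param_scriU_of_eq h₁, Patch.param_scriV_of_neg h₂,
      beyondPoint_of_neg _ (x := vOfU b) h₂] at h
    cases h
  · rw [Patch.param_scriU_of_eq h₁, Patch.param_scriV_of_eq h₂] at h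
    cases h
  · rw [Patch.param_scriU_of_eq h₁, Patch.param_scriV_of_pos h₂,
      kruskalPoint_of_mem _ (kruskalOfV_mem _ h₂)] at h
    cases h
  · rw [Patch.param_scriU_of_pos h₁, Patch.param_scriV_of_neg h₂,
      beyondPoint_of_neg _ (x := vOfU b) h₂, kruskalPoint_of_mem _ (kruskalOfU_mem _ h₁)] at h
    cases h
  · rw [Patch.param_scriU_of_pos h₁, Patch.param_scriV_of_eq h₂,
      kruskalPoint_of_mem _ (kruskalOfU_mem _ h₁)] at h
    cases h
  · rw [Patch.param_scriU_of_pos h₁, Patch.param_scriV_of_pos h₂,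
      kruskalPoint_inj (kruskalOfU_mem _ h₁) (kruskalOfV_mem _ h₂)] at h
    have h₃ := congrArg (fun x : ℝ × ℝ => |x.1|) h.2
    have hs (δ : ℤˣ) : |sgn δ| = 1 := by
      rcases Int.units_eq_one_or δ with rfl | rfl <;> simp [sgn]
    simp only [kruskalOfU, kruskalOfV, abs_mul, hs, Real.abs_exp, one_mul] at h₃
    have h₄ := hbig _ h₂.ne' hb₂
    rw [abs_of_pos h₂] at h₄
    generalize 1 / b.2 = y at *
    have h₅ : B < y - 1 := by linarith [abs_nonneg u, abs_nonneg v]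
    have h₆ : 1 ≤ Real.exp (y - 1) := Real.one_le_exp (by linarith)
    rw [abs_of_pos (by linarith : 0 < y - 1)] at h₃
    have h₇ : Real.exp (a.1 / 2) * Real.exp (b.1 / 2) < B := by
      rw [← Real.exp_add, hB, Real.exp_lt_exp]
      linarith
    have h₈ : Real.exp (-b.1 / 2) * Real.exp (b.1 / 2) = 1 := by rw [← Real.exp_add]; ring_nf; simp
    rw [h₃] at h₇
    have h₉ : Real.exp (-b.1 / 2) * ((y - 1) * Real.exp (y - 1)) * Real.exp (b.1 / 2) =
        (y - 1) * Real.exp (y - 1) := by linear_combination ((y - 1) * Real.exp (y - 1)) * h₈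
    rw [h₉] at h₇
    nlinarith

theorem separated_scriU_scriV (i j : ℤˣ × ℤˣ) (u v : ℝ) :
    SeparatedNhds ({(SurfacePoint.scriU i u : Surface)} : Set Surface)
      {(SurfacePoint.scriV j v : Surface)} := by
  obtain ⟨c, hc, h⟩ := scriU_ne_scriV i j u v
  have hopen (w : ℝ) : IsOpen {a : ℝ × ℝ | |a.1 - w| < 1 ∧ |a.2| < c} := by
    have h₁ : Continuous fun a : ℝ × ℝ => |a.1 - w| := by fun_prop
    have h₂ : Continuous fun a : ℝ × ℝ => |a.2| := by fun_prop
    exact (isOpen_lt h₁ continuous_const).inter (isOpen_lt h₂ continuous_const)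
  refine gluing.separated_of_images (i := .scriU i) (j := .scriV j) (hopen u) (hopen v)
    (fun _ _ => trivial) (fun _ _ => trivial) ⟨(u, 0), ⟨by simp, by simpa using hc⟩, ?_⟩
    ⟨(v, 0), ⟨by simp, by simpa using hc⟩, ?_⟩ fun a ha b hb => h a b ha.1 ha.2 hb.1 hb.2
  · exact Patch.param_scriU_of_eq rfl
  · exact Patch.param_scriV_of_eq rfl

theorem eq_of_sgn_mul_eq {δ δ' : ℤˣ} {a b : ℝ} (ha : 0 < a) (hb : 0 < b)
    (h : sgn δ * a = sgn δ' * b) : δ = δ' := by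
  rcases Int.units_eq_one_or δ with rfl | rfl <;> rcases Int.units_eq_one_or δ' with rfl | rfl <;>
    simp [sgn] at h ⊢ <;> linarith

theorem singular_param_ne {δ δ' : ℤˣ} (h : δ ≠ δ') {a b : ℝ × ℝ} (ha : a ∈ singularDomain)
    (hb : b ∈ singularDomain) : Patch.param (.singular δ) a ≠ Patch.param (.singular δ') b := by
  have hk (a b : ℝ × ℝ) (ha : a ∈ singularDomain) (hb : b ∈ singularDomain) :
      kruskalOfSingular δ a ≠ kruskalOfSingular δ' b := by
    have hs {c : ℝ × ℝ} (hc : c ∈ singularDomain) :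
        0 < Real.exp ((c.2 ^ 2 + c.1 - 1) / 2) * √(1 - c.2 ^ 2) := by
      have : 0 < 1 - c.2 ^ 2 := by nlinarith [hc.1, hc.2]
      positivity
    intro e
    exact h (eq_of_sgn_mul_eq (hs ha) (hs hb) (congrArg Prod.fst e))
  intro e
  rcases lt_trichotomy a.2 0 with h₁ | h₁ | h₁ <;> rcases lt_trichotomy b.2 0 with h₂ | h₂ | h₂
  · rw [Patch.param_singular_of_neg h₁, Patch.param_singular_of_neg h₂, kruskalPoint_inj
      (kruskalOfSingular_mem δ ha h₁.ne) (kruskalOfSingular_mem δ' hb h₂.ne)] at e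
    exact hk a b ha hb e.2
  · rw [Patch.param_singular_of_neg h₁, Patch.param_singular_of_eq h₂,
      kruskalPoint_of_mem _ (kruskalOfSingular_mem δ ha h₁.ne)] at e
    cases e
  · rw [Patch.param_singular_of_neg h₁, Patch.param_singular_of_pos h₂, kruskalPoint_inj
      (kruskalOfSingular_mem δ ha h₁.ne) (kruskalOfSingular_mem δ' hb h₂.ne')] at e
    exact hk a b ha hb e.2
  · rw [Patch.param_singular_of_eq h₁, Patch.param_singular_of_neg h₂,
      kruskalPoint_of_mem _ (kruskalOfSingular_mem δ' hb h₂.ne)] at e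
    cases e
  · rw [Patch.param_singular_of_eq h₁, Patch.param_singular_of_eq h₂] at e
    exact h (SurfacePoint.singular.inj e).1
  · rw [Patch.param_singular_of_eq h₁, Patch.param_singular_of_pos h₂,
      kruskalPoint_of_mem _ (kruskalOfSingular_mem δ' hb h₂.ne')] at e
    cases e
  · rw [Patch.param_singular_of_pos h₁, Patch.param_singular_of_neg h₂, kruskalPoint_inj
      (kruskalOfSingular_mem δ ha h₁.ne') (kruskalOfSingular_mem δ' hb h₂.ne)] at e
    exact hk a b ha hb e.2
  · rw [Patch.param_singular_of_pos h₁, Patch.param_singular_of_eq h₂,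
      kruskalPoint_of_mem _ (kruskalOfSingular_mem δ ha h₁.ne')] at e
    cases e
  · rw [Patch.param_singular_of_pos h₁, Patch.param_singular_of_pos h₂, kruskalPoint_inj
      (kruskalOfSingular_mem δ ha h₁.ne') (kruskalOfSingular_mem δ' hb h₂.ne')] at e
    exact hk a b ha hb e.2

theorem scriU_param_ne {i j : ℤˣ × ℤˣ} (h : i ≠ j) (a b : ℝ × ℝ) :
    Patch.param (.scriU i) a ≠ Patch.param (.scriU j) b := by
  intro e
  rcases lt_trichotomy a.2 0 with h₁ | h₁ | h₁ <;> rcases lt_trichotomy b.2 0 with h₂ | h₂ | h₂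
  · rw [Patch.param_scriU_of_neg h₁, Patch.param_scriU_of_neg h₂, beyondPoint_inj h₁ h₂] at e
    exact h e.1
  · rw [Patch.param_scriU_of_neg h₁, Patch.param_scriU_of_eq h₂, beyondPoint_of_neg _ h₁] at e
    cases e
  · rw [Patch.param_scriU_of_neg h₁, Patch.param_scriU_of_pos h₂, beyondPoint_of_neg _ h₁,
      kruskalPoint_of_mem _ (kruskalOfU_mem _ h₂)] at e
    cases e
  · rw [Patch.param_scriU_of_eq h₁, Patch.param_scriU_of_neg h₂, beyondPoint_of_neg _ h₂] at e
    cases e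
  · rw [Patch.param_scriU_of_eq h₁, Patch.param_scriU_of_eq h₂] at e
    exact h (SurfacePoint.scriU.inj e).1
  · rw [Patch.param_scriU_of_eq h₁, Patch.param_scriU_of_pos h₂,
      kruskalPoint_of_mem _ (kruskalOfU_mem _ h₂)] at e
    cases e
  · rw [Patch.param_scriU_of_pos h₁, Patch.param_scriU_of_neg h₂, beyondPoint_of_neg _ h₂,
      kruskalPoint_of_mem _ (kruskalOfU_mem _ h₁)] at e
    cases e
  · rw [Patch.param_scriU_of_pos h₁, Patch.param_scriU_of_eq h₂,
      kruskalPoint_of_mem _ (kruskalOfU_mem _ h₁)] at e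
    cases e
  · rw [Patch.param_scriU_of_pos h₁, Patch.param_scriU_of_pos h₂,
      kruskalPoint_inj (kruskalOfU_mem _ h₁) (kruskalOfU_mem _ h₂)] at e
    exact h (Prod.ext e.1 (eq_of_sgn_mul_eq (Real.exp_pos _) (Real.exp_pos _)
      (congrArg Prod.fst e.2)))

theorem scriV_param_ne {i j : ℤˣ × ℤˣ} (h : i ≠ j) (a b : ℝ × ℝ) :
    Patch.param (.scriV i) a ≠ Patch.param (.scriV j) b := by
  have hv {x : ℝ × ℝ} (hx : x.2 < 0) : (vOfU x).2 < 0 := hx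
  intro e
  rcases lt_trichotomy a.2 0 with h₁ | h₁ | h₁ <;> rcases lt_trichotomy b.2 0 with h₂ | h₂ | h₂
  · rw [Patch.param_scriV_of_neg h₁, Patch.param_scriV_of_neg h₂,
      beyondPoint_inj (hv h₁) (hv h₂)] at e
    exact h e.1
  · rw [Patch.param_scriV_of_neg h₁, Patch.param_scriV_of_eq h₂, beyondPoint_of_neg _ (hv h₁)] at e
    cases e
  · rw [Patch.param_scriV_of_neg h₁, Patch.param_scriV_of_pos h₂, beyondPoint_of_neg _ (hv h₁),
      kruskalPoint_of_mem _ (kruskalOfV_mem _ h₂)] at e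
    cases e
  · rw [Patch.param_scriV_of_eq h₁, Patch.param_scriV_of_neg h₂, beyondPoint_of_neg _ (hv h₂)] at e
    cases e
  · rw [Patch.param_scriV_of_eq h₁, Patch.param_scriV_of_eq h₂] at e
    exact h (SurfacePoint.scriV.inj e).1
  · rw [Patch.param_scriV_of_eq h₁, Patch.param_scriV_of_pos h₂,
      kruskalPoint_of_mem _ (kruskalOfV_mem _ h₂)] at e
    cases e
  · rw [Patch.param_scriV_of_pos h₁, Patch.param_scriV_of_neg h₂, beyondPoint_of_neg _ (hv h₂),
      kruskalPoint_of_mem _ (kruskalOfV_mem _ h₁)] at e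
    cases e
  · rw [Patch.param_scriV_of_pos h₁, Patch.param_scriV_of_eq h₂,
      kruskalPoint_of_mem _ (kruskalOfV_mem _ h₁)] at e
    cases e
  · rw [Patch.param_scriV_of_pos h₁, Patch.param_scriV_of_pos h₂,
      kruskalPoint_inj (kruskalOfV_mem _ h₁) (kruskalOfV_mem _ h₂)] at e
    exact h (Prod.ext e.1 (eq_of_sgn_mul_eq (Real.exp_pos _) (Real.exp_pos _)
      (congrArg Prod.snd e.2)))

theorem separated_of_param_ne {i j : Patch} (h : ∀ x ∈ i.dom, ∀ y ∈ j.dom, i.param x ≠ j.param y)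
    {m m' : SurfacePoint} (hm : m.homeIdx = i) (hm' : m'.homeIdx = j) :
    SeparatedNhds ({m} : Set Surface) {m'} := by
  subst hm hm'
  exact gluing.separated_of_images (Patch.isOpen_dom _) (Patch.isOpen_dom _) subset_rfl subset_rfl
    ⟨_, m.homePt_mem, m.param_homePt⟩ ⟨_, m'.homePt_mem, m'.param_homePt⟩ h

theorem separated_of_homeIdx_eq {m m' : SurfacePoint} (h : m.homeIdx = m'.homeIdx) (hne : m ≠ m') :
    SeparatedNhds ({m} : Set Surface) {m'} := by
  have h₁ : gluing.pt m.homeIdx m.homePt = m := m.param_homePt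
  have h₂ : gluing.pt m.homeIdx m'.homePt = m' := h ▸ m'.param_homePt
  have h₃ : m.homePt ≠ m'.homePt := fun e => hne (by rw [← h₁, e, h₂])
  have := gluing.separated_of_ne m.homePt_mem (h ▸ m'.homePt_mem) h₃
  rwa [h₁, h₂] at this

theorem separated_kruskal_beyond (ε : ℤˣ) (x : kruskalDomain) (i : ℤˣ × ℤˣ)
    (y : {x : ℝ × ℝ // x.2 < 0}) :
    SeparatedNhds ({(SurfacePoint.kruskal ε x : Surface)} : Set Surface)
      {(SurfacePoint.beyond i y : Surface)} := by
  refine gluing.separated_of_images (i := .kruskal ε) (j := .scriU i) isOpen_kruskalDomain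
    (isOpen_lt continuous_snd continuous_const : IsOpen {y : ℝ × ℝ | y.2 < 0}) subset_rfl
    (Set.subset_univ _) ⟨x, x.2, kruskalPoint_of_mem ε x.2⟩
    ⟨y, y.2, (Patch.param_scriU_of_neg y.2).trans (beyondPoint_of_neg i y.2)⟩ ?_
  intro a ha b hb e
  change kruskalPoint ε a = Patch.param (.scriU i) b at e
  rw [Patch.param_scriU_of_neg hb, beyondPoint_of_neg i hb, kruskalPoint_of_mem ε ha] at e
  cases e

/-- Among points of equal level with different home patches, those of the same kind have disjoint
patches or sit in disjoint `(u, s)` patches, and a Kruskal–Szekeres point is separated from one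
beyond scri by the half `s < 0`. Only `u`-scri against `v`-scri needs an estimate. -/
theorem separated_of_ne (m m' : SurfacePoint) (hne : m ≠ m') :
    SeparatedNhds ({m} : Set Surface) {m'} := by
  by_cases hl : level m ≠ level m'
  · exact separated_of_level hl
  rw [not_not] at hl
  by_cases hi : m.homeIdx = m'.homeIdx
  · exact separated_of_homeIdx_eq hi hne
  have hk (ε x) := level_kruskal_mem ε x
  have hb (i x) := level_beyond_mem i x
  have h0 (δ t) : level (.singular δ t) = 0 := rfl
  have h1 (i u) : level (.scriU i u) = 1 := rfl
  have h1' (i v) : level (.scriV i v) = 1 := rfl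
  cases m with
  | kruskal ε x =>
    have := hk ε x
    cases m' with
    | kruskal ε' x' =>
      refine separated_of_param_ne (i := .kruskal ε) (j := .kruskal ε') ?_ rfl rfl
      intro a ha b hb e
      exact hi (congrArg Patch.kruskal ((kruskalPoint_inj ha hb).1 e).1)
    | beyond j y => exact separated_kruskal_beyond ε x j y
    | _ => simp only [h0, h1, h1'] at hl; linarith
  | singular δ t =>
    cases m' with
    | singular δ' t' =>
      exact separated_of_param_ne (i := .singular δ) (j := .singular δ')
        (fun a ha b hb => singular_param_ne (fun e => hi (congrArg Patch.singular e)) ha hb) rfl rfl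
    | kruskal ε x => have := hk ε x; rw [h0] at hl; linarith
    | beyond j y => have := hb j y; rw [h0] at hl; linarith
    | _ => simp only [h0, h1, h1'] at hl; linarith
  | scriU i u =>
    cases m' with
    | scriU j v =>
      exact separated_of_param_ne (i := .scriU i) (j := .scriU j)
        (fun a _ b _ => scriU_param_ne (fun e => hi (congrArg Patch.scriU e)) a b) rfl rfl
    | scriV j v => exact separated_scriU_scriV i j u v
    | kruskal ε x => have := hk ε x; rw [h1] at hl; linarith
    | beyond j y => have := hb j y; rw [h1] at hl; linarith
    | _ => simp only [h0, h1] at hl; linarith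
  | scriV i u =>
    cases m' with
    | scriV j v =>
      exact separated_of_param_ne (i := .scriV i) (j := .scriV j)
        (fun a _ b _ => scriV_param_ne (fun e => hi (congrArg Patch.scriV e)) a b) rfl rfl
    | scriU j v => exact (separated_scriU_scriV j i v u).symm
    | kruskal ε x => have := hk ε x; rw [h1'] at hl; linarith
    | beyond j y => have := hb j y; rw [h1'] at hl; linarith
    | _ => simp only [h0, h1'] at hl; linarith
  | beyond i y =>
    have := hb i y
    cases m' with
    | kruskal ε x => exact (separated_kruskal_beyond ε x i y).symm
    | beyond j y' =>
      exact separated_of_param_ne (i := .scriU i) (j := .scriU j)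
        (fun a _ b _ => scriU_param_ne (fun e => hi (congrArg Patch.scriU e)) a b) rfl rfl
    | _ => simp only [h0, h1, h1'] at hl; linarith

theorem t2Space_surface : T2Space Surface :=
  t2Space_iff_disjoint_nhds.2 fun m m' hne => by
    have h : SeparatedNhds ({m} : Set Surface) ({m'} : Set Surface) := separated_of_ne m m' hne
    simpa only [separatedNhds_iff_disjoint, nhdsSet_singleton] using h

theorem secondCountableTopology_surface : SecondCountableTopology Surface := by
  let f : Unit ⊕ ℤˣ ⊕ ℤˣ ⊕ (ℤˣ × ℤˣ) ⊕ (ℤˣ × ℤˣ) → Patch := fun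
    | .inl _ => .string
    | .inr (.inl ε) => .kruskal ε
    | .inr (.inr (.inl δ)) => .singular δ
    | .inr (.inr (.inr (.inl i))) => .scriU i
    | .inr (.inr (.inr (.inr i))) => .scriV i
  have hf : Function.Surjective f := fun i => by
    cases i with
    | string => exact ⟨.inl (), rfl⟩
    | kruskal ε => exact ⟨.inr (.inl ε), rfl⟩
    | singular δ => exact ⟨.inr (.inr (.inl δ)), rfl⟩
    | scriU i => exact ⟨.inr (.inr (.inr (.inl i))), rfl⟩
    | scriV i => exact ⟨.inr (.inr (.inr (.inr i))), rfl⟩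
  have : Countable Patch := hf.countable
  exact gluing.secondCountable

/-! ### Conservation laws and symmetries -/

theorem fderiv_eq_zero_of_curve {h : (ℝ × ℝ) × (ℝ × ℝ) → ℝ} {c : ℝ → (ℝ × ℝ) × (ℝ × ℝ)}
    {k : (ℝ × ℝ) × (ℝ × ℝ)} (hd : DifferentiableAt ℝ h (c 0)) (hc : HasDerivAt c k 0)
    (h' : ∀ t, h (c t) = h (c 0)) : fderiv ℝ h (c 0) k = 0 := by
  have h₁ := HasFDerivAt.comp_hasDerivAt 0 hd.hasFDerivAt hc
  have h₂ : h ∘ c = fun _ => h (c 0) := funext h'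
  rw [h₂] at h₁
  exact h₁.unique (hasDerivAt_const _ _)

theorem fderiv_hamVF_self (h : (ℝ × ℝ) × (ℝ × ℝ) → ℝ) (w : (ℝ × ℝ) × (ℝ × ℝ)) :
    fderiv ℝ h w (hamVF h w) = 0 := by
  rw [fderiv_eq_hamVF, sub_self]

theorem hamVF_snd_fst_eq_zero {h : (ℝ × ℝ) × (ℝ × ℝ) → ℝ} {x ξ : ℝ × ℝ}
    (hd : DifferentiableAt ℝ h (x, ξ)) (hh : ∀ t, h ((x.1 + t, x.2), ξ) = h (x, ξ)) :
    (hamVF h (x, ξ)).2.1 = 0 := by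
  have hc : HasDerivAt (fun t : ℝ => ((x.1 + t, x.2), ξ)) (((1, 0), 0) : (ℝ × ℝ) × (ℝ × ℝ)) 0 :=
    (((hasDerivAt_id (0 : ℝ)).const_add x.1).prodMk (hasDerivAt_const _ _)).prodMk
      (hasDerivAt_const _ _)
  have e : ((x.1 + 0, x.2), ξ) = (x, ξ) := by simp
  have := fderiv_eq_zero_of_curve (h := h) (by simpa only [e] using hd) hc
    (fun t => by simp only [e, hh])
  simp only [e] at this
  simp [hamVF, this]

theorem kruskalHam_boost {a : ℝ} (ha : a ≠ 0) {x : ℝ × ℝ} (hx : x ∈ kruskalDomain) (ξ : ℝ × ℝ) :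
    metricHam kruskalMetric (a * x.1, a⁻¹ * x.2) (a⁻¹ * ξ.1, a * ξ.2) =
      metricHam kruskalMetric x ξ := by
  have e : a * x.1 * (a⁻¹ * x.2) = x.1 * x.2 := by field_simp
  have hx' : (a * x.1, a⁻¹ * x.2) ∈ kruskalDomain := by
    rw [mem_kruskalDomain] at hx ⊢
    rwa [e]
  rw [metricHam, metricHam, geodesicHamiltonian_kruskalMetric hx',
    geodesicHamiltonian_kruskalMetric hx]
  simp only [e]
  field_simp

/-- Noether's theorem: the boosts are the Hamiltonian flow of `2E` and preserve `H`, so the Poisson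
bracket of `H` and `E` vanishes; it is antisymmetric, hence `E` is conserved along the flow of `H`.
-/
theorem fderiv_kruskalEnergy_hamVF {x : ℝ × ℝ} (hx : x ∈ kruskalDomain) (ξ : ℝ × ℝ) :
    fderiv ℝ (Function.uncurry kruskalEnergy) (x, ξ)
      (hamVF (Function.uncurry (metricHam kruskalMetric)) (x, ξ)) = 0 := by
  have hd := (contDiffAt_ham (.kruskal 1) x hx ξ).differentiableAt (by simp)
  have hc : HasDerivAt (fun t : ℝ => ((Real.exp t * x.1, (Real.exp t)⁻¹ * x.2),
      ((Real.exp t)⁻¹ * ξ.1, Real.exp t * ξ.2))) ((x.1, -x.2), (-ξ.1, ξ.2)) 0 := by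
    have h₁ : HasDerivAt Real.exp 1 0 := by simpa using Real.hasDerivAt_exp 0
    have h₂ : HasDerivAt (fun t => (Real.exp t)⁻¹) (-1) 0 := by
      simpa using h₁.fun_inv (Real.exp_pos 0).ne'
    convert! ((h₁.mul_const x.1).prodMk (h₂.mul_const x.2)).prodMk
      ((h₂.mul_const ξ.1).prodMk (h₁.mul_const ξ.2)) using 1
    simp
  have e : (((Real.exp 0 * x.1, (Real.exp 0)⁻¹ * x.2), ((Real.exp 0)⁻¹ * ξ.1, Real.exp 0 * ξ.2)) :
      (ℝ × ℝ) × (ℝ × ℝ)) = (x, ξ) := by simp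
  have h₀ := fderiv_eq_zero_of_curve (h := Function.uncurry (metricHam kruskalMetric))
    (by rw [e]; exact hd) hc (fun t => by
      rw [e]; exact kruskalHam_boost (Real.exp_pos t).ne' hx ξ)
  rw [e, fderiv_eq_hamVF] at h₀
  have h₁ : HasFDerivAt (fun w : (ℝ × ℝ) × (ℝ × ℝ) => w.1)
      (ContinuousLinearMap.fst ℝ (ℝ × ℝ) (ℝ × ℝ)) (x, ξ) := hasFDerivAt_fst
  have h₂ : HasFDerivAt (fun w : (ℝ × ℝ) × (ℝ × ℝ) => w.2)
      (ContinuousLinearMap.snd ℝ (ℝ × ℝ) (ℝ × ℝ)) (x, ξ) := hasFDerivAt_snd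
  have hE : HasFDerivAt (Function.uncurry kruskalEnergy) _ (x, ξ) :=
    ((h₁.fst.mul h₂.fst).sub (h₁.snd.mul h₂.snd)).mul_const (2⁻¹ : ℝ)
  rw [hE.fderiv]
  simp only [planeForm_apply] at h₀
  simp
  linarith

theorem bracket_energy (i : Patch) (x : ℝ × ℝ) (hx : x ∈ i.dom) (ξ : ℝ × ℝ) :
    fderiv ℝ (Function.uncurry i.energy) (x, ξ) (hamVF (Function.uncurry i.ham) (x, ξ)) = 0 := by
  have hd := (contDiffAt_ham i x hx ξ).differentiableAt (by simp)
  have h₁ : fderiv ℝ (Function.uncurry fun _ ξ : ℝ × ℝ => ξ.1) (x, ξ) =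
      (ContinuousLinearMap.fst ℝ ℝ ℝ).comp (ContinuousLinearMap.snd ℝ (ℝ × ℝ) (ℝ × ℝ)) :=
    ((ContinuousLinearMap.fst ℝ ℝ ℝ).comp (ContinuousLinearMap.snd ℝ (ℝ × ℝ) (ℝ × ℝ))).fderiv
  have h₂ : fderiv ℝ (Function.uncurry fun _ ξ : ℝ × ℝ => -ξ.1) (x, ξ) =
      -(ContinuousLinearMap.fst ℝ ℝ ℝ).comp (ContinuousLinearMap.snd ℝ (ℝ × ℝ) (ℝ × ℝ)) :=
    (-(ContinuousLinearMap.fst ℝ ℝ ℝ).comp (ContinuousLinearMap.snd ℝ (ℝ × ℝ) (ℝ × ℝ))).fderiv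
  cases i with
  | kruskal ε => exact fderiv_kruskalEnergy_hamVF hx ξ
  | scriV i =>
    have h₃ := hamVF_snd_fst_eq_zero hd (fun _ => rfl)
    simp only [Patch.energy, h₂]
    simp [h₃]
  | _ =>
    have h₃ := hamVF_snd_fst_eq_zero hd (fun _ => rfl)
    simp only [Patch.energy, h₁]
    simp [h₃]

/-- The linear part of `affineLift`. -/
def linearLift (a : ℝ) : ((ℝ × ℝ) × (ℝ × ℝ)) →L[ℝ] ((ℝ × ℝ) × (ℝ × ℝ)) :=
  (planeMap a 0 0 a⁻¹).prodMap (planeMap a⁻¹ 0 0 a)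

/-- The lift of the map `(x₁, x₂) ↦ (a x₁ + c, x₂ / a)` to the cotangent bundle. -/
def affineLift (a c : ℝ) (w : (ℝ × ℝ) × (ℝ × ℝ)) : (ℝ × ℝ) × (ℝ × ℝ) :=
  linearLift a w + ((c, 0), 0)

theorem affineLift_apply (a c : ℝ) (w : (ℝ × ℝ) × (ℝ × ℝ)) : affineLift a c w =
    ((a * w.1.1 + c, a⁻¹ * w.1.2), (a⁻¹ * w.2.1, a * w.2.2)) := by
  ext <;> simp [affineLift, linearLift]

/-- The lift of a symmetry is symplectic, so it carries the Hamiltonian vector field to itself. The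
case `a = 1` gives the translations of `t`, `u`, `v`, the case `c = 0` the boosts of the `(p, q)`
plane. -/
theorem hamVF_affineLift {h : (ℝ × ℝ) × (ℝ × ℝ) → ℝ} {a c : ℝ} {w : (ℝ × ℝ) × (ℝ × ℝ)}
    (ha : a ≠ 0) (hh : ∀ᶠ w' in 𝓝 w, h (affineLift a c w') = h w')
    (hd : DifferentiableAt ℝ h (affineLift a c w)) :
    hamVF h (affineLift a c w) = linearLift a (hamVF h w) := by
  have h₁ : HasFDerivAt (affineLift a c) (linearLift a) w :=
    (linearLift a).hasFDerivAt.add_const _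
  have h₂ : fderiv ℝ h w = (fderiv ℝ h (affineLift a c w)).comp (linearLift a) := by
    refine HasFDerivAt.fderiv ((hd.hasFDerivAt.comp w h₁).congr_of_eventuallyEq ?_)
    filter_upwards [hh] with w' hw' using hw'.symm
  have e₁ : linearLift a (0, (1, 0)) = a⁻¹ • (0, (1, 0)) := by simp [linearLift]
  have e₂ : linearLift a (0, (0, 1)) = a • (0, (0, 1)) := by simp [linearLift]
  have e₃ : linearLift a ((1, 0), 0) = a • ((1, 0), 0) := by simp [linearLift]
  have e₄ : linearLift a ((0, 1), 0) = a⁻¹ • ((0, 1), 0) := by simp [linearLift]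
  have h₃ : hamVF h w =
      ((a⁻¹ * (hamVF h (affineLift a c w)).1.1, a * (hamVF h (affineLift a c w)).1.2),
        (a * (hamVF h (affineLift a c w)).2.1, a⁻¹ * (hamVF h (affineLift a c w)).2.2)) := by
    simp only [hamVF, h₂, ContinuousLinearMap.comp_apply, e₁, e₂, e₃, e₄, map_smul, smul_eq_mul,
      mul_neg]
  rw [h₃]
  ext <;> simp [linearLift, ha]

/-- There is an integral curve of the Hamiltonian flow of `h` in `U`, for times up to `ε`. -/
def HasFlowFor (h : (ℝ × ℝ) × (ℝ × ℝ) → ℝ) (U : Set (ℝ × ℝ)) (ε : ℝ) (w₀ : (ℝ × ℝ) × (ℝ × ℝ)) :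
    Prop :=
  ∃ w : ℝ → (ℝ × ℝ) × (ℝ × ℝ), w 0 = w₀ ∧
    ∀ τ ∈ Set.Ioo (-ε) ε, (w τ).1 ∈ U ∧ HasDerivAt w (hamVF h (w τ)) τ

section

variable {h : (ℝ × ℝ) × (ℝ × ℝ) → ℝ} {U : Set (ℝ × ℝ)} {ε : ℝ} {w₀ : (ℝ × ℝ) × (ℝ × ℝ)}

theorem HasFlowFor.mono {ε' : ℝ} (H : HasFlowFor h U ε w₀) (hε : ε' ≤ ε) :
    HasFlowFor h U ε' w₀ := by
  obtain ⟨w, hw, H⟩ := H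
  exact ⟨w, hw, fun τ hτ => H τ ⟨by linarith [hτ.1], by linarith [hτ.2]⟩⟩

theorem exists_hasFlowFor (hU : IsOpen U) (hh : ∀ x ∈ U, ∀ ξ, ContDiffAt ℝ ω h (x, ξ))
    {K : Set ((ℝ × ℝ) × (ℝ × ℝ))} (hK : IsCompact K) (hKU : ∀ w ∈ K, w.1 ∈ U) :
    ∃ ε > 0, ∀ w ∈ K, HasFlowFor h U ε w :=
  exists_uniform_time (hU.preimage continuous_fst)
    (fun w hw => contDiffAt_hamVF (hh w.1 hw w.2)) hK hKU

/-- By this an existence time found on a compact set of normalized covectors is valid on all their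
translates, that is, on a noncompact part of a level set. -/
theorem HasFlowFor.affineLift (hU : IsOpen U) (hh : ∀ x ∈ U, ∀ ξ, ContDiffAt ℝ ω h (x, ξ))
    {a c : ℝ} (ha : a ≠ 0) (hinv : ∀ w, w.1 ∈ U → h (affineLift a c w) = h w)
    (hUU : ∀ w, w.1 ∈ U → (affineLift a c w).1 ∈ U) (H : HasFlowFor h U ε w₀) :
    HasFlowFor h U ε (affineLift a c w₀) := by
  obtain ⟨w, hw, H⟩ := H
  refine ⟨fun τ => SchwarzschildString.affineLift a c (w τ), by simp only [hw], fun τ hτ => ?_⟩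
  obtain ⟨h₁, h₂⟩ := H τ hτ
  refine ⟨hUU _ h₁, ?_⟩
  rw [hamVF_affineLift ha]
  · exact ((linearLift a).hasFDerivAt.comp_hasDerivAt τ h₂).add_const _
  · filter_upwards [(hU.preimage continuous_fst).mem_nhds h₁] with w' hw' using hinv w' hw'
  · exact (hh _ (hUU _ h₁) _).differentiableAt (by simp)

theorem AnalyticGluing.exists_isFlowAt {M ι : Type} {G : AnalyticGluing M ι}
    {F : ι → ℝ × ℝ → ℝ × ℝ → ℝ} {i : ι} {x ξ : ℝ × ℝ}
    (H : HasFlowFor (Function.uncurry (F i)) (G.dom i) ε (x, ξ)) :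
    ∃ γ, γ 0 = covectorAt (G.chart i) x ξ ∧ ∀ s ∈ Set.Ioo (-ε) ε, G.IsFlowAt F γ s := by
  obtain ⟨w, hw, H⟩ := H
  refine ⟨fun τ => covectorAt (G.chart i) (w τ).1 (w τ).2, by simp only [hw], fun s hs => ⟨i, w, ?_⟩⟩
  filter_upwards [isOpen_Ioo.mem_nhds hs] with τ hτ
  exact ⟨(H τ hτ).1, rfl, (H τ hτ).2⟩

end

/-! ### Uniform existence times for timelike geodesics -/

/-- With energy `T = e` the equation `H = h` reads `(x² - 1)²X² = 4x⁶e² + 8h(1 - x²)`, and `(x² -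
1)² ≥ 9/16` for `|x| ≤ 1/2`. So `X` is bounded by a constant depending on `e` and `h`, and `t` is
translated to `0`. -/
theorem exists_time_singular (h e : ℝ) : ∃ ε > 0, ∀ y ξ : ℝ × ℝ, |y.2| ≤ 1 / 2 →
    ξ.1 = e → singularHamiltonian y ξ = h →
    HasFlowFor (Function.uncurry singularHamiltonian) singularDomain ε (y, ξ) := by
  set C := 8 * e ^ 2 + 16 * |h| + 1 with hC
  have hdom {y : ℝ × ℝ} (hy : |y.2| ≤ 1 / 2) : y ∈ singularDomain := by
    rw [abs_le] at hy
    constructor <;> linarith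
  have hopen : IsOpen singularDomain := Patch.isOpen_dom (.singular 1)
  have hsm : ∀ x ∈ singularDomain, ∀ ξ,
      ContDiffAt ℝ ω (Function.uncurry singularHamiltonian) (x, ξ) := contDiffAt_ham (.singular 1)
  have hK : IsCompact (((({0} : Set ℝ) ×ˢ Set.Icc (-(1 / 2)) (1 / 2)) ×ˢ
      (({e} : Set ℝ) ×ˢ Set.Icc (-C) C)) : Set ((ℝ × ℝ) × (ℝ × ℝ))) :=
    (isCompact_singleton.prod isCompact_Icc).prod (isCompact_singleton.prod isCompact_Icc)
  obtain ⟨ε, hε, H⟩ := exists_hasFlowFor hopen hsm hK (fun w hw => hdom (abs_le.2 hw.1.2))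
  refine ⟨ε, hε, fun y ξ hy hξ hh => ?_⟩
  have hX : |ξ.2| ≤ C := by
    rw [singularHamiltonian, hξ, div_eq_iff (by have := hdom hy; nlinarith [this.1, this.2])] at hh
    have h₁ : y.2 ^ 2 ≤ 1 / 4 := by
      rw [← sq_abs]; nlinarith [abs_nonneg y.2]
    have h₂ : y.2 ^ 6 ≤ 1 := by
      have : y.2 ^ 6 = (y.2 ^ 2) ^ 3 := by ring
      rw [this]
      exact pow_le_one₀ (sq_nonneg _) (by linarith)
    have h₃ : (y.2 ^ 2 - 1) ^ 2 * ξ.2 ^ 2 ≤ 4 * e ^ 2 + 8 * |h| := by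
      have e₁ : (y.2 ^ 2 - 1) ^ 2 * ξ.2 ^ 2 = 4 * y.2 ^ 6 * e ^ 2 + h * (8 * (1 - y.2 ^ 2)) := by
        linarith
      have h₄ : y.2 ^ 6 * e ^ 2 ≤ 1 * e ^ 2 := by gcongr
      have h₅ : h * (1 - y.2 ^ 2) ≤ |h| * 1 := by
        have := le_abs_self h
        have h₆ : 0 ≤ 1 - y.2 ^ 2 := by linarith
        have h₇ : 1 - y.2 ^ 2 ≤ 1 := by linarith [sq_nonneg y.2]
        calc h * (1 - y.2 ^ 2) ≤ |h| * (1 - y.2 ^ 2) := by gcongr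
          _ ≤ |h| * 1 := by gcongr
      linarith
    have h₄ : 9 / 16 ≤ (y.2 ^ 2 - 1) ^ 2 := by nlinarith
    have h₅ : 9 / 16 * ξ.2 ^ 2 ≤ (y.2 ^ 2 - 1) ^ 2 * ξ.2 ^ 2 := by gcongr
    have h₆ : |ξ.2| ≤ |ξ.2| ^ 2 + 1 := by nlinarith [sq_nonneg (|ξ.2| - 1)]
    rw [sq_abs] at h₆
    linarith [abs_nonneg h, sq_nonneg e]
  have hmem : (((0, y.2), ξ) : (ℝ × ℝ) × (ℝ × ℝ)) ∈ ((({0} : Set ℝ) ×ˢ Set.Icc (-(1 / 2)) (1 / 2)) ×ˢ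
      (({e} : Set ℝ) ×ˢ Set.Icc (-C) C)) := ⟨⟨rfl, abs_le.1 hy⟩, ⟨hξ, abs_le.1 hX⟩⟩
  have := (H _ hmem).affineLift hopen hsm (c := y.1) one_ne_zero
    (fun w _ => by simp [affineLift_apply, singularHamiltonian, Function.uncurry])
    (fun w hw => by simpa [affineLift_apply, singularDomain] using hw)
  simpa [affineLift_apply] using this

/-- With `f = s²(1 - s)`, the identity `(e - fS)² = e² - 2hf` bounds `f`, hence `s` from below, and
`S(e + (e - fS)) = 2h` bounds `S`. The sign hypothesis says that `ds/dτ = e - fS` does not oppose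
`e`, so the two terms in the bracket cannot cancel. -/
theorem exists_time_eddington {h : ℝ} (e : ℝ) (hh : 0 < h) : ∃ ε > 0, ∀ x ξ : ℝ × ℝ,
    x.2 ≤ 1 / 2 → ξ.1 = e → 0 ≤ (ξ.1 - x.2 ^ 2 * (1 - x.2) * ξ.2) * ξ.1 →
    metricHam eddingtonMetric x ξ = h →
    HasFlowFor (Function.uncurry (metricHam eddingtonMetric)) Set.univ ε (x, ξ) := by
  set C := e ^ 2 / (2 * h) + 1 with hC
  set D := 2 * h / |e| with hD
  have hsm : ∀ x ∈ (Set.univ : Set (ℝ × ℝ)), ∀ ξ,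
      ContDiffAt ℝ ω (Function.uncurry (metricHam eddingtonMetric)) (x, ξ) :=
    contDiffAt_ham (.scriU 1)
  have hK : IsCompact (((({0} : Set ℝ) ×ˢ Set.Icc (-C) (1 / 2)) ×ˢ
      (({e} : Set ℝ) ×ˢ Set.Icc (-D) D)) : Set ((ℝ × ℝ) × (ℝ × ℝ))) :=
    (isCompact_singleton.prod isCompact_Icc).prod (isCompact_singleton.prod isCompact_Icc)
  obtain ⟨ε, hε, H⟩ := exists_hasFlowFor isOpen_univ hsm hK (fun w hw => trivial)
  refine ⟨ε, hε, fun x ξ hx hξ hg hham => ?_⟩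
  rw [metricHam, geodesicHamiltonian_eddingtonMetric] at hham
  have hf : 0 ≤ x.2 ^ 2 * (1 - x.2) := mul_nonneg (sq_nonneg _) (by linarith)
  set f := x.2 ^ 2 * (1 - x.2) with hf'
  rw [hξ] at hg hham
  -- For `e = 0` the Hamiltonian would be `-fS²/2 ≤ 0`.
  have he : e ≠ 0 := by
    rintro rfl
    have : 0 ≤ f * ξ.2 ^ 2 := by positivity
    linarith
  have hfle : f ≤ e ^ 2 / (2 * h) := by
    rw [le_div_iff₀ (by positivity)]
    nlinarith [sq_nonneg (e - f * ξ.2)]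
  have hs : -C ≤ x.2 := by
    by_contra! hlt
    have h₁ : 0 ≤ e ^ 2 / (2 * h) := by positivity
    have h₂ : x.2 < -1 := by linarith
    have h₃ : -x.2 ≤ f := by
      have : 1 ≤ (-x.2) * (1 - x.2) := by nlinarith
      rw [hf']
      nlinarith
    linarith
  have hξs : |ξ.2| ≤ D := by
    rw [hD, le_div_iff₀ (abs_pos.2 he)]
    have h₁ : |ξ.2| * |e + (e - f * ξ.2)| = 2 * h := by
      rw [← abs_mul, ← abs_of_pos (show 0 < 2 * h by positivity)]
      congr 1
      linarith
    have h₂ : |e| ≤ |e + (e - f * ξ.2)| := by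
      rw [← sq_le_sq]
      nlinarith [sq_nonneg (e - f * ξ.2)]
    rw [← h₁]
    gcongr
  have hmem : (((0, x.2), ξ) : (ℝ × ℝ) × (ℝ × ℝ)) ∈ ((({0} : Set ℝ) ×ˢ Set.Icc (-C) (1 / 2)) ×ˢ
      (({e} : Set ℝ) ×ˢ Set.Icc (-D) D)) := ⟨⟨rfl, hs, hx⟩, ⟨hξ, abs_le.1 hξs⟩⟩
  have := (H _ hmem).affineLift isOpen_univ hsm (c := x.1) one_ne_zero
    (fun w _ => by simp [affineLift_apply, Function.uncurry, metricHam,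
      geodesicHamiltonian_eddingtonMetric]) (fun w hw => trivial)
  simpa [affineLift_apply] using this

theorem mem_Icc_of_sq_add_one_le {y D : ℝ} (h : y ^ 2 + 1 ≤ D) : y ∈ Set.Icc (-D) D := by
  have h₁ : 0 ≤ (y + 1) ^ 2 + y ^ 2 := by positivity
  have h₂ : 0 ≤ (y - 1) ^ 2 + y ^ 2 := by positivity
  exact ⟨by linarith, by linarith⟩

/-- A boost normalizes the covector to `(η, -η)`. Then `η² = -ξ₁ξ₂` lies between positive multiples
of `h`, so `(p + q)η = 2e` bounds `p + q`, and the lower bound on `pq` bounds `p² + q² = (p + q)² -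
2pq`. -/
theorem exists_time_kruskal {h : ℝ} (e : ℝ) (hh : 0 < h) : ∃ ε > 0, ∀ x ∈ kruskalDomain,
    ∀ ξ : ℝ × ℝ, -(3 / 4) ≤ lambertW (x.1 * x.2) → lambertW (x.1 * x.2) ≤ 1 →
    kruskalEnergy x ξ = e → metricHam kruskalMetric x ξ = h →
    HasFlowFor (Function.uncurry (metricHam kruskalMetric)) kruskalDomain ε (x, ξ) := by
  set B := 48 * e ^ 2 / h + 7 with hB
  set C := 512 * h + 1 with hC
  -- The value of `pq` at `W = -3/4`. The closed condition `pq ≥ m` keeps the compact set inside the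
  -- open domain `e pq > -1`.
  set m := (-(3 / 4) : ℝ) * Real.exp (-(3 / 4)) with hm
  have hsm : ∀ x ∈ kruskalDomain, ∀ ξ,
      ContDiffAt ℝ ω (Function.uncurry (metricHam kruskalMetric)) (x, ξ) :=
    contDiffAt_ham (.kruskal 1)
  have hK : IsCompact (((((Set.Icc (-B) B) ×ˢ (Set.Icc (-B) B)) ∩ {x | m ≤ x.1 * x.2}) ×ˢ
      (Set.Icc (-C) C ×ˢ Set.Icc (-C) C)) : Set ((ℝ × ℝ) × (ℝ × ℝ))) := by
    refine (IsCompact.inter_right (isCompact_Icc.prod isCompact_Icc) ?_).prod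
      (isCompact_Icc.prod isCompact_Icc)
    exact isClosed_le continuous_const (continuous_fst.mul continuous_snd)
  have hmdom {x : ℝ × ℝ} (hx : m ≤ x.1 * x.2) : x ∈ kruskalDomain := by
    rw [mem_kruskalDomain]
    have h₁ := neg_one_lt_exp_mul (w := -(3 / 4)) (by norm_num)
    rw [← hm] at h₁
    nlinarith [Real.exp_pos 1]
  obtain ⟨ε, hε, H⟩ := exists_hasFlowFor isOpen_kruskalDomain hsm hK (fun w hw => hmdom hw.1.2)
  refine ⟨ε, hε, fun x hx ξ hW₁ hW₂ hE hham => ?_⟩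
  rw [metricHam, geodesicHamiltonian_kruskalMetric hx] at hham
  obtain ⟨-, hWe⟩ := lambertW_spec (mem_kruskalDomain.1 hx)
  set W := lambertW (x.1 * x.2) with hW
  have he3 : Real.exp 1 < 3 := by linarith [Real.exp_one_lt_d9]
  have hexp₁ : Real.exp W < 3 := (Real.exp_le_exp.2 hW₂).trans_lt he3
  have hexp₂ : 1 / 4 ≤ Real.exp W := by linarith [Real.add_one_le_exp W]
  -- From `W ∈ [-3/4, 1]`: `1/4 ≤ e^W < 3` and `1/4 ≤ 1 + W ≤ 2`, so `k` lies between `(1/4)(1/4)³/2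
  -- = 1/512` and `3·2³/2 = 12`. The constants `B` and `C` come from `h/12 ≤ η² ≤ 512h` and `pq ≥
  -- -3`.
  have hk₁ : 1 / 512 ≤ Real.exp W * (1 + W) ^ 3 / 2 := by
    have : (1 / 4 : ℝ) ^ 3 ≤ (1 + W) ^ 3 := by gcongr; linarith
    nlinarith
  have hk₂ : Real.exp W * (1 + W) ^ 3 / 2 ≤ 12 := by
    have h₁ : (1 + W) ^ 3 ≤ 2 ^ 3 := pow_le_pow_left₀ (by linarith) (by linarith) 3
    have h₂ : 0 ≤ (1 + W) ^ 3 := pow_nonneg (by linarith) 3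
    nlinarith
  set k := Real.exp W * (1 + W) ^ 3 / 2 with hk
  have hneg : 0 < -(ξ.1 * ξ.2) := by
    by_contra! hle
    nlinarith
  have hn₁ : -(ξ.1 * ξ.2) ≤ 512 * h := by nlinarith
  have hn₂ : h ≤ 12 * -(ξ.1 * ξ.2) := by nlinarith
  have hmul : m ≤ x.1 * x.2 := by
    rw [← hWe]
    exact strictMonoOn_mul_exp.monotoneOn (Set.mem_Ici.2 (by norm_num))
      (Set.mem_Ici.2 (by linarith)) hW₁
  have hpq₁ : -3 ≤ x.1 * x.2 := by rw [← hWe]; nlinarith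
  have hξ₁ : ξ.1 ≠ 0 := by rintro h; simp [h] at hneg
  have hξ₂ : ξ.2 ≠ 0 := by rintro h; simp [h] at hneg
  have hratio : 0 < -(ξ.2 / ξ.1) := by
    have : -(ξ.2 / ξ.1) = -(ξ.1 * ξ.2) / ξ.1 ^ 2 := by field_simp
    rw [this]
    positivity
  -- The boost parameter is fixed by requiring `aξ₁ = -ξ₂/a`; the ratio is negative because the
  -- covector is timelike.
  obtain ⟨a, ha, ha₂⟩ : ∃ a : ℝ, 0 < a ∧ a ^ 2 = -(ξ.2 / ξ.1) :=
    ⟨√(-(ξ.2 / ξ.1)), Real.sqrt_pos.2 hratio, Real.sq_sqrt hratio.le⟩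
  have ha₃ : a ^ 2 * ξ.1 = -ξ.2 := by rw [ha₂]; field_simp
  obtain ⟨p, hp⟩ : ∃ p, p = a⁻¹ * x.1 := ⟨_, rfl⟩
  obtain ⟨q, hq⟩ : ∃ q, q = a * x.2 := ⟨_, rfl⟩
  obtain ⟨η, hη⟩ : ∃ η, η = a * ξ.1 := ⟨_, rfl⟩
  have hpq : p * q = x.1 * x.2 := by rw [hp, hq]; field_simp
  have hη' : a⁻¹ * ξ.2 = -η := by
    rw [hη]
    field_simp
    linarith
  have hηsq : η ^ 2 = -(ξ.1 * ξ.2) := by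
    rw [hη]
    linear_combination ξ.1 * ha₃
  have hsum : (p + q) * η = 2 * e := by
    rw [← hE, kruskalEnergy, hp, hq, hη]
    field_simp
    linear_combination x.2 * ha₃
  have hsumsq : (p + q) ^ 2 ≤ 48 * e ^ 2 / h := by
    rw [le_div_iff₀ hh]
    have h₁ : (p + q) ^ 2 * η ^ 2 = 4 * e ^ 2 := by rw [← mul_pow, hsum]; ring
    nlinarith [sq_nonneg (p + q)]
  have hsq : p ^ 2 + q ^ 2 ≤ 48 * e ^ 2 / h + 6 := by
    have : p ^ 2 + q ^ 2 = (p + q) ^ 2 - 2 * (p * q) := by ring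
    linarith
  have hmem : (((p, q), (η, -η)) : (ℝ × ℝ) × (ℝ × ℝ)) ∈
      (((((Set.Icc (-B) B) ×ˢ (Set.Icc (-B) B)) ∩ {x | m ≤ x.1 * x.2}) ×ˢ
      (Set.Icc (-C) C ×ˢ Set.Icc (-C) C)) : Set ((ℝ × ℝ) × (ℝ × ℝ))) := by
    refine ⟨⟨⟨mem_Icc_of_sq_add_one_le ?_, mem_Icc_of_sq_add_one_le ?_⟩, ?_⟩, ⟨mem_Icc_of_sq_add_one_le ?_, mem_Icc_of_sq_add_one_le ?_⟩⟩
    · change p ^ 2 + 1 ≤ _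
      linarith [sq_nonneg q]
    · change q ^ 2 + 1 ≤ _
      linarith [sq_nonneg p]
    · change m ≤ p * q
      rwa [hpq]
    · change η ^ 2 + 1 ≤ _
      linarith
    · change (-η) ^ 2 + 1 ≤ _
      rw [neg_sq]
      linarith
  have := (H _ hmem).affineLift isOpen_kruskalDomain hsm (a := a) (c := 0) ha.ne'
    (fun w hw => by
      rw [affineLift_apply, add_zero]
      exact kruskalHam_boost ha.ne' hw w.2)
    (fun w hw => by
      have e : a * w.1.1 * (a⁻¹ * w.1.2) = w.1.1 * w.1.2 := by field_simp
      rw [affineLift_apply, mem_kruskalDomain]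
      simpa only [add_zero, e] using mem_kruskalDomain.1 hw)
  have e₁ : affineLift a 0 ((p, q), (η, -η)) = (x, ξ) := by
    rw [affineLift_apply, ← hη', hp, hq, hη]
    ext <;> simp <;> field_simp
  rwa [e₁] at this

/-! ### Changes between the patches -/

theorem exists_eq_sgn_mul_abs {a : ℝ} : ∃ δ, sgn δ * |a| = a := by
  rcases le_total 0 a with h | h
  · exact ⟨1, by simp [sgn, abs_of_nonneg h]⟩
  · exact ⟨-1, by simp [sgn, abs_of_nonpos h]⟩

theorem exists_kruskalOfU {x : ℝ × ℝ} (hx : x ∈ kruskalDomain) (hp : x.1 ≠ 0) :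
    ∃ δ u, kruskalOfU δ (u, 1 / (1 + lambertW (x.1 * x.2))) = x := by
  obtain ⟨h₁, h₂⟩ := lambertW_spec (mem_kruskalDomain.1 hx)
  obtain ⟨δ, hδ⟩ := exists_eq_sgn_mul_abs (a := x.1)
  refine ⟨δ, 2 * Real.log |x.1|, ?_⟩
  have hfst : (kruskalOfU δ (2 * Real.log |x.1|, 1 / (1 + lambertW (x.1 * x.2)))).1 = x.1 := by
    simp only [kruskalOfU]
    rw [mul_div_cancel_left₀ _ two_ne_zero, Real.exp_log (abs_pos.2 hp), hδ]
  refine Prod.ext hfst (mul_left_cancel₀ hp ?_)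
  have := kruskalOfU_mul δ (2 * Real.log |x.1|, 1 / (1 + lambertW (x.1 * x.2)))
  rw [hfst] at this
  rw [this]
  simp [h₂]

theorem exists_kruskalOfV {x : ℝ × ℝ} (hx : x ∈ kruskalDomain) (hq : x.2 ≠ 0) :
    ∃ δ v, kruskalOfV δ (v, 1 / (1 + lambertW (x.1 * x.2))) = x := by
  have hx' : x.swap ∈ kruskalDomain := by
    rw [mem_kruskalDomain] at hx ⊢
    rwa [Prod.fst_swap, Prod.snd_swap, mul_comm x.2]
  obtain ⟨δ, v, h⟩ := exists_kruskalOfU hx' hq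
  refine ⟨δ, v, ?_⟩
  rw [Prod.fst_swap, Prod.snd_swap, mul_comm x.2] at h
  rw [kruskalOfV_eq_swap, h, Prod.swap_swap]

theorem exists_kruskalOfSingular {x : ℝ × ℝ} (hx : x ∈ kruskalDomain)
    (hW : lambertW (x.1 * x.2) < 0) (ε : ℤˣ) :
    ∃ δ t, kruskalOfSingular δ (t, sgn ε * √(1 + lambertW (x.1 * x.2))) = x := by
  obtain ⟨h₁, h₂⟩ := lambertW_spec (mem_kruskalDomain.1 hx)
  set W := lambertW (x.1 * x.2) with hW'
  have hp : x.1 ≠ 0 := by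
    intro h
    rw [h, zero_mul] at h₂
    exact (mul_neg_of_neg_of_pos hW (Real.exp_pos W)).ne h₂
  have hsq : (sgn ε * √(1 + W)) ^ 2 = 1 + W := by
    rw [mul_pow, Real.sq_sqrt (by linarith), sq, sgn_mul_self, one_mul]
  obtain ⟨δ, hδ⟩ := exists_eq_sgn_mul_abs (a := x.1)
  have hroot : 0 < √(-W) := Real.sqrt_pos.2 (by linarith)
  set t := 2 * Real.log (|x.1| / √(-W)) - W with ht
  refine ⟨δ, t, ?_⟩
  have hfst : (kruskalOfSingular δ (t, sgn ε * √(1 + W))).1 = x.1 := by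
    simp only [kruskalOfSingular, hsq]
    have e₁ : (1 + W + t - 1) / 2 = Real.log (|x.1| / √(-W)) := by rw [ht]; ring
    have e₂ : 1 - (1 + W) = -W := by ring
    rw [e₁, e₂, Real.exp_log (div_pos (abs_pos.2 hp) hroot), div_mul_cancel₀ _ hroot.ne', hδ]
  have hmem : ((t, sgn ε * √(1 + W)) : ℝ × ℝ) ∈ singularDomain := by
    have : (sgn ε * √(1 + W)) ^ 2 < 1 := by rw [hsq]; linarith
    exact abs_lt.1 ((sq_lt_one_iff_abs_lt_one _).1 this)
  refine Prod.ext hfst (mul_left_cancel₀ hp ?_)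
  have := kruskalOfSingular_mul δ hmem
  rw [hfst] at this
  rw [this]
  simp only [hsq, add_sub_cancel_left, h₂]

/-- For `r > 1` the coordinates `p` and `q` have the same sign, so the `(u, s)` and `(v, s)` patches
with equal indices overlap there too, by the same formula as beyond scri. -/
theorem kruskalOfV_vOfU (δ : ℤˣ) {x : ℝ × ℝ} (h₀ : 0 < x.2) (h₁ : x.2 < 1) :
    kruskalOfV δ (vOfU x) = kruskalOfU δ x := by
  have hr : 0 < 1 / x.2 - 1 := by rw [sub_pos, one_lt_div h₀]; exact h₁
  have hfst : (kruskalOfV δ (vOfU x)).2 = (kruskalOfU δ x).2 := by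
    simp only [kruskalOfV, kruskalOfU, vOfU]
    have e : (-x.1 + 2 * (1 / x.2 - 1) + Real.log ((1 / x.2 - 1) ^ 2)) / 2 =
        -x.1 / 2 + (Real.log (1 / x.2 - 1) + (1 / x.2 - 1)) := by
      rw [Real.log_pow]
      push_cast
      ring
    rw [e, Real.exp_add, Real.exp_add, Real.exp_log hr, mul_assoc]
  refine Prod.ext ?_ hfst
  have hne : (kruskalOfU δ x).2 ≠ 0 := by
    have := sgn_ne_zero δ
    simp only [kruskalOfU]
    positivity
  refine mul_right_cancel₀ hne ?_
  rw [kruskalOfU_mul, ← hfst, kruskalOfV_mul, vOfU_snd]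

/-- Since the regions beyond scri are paired by the identity permutation, one index serves on both
sides of scri, and changing patches needs no distinction between `s < 0` and `0 < s < 1`. -/
theorem param_scriV_vOfU (i : ℤˣ × ℤˣ) {x : ℝ × ℝ} (h₀ : x.2 ≠ 0) (h₁ : x.2 < 1) :
    Patch.param (.scriU i) x = Patch.param (.scriV i) (vOfU x) := by
  rcases lt_or_gt_of_ne h₀ with h | h
  · rw [Patch.param_scriU_of_neg h, Patch.param_scriV_of_neg (by exact h), vOfU_vOfU]
  · rw [Patch.param_scriU_of_pos h, Patch.param_scriV_of_pos (by exact h), kruskalOfV_vOfU _ h h₁]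

theorem covectorAt_scriU_eq_scriV (i : ℤˣ × ℤˣ) {x : ℝ × ℝ} (h₀ : x.2 ≠ 0) (h₁ : x.2 < 1)
    (η : ℝ × ℝ) :
    covectorAt (gluing.chart (.scriU i)) x (-η.1, η.2 - 2 / (x.2 ^ 2 * (1 - x.2)) * η.1) =
      covectorAt (gluing.chart (.scriV i)) (vOfU x) η := by
  obtain ⟨T', hT, hpull⟩ := intertwines_vOfU h₀ h₁.ne
  have hcont : ContinuousAt (Prod.snd : ℝ × ℝ → ℝ) x := continuousAt_snd
  have htr : IsTransition (gluing.param (.scriU i)) (gluing.param (.scriV i)) vOfU T' x := by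
    refine ⟨hT.contDiffAt, hT.hasFDerivAt, ?_⟩
    filter_upwards [hcont.eventually (isOpen_ne.mem_nhds h₀),
      hcont.eventually (gt_mem_nhds h₁)] with y hy₀ hy₁
    exact param_scriV_vOfU i hy₀ hy₁
  rw [← hpull]
  exact gluing.covectorAt_transition (i := .scriU i) (j := .scriV i) trivial trivial htr η

/-- The coordinate `p` is a function of `u` alone, so `dp` is a multiple of `du`. -/
theorem covectorAt_scriU_eq_kruskal (ε δ : ℤˣ) {x : ℝ × ℝ} (hx : 0 < x.2) (a : ℝ) :
    ∃ b, covectorAt (gluing.chart (.scriU (ε, δ))) x (b, 0) =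
      covectorAt (gluing.chart (.kruskal ε)) (kruskalOfU δ x) (a, 0) := by
  obtain ⟨T', hT⟩ := intertwines_kruskalOfU δ hx
  have hcont : ContinuousAt (Prod.snd : ℝ × ℝ → ℝ) x := continuousAt_snd
  have htr : IsTransition (gluing.param (.scriU (ε, δ))) (gluing.param (.kruskal ε))
      (kruskalOfU δ) T' x := by
    refine ⟨hT.contDiffAt, hT.hasFDerivAt, ?_⟩
    filter_upwards [hcont.eventually (lt_mem_nhds hx)] with y hy
    exact Patch.param_scriU_of_pos hy
  have hline : HasDerivAt (fun s : ℝ => (x.1, s)) ((0, 1) : ℝ × ℝ) x.2 :=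
    (hasDerivAt_const _ _).prodMk (hasDerivAt_id _)
  have h₁ := HasFDerivAt.comp_hasDerivAt x.2 hT.hasFDerivAt.fst hline
  have h₂ : (T' (0, 1)).1 = 0 := h₁.unique (hasDerivAt_const _ (sgn δ * Real.exp (x.1 / 2)))
  refine ⟨(pullback T' (a, 0)).1, ?_⟩
  rw [← gluing.covectorAt_transition (i := .scriU (ε, δ)) (j := .kruskal ε) trivial
    (kruskalOfU_mem δ hx) htr]
  congr 1
  simp [pullback_apply, h₂]

theorem covectorAt_scriV_eq_kruskal (ε δ : ℤˣ) {x : ℝ × ℝ} (hx : 0 < x.2) (a : ℝ) :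
    ∃ b, covectorAt (gluing.chart (.scriV (ε, δ))) x (b, 0) =
      covectorAt (gluing.chart (.kruskal ε)) (kruskalOfV δ x) (0, a) := by
  obtain ⟨T', hT⟩ := intertwines_kruskalOfV δ hx
  have hcont : ContinuousAt (Prod.snd : ℝ × ℝ → ℝ) x := continuousAt_snd
  have htr : IsTransition (gluing.param (.scriV (ε, δ))) (gluing.param (.kruskal ε))
      (kruskalOfV δ) T' x := by
    refine ⟨hT.contDiffAt, hT.hasFDerivAt, ?_⟩
    filter_upwards [hcont.eventually (lt_mem_nhds hx)] with y hy
    exact Patch.param_scriV_of_pos hy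
  have hline : HasDerivAt (fun s : ℝ => (x.1, s)) ((0, 1) : ℝ × ℝ) x.2 :=
    (hasDerivAt_const _ _).prodMk (hasDerivAt_id _)
  have h₁ := HasFDerivAt.comp_hasDerivAt x.2 hT.hasFDerivAt.snd hline
  have h₂ : (T' (0, 1)).2 = 0 := h₁.unique (hasDerivAt_const _ (sgn δ * Real.exp (x.1 / 2)))
  refine ⟨(pullback T' (0, a)).1, ?_⟩
  rw [← gluing.covectorAt_transition (i := .scriV (ε, δ)) (j := .kruskal ε) trivial
    (kruskalOfV_mem δ hx) htr]
  congr 1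
  simp [pullback_apply, h₂]

/-! ### Timelike completeness -/

theorem exists_flow_of_timelike {z : CotangentBundle Surface} (hz : 0 < stringHam z) :
    ∃ γ, γ 0 = z ∧ ∀ s, gluing.IsFlowAt Patch.ham γ s := by
  obtain ⟨h, hh⟩ : ∃ h, h = stringHam z := ⟨_, rfl⟩
  obtain ⟨e, he⟩ : ∃ e, e = stringEnergy z := ⟨_, rfl⟩
  rw [← hh] at hz
  obtain ⟨ε₁, hε₁, H₁⟩ := exists_time_singular h e
  obtain ⟨ε₂, hε₂, H₂⟩ := exists_time_kruskal e hz
  obtain ⟨ε₃, hε₃, H₃⟩ := exists_time_eddington e hz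
  obtain ⟨ε₄, hε₄, H₄⟩ := exists_time_eddington (-e) hz
  set ε := min (min ε₁ ε₂) (min ε₃ ε₄) with hε
  have hle₁ : ε ≤ ε₁ := (min_le_left _ _).trans (min_le_left _ _)
  have hle₂ : ε ≤ ε₂ := (min_le_left _ _).trans (min_le_right _ _)
  have hle₃ : ε ≤ ε₃ := (min_le_right _ _).trans (min_le_left _ _)
  have hle₄ : ε ≤ ε₄ := (min_le_right _ _).trans (min_le_right _ _)
  have hscri (i : ℤˣ × ℤˣ) (x ξ : ℝ × ℝ) (hx : x.2 ≤ 1 / 2)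
      (hH : stringHam (covectorAt (gluing.chart (.scriU i)) x ξ) = h)
      (hE : stringEnergy (covectorAt (gluing.chart (.scriU i)) x ξ) = e) :
      ∃ γ, γ 0 = covectorAt (gluing.chart (.scriU i)) x ξ ∧
        ∀ s ∈ Set.Ioo (-ε) ε, gluing.IsFlowAt Patch.ham γ s := by
    -- If `ds/dτ` opposes the momentum of `u`, the `(v, s)` patch is used: there `ds/dτ` is the same
    -- and the first momentum is reversed. On scri itself `f = 0`, so the bad sign does not occur
    -- and the change of patch is defined.
    by_cases hg : 0 ≤ (ξ.1 - x.2 ^ 2 * (1 - x.2) * ξ.2) * ξ.1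
    · rw [stringHam_covectorAt (.scriU i) _ trivial] at hH
      rw [stringEnergy_covectorAt (.scriU i) _ trivial] at hE
      exact AnalyticGluing.exists_isFlowAt (G := gluing) (F := Patch.ham) (i := .scriU i)
        ((H₃ x ξ hx hE hg hH).mono hle₃)
    · have hs : x.2 ≠ 0 := by
        intro hs
        apply hg
        rw [hs]
        nlinarith [mul_self_nonneg ξ.1]
      have hf : x.2 ^ 2 * (1 - x.2) ≠ 0 :=
        mul_ne_zero (pow_ne_zero 2 hs) (by linarith)
      set η : ℝ × ℝ := (-ξ.1, ξ.2 - 2 / (x.2 ^ 2 * (1 - x.2)) * ξ.1) with hη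
      have hcov := covectorAt_scriU_eq_scriV i hs (by linarith) η
      have e₁ : ((-η.1, η.2 - 2 / (x.2 ^ 2 * (1 - x.2)) * η.1) : ℝ × ℝ) = ξ := by
        ext <;> simp [hη]
      rw [e₁] at hcov
      rw [hcov] at hH hE ⊢
      rw [stringHam_covectorAt (.scriV i) _ trivial] at hH
      rw [stringEnergy_covectorAt (.scriV i) _ trivial] at hE
      refine AnalyticGluing.exists_isFlowAt (G := gluing) (F := Patch.ham) (i := .scriV i)
        ((H₄ (vOfU x) η hx ?_ ?_ hH).mono hle₄)
      · rw [← hE]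
        simp [Patch.energy]
      · have e₂ : η.1 - x.2 ^ 2 * (1 - x.2) * η.2 = ξ.1 - x.2 ^ 2 * (1 - x.2) * ξ.2 := by
          have : x.2 ^ 2 * (1 - x.2) * (2 / (x.2 ^ 2 * (1 - x.2)) * ξ.1) = 2 * ξ.1 := by
            rw [← mul_assoc, mul_div_cancel₀ _ hf]
          simp only [hη]
          linarith
        rw [vOfU_snd, e₂]
        simp only [hη]
        linarith
  have hloc : ∀ z ∈ {z | stringHam z = h ∧ stringEnergy z = e}, ∃ γ, γ 0 = z ∧
      ∀ s ∈ Set.Ioo (-ε) ε, gluing.IsFlowAt Patch.ham γ s := by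
    rintro z ⟨hH, hE⟩
    have hhome {i : Patch} {x : ℝ × ℝ} (hx : x ∈ i.dom) (hp : z.proj = i.param x) :
        ∃ ξ, z = covectorAt (gluing.chart i) x ξ ∧ i.ham x ξ = h ∧ i.energy x ξ = e := by
      obtain ⟨ξ, hξ⟩ := gluing.exists_eq_covectorAt hx hp
      refine ⟨ξ, hξ, ?_, ?_⟩
      · rw [← hH, hξ, stringHam_covectorAt _ _ hx]
      · rw [← hE, hξ, stringEnergy_covectorAt _ _ hx]
    have hsing {δ : ℤˣ} {y : ℝ × ℝ} (hy : |y.2| ≤ 1 / 2)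
        (hp : z.proj = Patch.param (.singular δ) y) : ∃ γ, γ 0 = z ∧
          ∀ s ∈ Set.Ioo (-ε) ε, gluing.IsFlowAt Patch.ham γ s := by
      have hmem : y ∈ singularDomain := by
        rw [abs_le] at hy
        constructor <;> linarith
      obtain ⟨ξ, hξ, h₁, h₂⟩ := hhome (i := .singular δ) hmem hp
      rw [hξ]
      exact AnalyticGluing.exists_isFlowAt (G := gluing) (F := Patch.ham) (i := .singular δ)
        ((H₁ y ξ hy h₂ h₁).mono hle₁)
    have hU {i : ℤˣ × ℤˣ} {x : ℝ × ℝ} (hx : x.2 ≤ 1 / 2)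
        (hp : z.proj = Patch.param (.scriU i) x) : ∃ γ, γ 0 = z ∧
          ∀ s ∈ Set.Ioo (-ε) ε, gluing.IsFlowAt Patch.ham γ s := by
      obtain ⟨ξ, hξ, h₁, h₂⟩ := hhome (i := .scriU i) trivial hp
      rw [hξ] at hH hE ⊢
      exact hscri i x ξ hx hH hE
    obtain ⟨m, hm⟩ : ∃ m : SurfacePoint, m = z.proj := ⟨_, rfl⟩
    cases m with
    | kruskal ε' x =>
      obtain ⟨x, hx⟩ := x
      have hpos := (lambertW_spec (mem_kruskalDomain.1 hx)).1
      have hm' : z.proj = kruskalPoint ε' x := by rw [kruskalPoint_of_mem ε' hx]; exact hm.symm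
      -- As `r = 1 + W`, the cases are `r < 1/4`, that is `|x| < 1/2`; then `1/4 ≤ r ≤ 2`; and `r >
      -- 2`, that is `s < 1/2`, where `p ≠ 0` because `W ≠ 0`. They match the ranges of the three
      -- uniform times.
      rcases lt_or_ge (lambertW (x.1 * x.2)) (-(3 / 4)) with hW | hW
      · obtain ⟨δ, t, hy⟩ := exists_kruskalOfSingular hx (by linarith) ε'
        have hroot : 0 < √(1 + lambertW (x.1 * x.2)) := Real.sqrt_pos.2 (by linarith)
        refine hsing (δ := δ) (y := (t, sgn ε' * √(1 + lambertW (x.1 * x.2)))) ?_ ?_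
        · have h₁ : |sgn ε'| = 1 := by
            rcases Int.units_eq_one_or ε' with rfl | rfl <;> simp [sgn]
          rw [abs_mul, h₁, one_mul, abs_of_pos hroot, Real.sqrt_le_left (by norm_num)]
          linarith
        · rcases Int.units_eq_one_or ε' with rfl | rfl
          · rw [Patch.param_singular_of_pos (by simpa [sgn] using hroot), hy, hm']
          · rw [Patch.param_singular_of_neg (by simpa [sgn] using hroot), hy, hm']
      · rcases le_or_gt (lambertW (x.1 * x.2)) 1 with hW' | hW'
        · obtain ⟨ξ, hξ, h₁, h₂⟩ := hhome (i := .kruskal ε') hx hm'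
          rw [hξ]
          exact AnalyticGluing.exists_isFlowAt (G := gluing) (F := Patch.ham) (i := .kruskal ε')
            ((H₂ x hx ξ hW hW' h₂ h₁).mono hle₂)
        · have hp : x.1 ≠ 0 := by
            intro h₀
            have := lambertW_mul_exp_self (w := 0) (by norm_num)
            rw [zero_mul] at this
            rw [h₀, zero_mul, this] at hW'
            linarith
          obtain ⟨δ, u, hu⟩ := exists_kruskalOfU hx hp
          have hs : 0 < 1 / (1 + lambertW (x.1 * x.2)) := by
            have : 0 < 1 + lambertW (x.1 * x.2) := by linarith
            positivity
          refine hU (i := (ε', δ)) (x := (u, 1 / (1 + lambertW (x.1 * x.2)))) ?_ ?_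
          · exact one_div_le_one_div_of_le two_pos (by linarith)
          · rw [Patch.param_scriU_of_pos hs, hu, hm']
    | singular δ t =>
      exact hsing (δ := δ) (y := (t, 0)) (by norm_num)
        (by rw [Patch.param_singular_of_eq rfl]; exact hm.symm)
    | scriU i u =>
      exact hU (i := i) (x := (u, 0)) (by norm_num)
        (by rw [Patch.param_scriU_of_eq rfl]; exact hm.symm)
    | scriV i v =>
      obtain ⟨ξ, hξ, h₁, h₂⟩ := hhome (i := .scriV i) (x := (v, 0)) trivial
        (by rw [Patch.param_scriV_of_eq rfl]; exact hm.symm)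
      rw [hξ]
      refine AnalyticGluing.exists_isFlowAt (G := gluing) (F := Patch.ham) (i := .scriV i)
        ((H₄ (v, 0) ξ (by norm_num) ?_ ?_ h₁).mono hle₄)
      · rw [← h₂]
        simp [Patch.energy]
      · simpa using mul_self_nonneg ξ.1
    | beyond i x =>
      refine hU (i := i) (x := x.1) (by linarith [x.2]) ?_
      rw [Patch.param_scriU_of_neg x.2, beyondPoint_of_neg i x.2]
      exact hm.symm
  refine AnalyticGluing.exists_complete_flow isExpression_ham
    (lt_min (lt_min hε₁ hε₂) (lt_min hε₃ hε₄)) hloc ?_ ⟨hh.symm, he.symm⟩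
  rintro γ b hγ ⟨h₁, h₂⟩ s hs
  refine ⟨?_, ?_⟩
  · rw [← h₁]
    exact AnalyticGluing.const_of_isFlowAt isExpression_ham
      (fun i x _ ξ => fderiv_hamVF_self _ _) hγ hs
  · rw [← h₂]
    exact AnalyticGluing.const_of_isFlowAt isExpression_energy bracket_energy hγ hs

/-! ### Null completeness -/

theorem hamVF_eq_of_hasDerivAt {h : (ℝ × ℝ) × (ℝ × ℝ) → ℝ} {x ξ : ℝ × ℝ} {a b c d : ℝ}
    (hd : DifferentiableAt ℝ h (x, ξ)) (h₁ : HasDerivAt (fun t => h ((t, x.2), ξ)) a x.1)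
    (h₂ : HasDerivAt (fun t => h ((x.1, t), ξ)) b x.2)
    (h₃ : HasDerivAt (fun t => h (x, (t, ξ.2))) c ξ.1)
    (h₄ : HasDerivAt (fun t => h (x, (ξ.1, t))) d ξ.2) :
    hamVF h (x, ξ) = ((c, d), (-a, -b)) := by
  have l₁ : HasDerivAt (fun t : ℝ => ((t, x.2), ξ)) (((1, 0), 0) : (ℝ × ℝ) × (ℝ × ℝ)) x.1 :=
    ((hasDerivAt_id _).prodMk (hasDerivAt_const _ _)).prodMk (hasDerivAt_const _ _)
  have l₂ : HasDerivAt (fun t : ℝ => ((x.1, t), ξ)) (((0, 1), 0) : (ℝ × ℝ) × (ℝ × ℝ)) x.2 :=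
    ((hasDerivAt_const _ _).prodMk (hasDerivAt_id _)).prodMk (hasDerivAt_const _ _)
  have l₃ : HasDerivAt (fun t : ℝ => (x, (t, ξ.2))) ((0, (1, 0)) : (ℝ × ℝ) × (ℝ × ℝ)) ξ.1 :=
    (hasDerivAt_const _ _).prodMk ((hasDerivAt_id _).prodMk (hasDerivAt_const _ _))
  have l₄ : HasDerivAt (fun t : ℝ => (x, (ξ.1, t))) ((0, (0, 1)) : (ℝ × ℝ) × (ℝ × ℝ)) ξ.2 :=
    (hasDerivAt_const _ _).prodMk ((hasDerivAt_const _ _).prodMk (hasDerivAt_id _))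
  have e₁ := (HasFDerivAt.comp_hasDerivAt x.1 (f := fun t : ℝ => ((t, x.2), ξ))
    hd.hasFDerivAt l₁).unique h₁
  have e₂ := (HasFDerivAt.comp_hasDerivAt x.2 (f := fun t : ℝ => ((x.1, t), ξ))
    hd.hasFDerivAt l₂).unique h₂
  have e₃ := (HasFDerivAt.comp_hasDerivAt ξ.1 (f := fun t : ℝ => (x, (t, ξ.2)))
    hd.hasFDerivAt l₃).unique h₃
  have e₄ := (HasFDerivAt.comp_hasDerivAt ξ.2 (f := fun t : ℝ => (x, (ξ.1, t)))
    hd.hasFDerivAt l₄).unique h₄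
  simp only [hamVF, e₁, e₂, e₃, e₄]

theorem hamVF_eddington (x ξ : ℝ × ℝ) :
    hamVF (Function.uncurry (metricHam eddingtonMetric)) (x, ξ) =
      ((ξ.2, ξ.1 - x.2 ^ 2 * (1 - x.2) * ξ.2),
        (-0, -(-((2 * x.2 - 3 * x.2 ^ 2) / 2 * ξ.2 ^ 2)))) := by
  have hd := (contDiffAt_ham (.scriU 1) x trivial ξ).differentiableAt (by simp)
  refine hamVF_eq_of_hasDerivAt hd ?_ ?_ ?_ ?_ <;>
    simp only [Function.uncurry_apply_pair, metricHam, geodesicHamiltonian_eddingtonMetric]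
  · exact hasDerivAt_const _ _
  · have h₁ : HasDerivAt (fun t : ℝ => t ^ 2 * (1 - t)) (2 * x.2 - 3 * x.2 ^ 2) x.2 := by
      convert! (hasDerivAt_pow 2 x.2).mul ((hasDerivAt_id x.2).const_sub 1) using 1
      simp
      ring
    convert! (((h₁.div_const 2).mul_const (ξ.2 ^ 2)).const_sub (ξ.1 * ξ.2)) using 1
  · convert! ((hasDerivAt_id ξ.1).mul_const ξ.2).sub_const _ using 1
    simp
  · convert! ((hasDerivAt_id ξ.2).const_mul ξ.1).sub
      ((hasDerivAt_pow 2 ξ.2).const_mul (x.2 ^ 2 * (1 - x.2) / 2)) using 1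
    simp
    ring

/-- Every null curve needed below has this form in a suitable patch: constant momentum and constant
velocity, possibly zero. -/
theorem exists_flow_of_straight {i : Patch} {x ξ v : ℝ × ℝ}
    (h : ∀ τ : ℝ, x + τ • v ∈ i.dom ∧ hamVF (Function.uncurry i.ham) (x + τ • v, ξ) = (v, 0)) :
    ∃ γ, γ 0 = covectorAt (gluing.chart i) x ξ ∧ ∀ s, gluing.IsFlowAt Patch.ham γ s := by
  refine ⟨fun τ => covectorAt (gluing.chart i) (x + τ • v) ξ, by simp, fun s =>
    ⟨i, fun τ => (x + τ • v, ξ), Filter.Eventually.of_forall fun τ => ⟨(h τ).1, rfl, ?_⟩⟩⟩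
  rw [(h τ).2]
  have : HasDerivAt (fun τ : ℝ => x + τ • v) v τ := by
    simpa using ((hasDerivAt_id τ).smul_const v).const_add x
  exact this.prodMk (hasDerivAt_const _ _)

/-- For a multiple of `du`, Hamilton's equations reduce to `ds/dτ = a`, everything else being
constant. For `a ≠ 0` the curve crosses `s = 1` and `s = 0` and approaches the singularity `s = ∞`
only in infinite parameter. -/
theorem exists_flow_scriU (i : ℤˣ × ℤˣ) (x : ℝ × ℝ) (a : ℝ) :
    ∃ γ, γ 0 = covectorAt (gluing.chart (.scriU i)) x (a, 0) ∧
      ∀ s, gluing.IsFlowAt Patch.ham γ s :=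
  exists_flow_of_straight (v := (0, a)) fun τ =>
    ⟨trivial, (hamVF_eddington _ _).trans (by ext <;> simp)⟩

theorem exists_flow_scriV (i : ℤˣ × ℤˣ) (x : ℝ × ℝ) (a : ℝ) :
    ∃ γ, γ 0 = covectorAt (gluing.chart (.scriV i)) x (a, 0) ∧
      ∀ s, gluing.IsFlowAt Patch.ham γ s :=
  exists_flow_of_straight (v := (0, a)) fun τ =>
    ⟨trivial, (hamVF_eddington _ _).trans (by ext <;> simp)⟩

/-- The function `s²(1 - s)` has a double zero at `s = 0`, so neither `s` nor its momentum changes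
and `u` is affine in the parameter. -/
theorem exists_flow_along_scriU (i : ℤˣ × ℤˣ) (u a : ℝ) :
    ∃ γ, γ 0 = covectorAt (gluing.chart (.scriU i)) (u, 0) (0, a) ∧
      ∀ s, gluing.IsFlowAt Patch.ham γ s :=
  exists_flow_of_straight (v := (a, 0)) fun τ =>
    ⟨trivial, (hamVF_eddington _ _).trans (by ext <;> simp)⟩

theorem exists_flow_along_scriV (i : ℤˣ × ℤˣ) (v a : ℝ) :
    ∃ γ, γ 0 = covectorAt (gluing.chart (.scriV i)) (v, 0) (0, a) ∧
      ∀ s, gluing.IsFlowAt Patch.ham γ s :=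
  exists_flow_of_straight (v := (a, 0)) fun τ =>
    ⟨trivial, (hamVF_eddington _ _).trans (by ext <;> simp)⟩

/-- Near `x = 0` the Hamiltonian depends on `x` and `X` only through `x⁶`, `x²X²` and `X²` up to
higher order, so its differential vanishes at `x = X = 0` and the curve is constant. -/
theorem exists_flow_singular (δ : ℤˣ) (t a : ℝ) :
    ∃ γ, γ 0 = covectorAt (gluing.chart (.singular δ)) (t, 0) (a, 0) ∧
      ∀ s, gluing.IsFlowAt Patch.ham γ s := by
  have hmem : ((t, 0) : ℝ × ℝ) ∈ singularDomain := by constructor <;> norm_num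
  refine exists_flow_of_straight (v := 0) fun τ => ?_
  rw [smul_zero, add_zero]
  refine ⟨hmem, ?_⟩
  have hd := (contDiffAt_ham (.singular δ) _ hmem (a, 0)).differentiableAt (by simp)
  rw [hamVF_eq_of_hasDerivAt (a := 0) (b := 0) (c := 0) (d := 0) hd]
  · simp
  · simpa [Patch.ham, singularHamiltonian] using hasDerivAt_const t (0 : ℝ)
  · have h₁ : HasDerivAt (fun s : ℝ => 4 * s ^ 6 * a ^ 2) 0 0 := by
      simpa using ((hasDerivAt_pow 6 (0 : ℝ)).const_mul 4).mul_const (a ^ 2)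
    have h₂ : HasDerivAt (fun s : ℝ => 8 * (s ^ 2 - 1)) 0 0 := by
      simpa using ((hasDerivAt_pow 2 (0 : ℝ)).sub_const 1).const_mul 8
    have := h₁.fun_div h₂ (by norm_num)
    simpa [Patch.ham, singularHamiltonian] using this
  · simpa [Patch.ham, singularHamiltonian] using hasDerivAt_const a (0 : ℝ)
  · have := ((hasDerivAt_pow 2 (0 : ℝ)).const_mul (-1 : ℝ)).div_const (-8)
    simpa [Patch.ham, singularHamiltonian] using this

theorem lambertW_zero : lambertW 0 = 0 := by
  simpa using lambertW_mul_exp_self (w := 0) (by norm_num)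

/-- The horizon `p = 0` is not in the `(u, s)` patches of this Kruskal–Szekeres patch. On it `W(pq)
= 0`, and since `H` vanishes identically for covectors `a dp`, only its derivative `-a/2` in the
momentum of `q` survives. -/
theorem exists_flow_kruskal_fst (ε : ℤˣ) (q a : ℝ) :
    ∃ γ, γ 0 = covectorAt (gluing.chart (.kruskal ε)) (0, q) (a, 0) ∧
      ∀ s, gluing.IsFlowAt Patch.ham γ s := by
  refine exists_flow_of_straight (v := (0, -(1 / 2) * a)) fun τ => ?_
  have e : ((0, q) : ℝ × ℝ) + τ • (0, -(1 / 2) * a) = (0, q + τ * (-(1 / 2) * a)) := by simp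
  rw [e]
  generalize q + τ * (-(1 / 2) * a) = q
  have hmem : ((0, q) : ℝ × ℝ) ∈ kruskalDomain := by rw [mem_kruskalDomain]; norm_num
  have hd := (contDiffAt_ham (.kruskal ε) _ hmem (a, 0)).differentiableAt (by simp)
  have hev {c : ℝ → ℝ × ℝ} {s : ℝ} (hc : Continuous c) (h0 : c s ∈ kruskalDomain) :
      (fun s => metricHam kruskalMetric (c s) (a, 0)) =ᶠ[𝓝 s] fun _ => 0 := by
    filter_upwards [hc.continuousAt.eventually (isOpen_kruskalDomain.mem_nhds h0)] with s hs
    simp [metricHam, geodesicHamiltonian_kruskalMetric hs]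
  refine ⟨hmem, ?_⟩
  rw [hamVF_eq_of_hasDerivAt (a := 0) (b := 0) (c := 0) (d := -(1 / 2) * a) hd]
  · simp
  · exact (hasDerivAt_const (0 : ℝ) (0 : ℝ)).congr_of_eventuallyEq
      (hev (c := fun t => (t, q)) (by fun_prop) hmem)
  · exact (hasDerivAt_const q (0 : ℝ)).congr_of_eventuallyEq
      (hev (c := fun t => (0, t)) (by fun_prop) hmem)
  · simp only [Patch.ham, Function.uncurry_apply_pair, metricHam,
      geodesicHamiltonian_kruskalMetric hmem, mul_zero]
    exact hasDerivAt_const _ _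
  · simp only [Patch.ham, Function.uncurry_apply_pair, metricHam,
      geodesicHamiltonian_kruskalMetric hmem, zero_mul, lambertW_zero]
    simpa using ((hasDerivAt_id (0 : ℝ)).const_mul a).const_mul (-(1 / 2) : ℝ)

theorem exists_flow_kruskal_snd (ε : ℤˣ) (p a : ℝ) :
    ∃ γ, γ 0 = covectorAt (gluing.chart (.kruskal ε)) (p, 0) (0, a) ∧
      ∀ s, gluing.IsFlowAt Patch.ham γ s := by
  refine exists_flow_of_straight (v := (-(1 / 2) * a, 0)) fun τ => ?_
  have e : ((p, 0) : ℝ × ℝ) + τ • (-(1 / 2) * a, 0) = (p + τ * (-(1 / 2) * a), 0) := by simp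
  rw [e]
  generalize p + τ * (-(1 / 2) * a) = p
  have hmem : ((p, 0) : ℝ × ℝ) ∈ kruskalDomain := by rw [mem_kruskalDomain]; norm_num
  have hd := (contDiffAt_ham (.kruskal ε) _ hmem (0, a)).differentiableAt (by simp)
  have hev {c : ℝ → ℝ × ℝ} {s : ℝ} (hc : Continuous c) (h0 : c s ∈ kruskalDomain) :
      (fun s => metricHam kruskalMetric (c s) (0, a)) =ᶠ[𝓝 s] fun _ => 0 := by
    filter_upwards [hc.continuousAt.eventually (isOpen_kruskalDomain.mem_nhds h0)] with s hs
    simp [metricHam, geodesicHamiltonian_kruskalMetric hs]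
  refine ⟨hmem, ?_⟩
  rw [hamVF_eq_of_hasDerivAt (a := 0) (b := 0) (c := -(1 / 2) * a) (d := 0) hd]
  · simp
  · exact (hasDerivAt_const p (0 : ℝ)).congr_of_eventuallyEq
      (hev (c := fun t => (t, 0)) (by fun_prop) hmem)
  · exact (hasDerivAt_const (0 : ℝ) (0 : ℝ)).congr_of_eventuallyEq
      (hev (c := fun t => (p, t)) (by fun_prop) hmem)
  · simp only [Patch.ham, Function.uncurry_apply_pair, metricHam,
      geodesicHamiltonian_kruskalMetric hmem, mul_zero, lambertW_zero]
    simpa using ((hasDerivAt_id (0 : ℝ)).mul_const a).const_mul (-(1 / 2) : ℝ)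
  · simp only [Patch.ham, Function.uncurry_apply_pair, metricHam,
      geodesicHamiltonian_kruskalMetric hmem, zero_mul, mul_zero]
    exact hasDerivAt_const _ _

theorem exists_flow_of_null {z : CotangentBundle Surface} (hz : stringHam z = 0) :
    ∃ γ, γ 0 = z ∧ ∀ s, gluing.IsFlowAt Patch.ham γ s := by
  have hhome {i : Patch} {x : ℝ × ℝ} (hx : x ∈ i.dom) (hp : z.proj = i.param x) :
      ∃ ξ, z = covectorAt (gluing.chart i) x ξ ∧ i.ham x ξ = 0 := by
    obtain ⟨ξ, hξ⟩ := gluing.exists_eq_covectorAt hx hp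
    exact ⟨ξ, hξ, by rw [← hz, hξ, stringHam_covectorAt _ _ hx]⟩
  obtain ⟨m, hm⟩ : ∃ m : SurfacePoint, m = z.proj := ⟨_, rfl⟩
  have hedd {x ξ : ℝ × ℝ} (h : metricHam eddingtonMetric x ξ = 0) (hξ : ξ.2 ≠ 0) :
      ξ.1 = x.2 ^ 2 * (1 - x.2) / 2 * ξ.2 := by
    rw [metricHam, geodesicHamiltonian_eddingtonMetric] at h
    exact mul_right_cancel₀ hξ (by linarith)
  cases m with
  | kruskal ε x =>
    obtain ⟨x, hx⟩ := x
    have hm' : z.proj = kruskalPoint ε x := by rw [kruskalPoint_of_mem ε hx]; exact hm.symm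
    obtain ⟨⟨ξ₁, ξ₂⟩, rfl, h⟩ := hhome (i := .kruskal ε) hx hm'
    have hW : 0 < 1 + lambertW (x.1 * x.2) := by
      linarith [(lambertW_spec (mem_kruskalDomain.1 hx)).1]
    have hs : 0 < 1 / (1 + lambertW (x.1 * x.2)) := by positivity
    simp only [Patch.ham, metricHam, geodesicHamiltonian_kruskalMetric hx] at h
    have hk : -(Real.exp (lambertW (x.1 * x.2)) * (1 + lambertW (x.1 * x.2)) ^ 3 / 2) ≠ 0 :=
      neg_ne_zero.2 (by positivity)
    -- `H` is a nonzero multiple of `ξ₁ξ₂`, so the covector is a multiple of `dq` or of `dp`. It is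
    -- handled in a `(v, s)` or `(u, s)` patch, except on the horizon that those patches omit.
    rcases mul_eq_zero.1 ((mul_eq_zero.1 h).resolve_left hk) with rfl | rfl
    · by_cases hq : x.2 = 0
      · have e : x = (x.1, 0) := Prod.ext rfl hq
        rw [e]
        exact exists_flow_kruskal_snd ε x.1 ξ₂
      · obtain ⟨δ, v, hv⟩ := exists_kruskalOfV hx hq
        obtain ⟨b, hb⟩ := covectorAt_scriV_eq_kruskal ε δ
          (x := (v, 1 / (1 + lambertW (x.1 * x.2)))) hs ξ₂
        rw [hv] at hb
        rw [← hb]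
        exact exists_flow_scriV _ _ b
    · by_cases hp : x.1 = 0
      · have e : x = (0, x.2) := Prod.ext hp rfl
        rw [e]
        exact exists_flow_kruskal_fst ε x.2 ξ₁
      · obtain ⟨δ, u, hu⟩ := exists_kruskalOfU hx hp
        obtain ⟨b, hb⟩ := covectorAt_scriU_eq_kruskal ε δ
          (x := (u, 1 / (1 + lambertW (x.1 * x.2)))) hs ξ₁
        rw [hu] at hb
        rw [← hb]
        exact exists_flow_scriU _ _ b
  | singular δ t =>
    have hmem : ((t, 0) : ℝ × ℝ) ∈ singularDomain := by constructor <;> norm_num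
    obtain ⟨⟨ξ₁, ξ₂⟩, rfl, h⟩ := hhome (i := .singular δ) hmem
      (by rw [Patch.param_singular_of_eq rfl]; exact hm.symm)
    have h₀ : ξ₂ = 0 := by simpa [Patch.ham, singularHamiltonian] using h
    rw [h₀]
    exact exists_flow_singular δ t ξ₁
  | scriU i u =>
    obtain ⟨⟨ξ₁, ξ₂⟩, rfl, h⟩ := hhome (i := .scriU i) (x := (u, 0)) trivial
      (by rw [Patch.param_scriU_of_eq rfl]; exact hm.symm)
    by_cases h₀ : ξ₂ = 0
    · rw [h₀]
      exact exists_flow_scriU i _ ξ₁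
    · have h₁ : ξ₁ = 0 := by simpa using hedd h h₀
      rw [h₁]
      exact exists_flow_along_scriU i u ξ₂
  | scriV i v =>
    obtain ⟨⟨ξ₁, ξ₂⟩, rfl, h⟩ := hhome (i := .scriV i) (x := (v, 0)) trivial
      (by rw [Patch.param_scriV_of_eq rfl]; exact hm.symm)
    by_cases h₀ : ξ₂ = 0
    · rw [h₀]
      exact exists_flow_scriV i _ ξ₁
    · have h₁ : ξ₁ = 0 := by simpa using hedd h h₀
      rw [h₁]
      exact exists_flow_along_scriV i v ξ₂
  | beyond i x =>
    obtain ⟨x, hx⟩ := x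
    obtain ⟨⟨ξ₁, ξ₂⟩, rfl, h⟩ := hhome (i := .scriU i) (x := x) trivial
      (by rw [Patch.param_scriU_of_neg hx, beyondPoint_of_neg i hx]; exact hm.symm)
    by_cases h₀ : ξ₂ = 0
    · rw [h₀]
      exact exists_flow_scriU i _ ξ₁
    · have hf : x.2 ^ 2 * (1 - x.2) ≠ 0 := mul_ne_zero (pow_ne_zero 2 hx.ne) (by linarith)
      have h₁ : ξ₁ = x.2 ^ 2 * (1 - x.2) / 2 * ξ₂ := hedd h h₀
      -- A null covector beyond scri that is not a multiple of `du` is a multiple of `dv`, hence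
      -- straight in the `(v, s)` patch.
      have e : ((-(-ξ₁), 0 - 2 / (x.2 ^ 2 * (1 - x.2)) * -ξ₁) : ℝ × ℝ) = (ξ₁, ξ₂) := by
        ext
        · simp
        · simp only [h₁]
          generalize x.2 ^ 2 * (1 - x.2) = f at hf
          field_simp
          ring
      have hcov := covectorAt_scriU_eq_scriV i hx.ne (by linarith) (-ξ₁, 0)
      simp only [e] at hcov
      rw [hcov]
      exact exists_flow_scriV i _ (-ξ₁)

theorem timelikeAndNullComplete_stringHam : TimelikeAndNullComplete stringHam := by
  intro z hz
  obtain ⟨γ, h₀, hγ⟩ := hz.elim exists_flow_of_timelike exists_flow_of_null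
  exact ⟨γ, h₀, fun s => (hγ s).hamiltonEquationsAt isExpression_ham⟩

end SchwarzschildString

end

open SchwarzschildString in
theorem theorem1 :
    ∃ (S : Type) (_ : TopologicalSpace S) (_ : ChartedSpace (ℝ × ℝ) S)
      (_ : IsManifold 𝓘(ℝ, ℝ × ℝ) ω S) (A : Patches S) (H : CotangentBundle S → ℝ),
      T2Space S ∧ SecondCountableTopology S ∧ ConnectedSpace S ∧
      IsGluing A ∧
      ContMDiff (𝓘(ℝ, ℝ × ℝ).prod 𝓘(ℝ, (ℝ × ℝ) →L[ℝ] ℝ)) 𝓘(ℝ, ℝ) ω H ∧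
      IsStringHamiltonian A H ∧
      TimelikeAndNullComplete H := by
  refine ⟨Surface, inferInstance, inferInstance, inferInstance, patches, stringHam,
    t2Space_surface, secondCountableTopology_surface, connectedSpace_surface, isGluing_patches, ?_,
    isStringHamiltonian, timelikeAndNullComplete_stringHam⟩
  exact gluing.contMDiff_of_covectorAt stringHam_covectorAt contDiffAt_ham
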